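/- **Cyclic trees, preproofs.** A derivation system has sequents and rules, each rule having a conclusion and a finite list of premises. A preproof is a finite tree of sequents built with the rules, some of whose leaves may be open (assumptions) and some of whose leaves $t$ (buds) are assigned a companion $\beta(t)$, a proper ancestor of $t$ labelled by the same sequent. A preproof morphism $f$ maps sequents to sequents and each rule to a preproof of the translated conclusion whose open leaves are, in order, the translated premises; it maps a preproof $\Pi$ to the preproof $f(\Pi)$ in which every rule is replaced by its image and the image of a bud leads back to the root of the image of its companion. **Unfolding.** A single unfolding step at a bud $t$ replaces $t$ by a copy of the part of the current preproof above $\beta(t)$, the node $tu$ being a copy of $\beta(t)u$. A copy of a bud $s$ is again a bud, whose companion is any proper ancestor that is a copy of the same node of the original preproof as $\beta(s)$. An unfolding of $\Pi$ is a preproof obtained from $\Pi$ by finitely many such steps. **Cyclic Gödel's T ($\mathit{CGT}$).** Types: $A ::= N \mid A\to A$. Sequents: $\Gamma\Rightarrow A$ with $\Gamma$ a finite list of types. Rules (premises / conclusion): $\mathrm{Id}$: $/\,A\Rightarrow A$; $0$: $/\,\Rightarrow N$; $\mathrm S$: $/\,N\Rightarrow N$; $\mathrm L$: $\Gamma\Rightarrow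 A$ and $\Gamma,B\Rightarrow C\,/\,\Gamma,A\to B\Rightarrow C$; $\mathrm R$: $\Gamma,A\Rightarrow B\,/\,\Gamma\Rightarrow A\to B$; $\mathrm{Cond}$: $\Gamma\Rightarrow A$ and $\Gamma,N\Rightarrow A\,/\,\Gamma,N\Rightarrow A$; $\mathrm{Ex}$: $\Gamma,A,B,\Delta\Rightarrow C\,/\,\Gamma,B,A,\Delta\Rightarrow C$; $\mathrm{Wk}$: $\Gamma\Rightarrow B\,/\,\Gamma,A\Rightarrow B$; $\mathrm{Ctr}$: $\Gamma,A,A\Rightarrow B\,/\,\Gamma,A\Rightarrow B$; $\mathrm{Cut}$: $\Gamma\Rightarrow B$ and $\Gamma,B\Rightarrow A\,/\,\Gamma\Rightarrow A$. Traces: every occurrence of $N$ in the context of a conclusion is connected to its corresponding occurrences in the contexts of the premises (two for a contracted $N$, none in a premise from which it has been deleted), with value $0$, except that the displayed $N$ of $\mathrm{Cond}$ is connected to the displayed $N$ of the right premise with value $1$. A $\mathit{CGT}$-proof is a preproof without assumptions such that every infinite branch (continuing from each bud at its companion) carries, from some point on, a trace that has value $1$ infinitely often. $\mathit{CGT}\vdash\Gamma\Rightarrow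 A$ via $\Pi$ means that $\Pi$ is a $\mathit{CGT}$-proof with endsequent $\Gamma\Rightarrow A$. **Reset Gödel's T ($\mathit{RGT}$).** Sequents: $\Theta\mid\Gamma\Rightarrow A$, where the control $\Theta$ is a finite sequence of distinct letters, $A$ is a type, and $\Gamma$ is a list of types $B^u$ annotated by subsequences $u$ of $\Theta$, with $u=\varepsilon$ unless $B=N$. Below, $\Theta'$ in a premise is $\Theta$ without the letters that occur in no annotation of that premise. Rules: $\mathrm{Id}$: $/\,\Theta\mid A^u\Rightarrow A$; $0$: $/\,\Theta\mid\;\Rightarrow N$; $\mathrm S$: $/\,\Theta\mid N^u\Rightarrow N$; $\mathrm L$: $\Theta'\mid\Gamma\Rightarrow A$ and $\Theta\mid\Gamma,B^u\Rightarrow C\,/\,\Theta\mid\Gamma,(A\to B)^u\Rightarrow C$; $\mathrm R$: $\Theta\mid\Gamma,A^\varepsilon\Rightarrow B\,/\,\Theta\mid\Gamma\Rightarrow A\to B$; $\mathrm{Cond}$: $\Theta'\mid\Gamma\Rightarrow A$ and $\Theta a\mid\Gamma,N^{ua}\Rightarrow A\,/\,\Theta\mid\Gamma,N^u\Rightarrow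 A$ with $a\notin\Theta$; $\mathrm{Ex}$: $\Theta\mid\Gamma,A^v,B^u,\Delta\Rightarrow C\,/\,\Theta\mid\Gamma,B^u,A^v,\Delta\Rightarrow C$; $\mathrm{Wk}$: $\Theta'\mid\Gamma\Rightarrow B\,/\,\Theta\mid\Gamma,A^u\Rightarrow B$; $\mathrm{Ctr}$: $\Theta\mid\Gamma,A^u,A^u\Rightarrow B\,/\,\Theta\mid\Gamma,A^u\Rightarrow B$; $\mathrm{Cut}$: $\Theta\mid\Gamma\Rightarrow B$ and $\Theta\mid\Gamma,B^\varepsilon\Rightarrow A\,/\,\Theta\mid\Gamma\Rightarrow A$; $\mathrm{Reset}_a$: $\Theta'\mid\Gamma'\Rightarrow B\,/\,\Theta\mid\Gamma\Rightarrow B$, where $a$ occurs in some annotation in $\Gamma$, all annotations in $\Gamma$ containing $a$ are of the form $u\,a\,u_i$ with the same $u$ and with $u_i\neq\varepsilon$, and $\Gamma'$ arises from $\Gamma$ by replacing each of these by $ua$. An $\mathit{RGT}$-proof is a preproof without assumptions such that for every bud $t$ there is a letter $a$ which occurs in all controls on the path from $\beta(t)$ to $t$, such that the part of the control preceding $a$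 is constant along this path and $\mathrm{Reset}_a$ is applied on it. $\mathit{RGT}\vdash\Gamma\Rightarrow A$ via $\Pi'$ means that $\Pi'$ is an $\mathit{RGT}$-proof with endsequent $\varepsilon\mid\Gamma^\varepsilon\Rightarrow A$, all annotations being empty. **Embed and strip.** Let $\mathrm R(\mathit{CGT})$ be the reset proof system induced by $\mathit{CGT}$: its sequents are $\mathit{CGT}$-sequents together with a Safra board on the occurrences of $N$ in the context, i.e. a finite linear order $\Theta$ of chips and a map $\sigma$ from pairs (occurrence, value in $\{0,1\}$) to sets of stacks $S\subseteq\Theta$ in which every chip of $\Theta$ occurs in some stack; its rules are the $\mathit{CGT}$-rules, each premise carrying a successor of the board of the conclusion along the trace relation (stacks are moved along the traces, chips no longer occurring are deleted, and every stack arriving at a position $(y,1)$ is put back to $(y,0)$ with a new chip, depending on $y$ only, on top), and the unary structural rules of weakening (stacks are removed), $\gamma$-reset (for a chip $\gamma$ on top of no stack, all chips above $\gamma$ are removed from the stacks containing $\gamma$) and population (empty stacks are added at positions $(x,0)$). The morphism $\mathit{embed}:\mathit{RGT}\to\mathrm R(\mathit{CGT})$ sends $\Theta\mid\Gamma\Rightarrow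 A$ to the sequent without annotations with the board whose chips are the letters of $\Theta$ occurring in $\Gamma$, in their order, and in which the $i$-th occurrence $N^u$ of $N$ has the set of letters of $u$ as its only stack, at value $0$; it sends $\mathrm{Reset}_a$ to the $a$-reset and every other rule to the corresponding rule of $\mathrm R(\mathit{CGT})$, followed by a population above each premise in which a new $N$ has been introduced. The morphism $\mathit{strip}:\mathrm R(\mathit{CGT})\to\mathit{CGT}$ forgets the boards and omits the structural rules. **Theorem (Completeness of reset Gödel's T).** If $\mathit{CGT}\vdash\Gamma\Rightarrow A$ via $\Pi$, then $\mathit{RGT}\vdash\Gamma\Rightarrow A$ via some proof $\Pi'$ such that $\mathit{strip}(\mathit{embed}(\Pi'))$ is an unfolding of $\Pi$. -/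

import Mathlib

namespace CyclicProofs

/-! ### Derivation systems and preproofs -/

/-- A derivation system: sequents, rules, and for each rule its conclusion and the finite
list of its premises. -/
structure DerivSys where
  Seq : Type
  Rule : Type
  arity : Rule → ℕ
  concl : Rule → Seq
  prem : (r : Rule) → Fin (arity r) → Seq

/-- Cyclic trees labelled by the rules of `D`.  Nodes are addressed by lists of natural numbers,
the `i`-th premise of the node `t` being `t ++ [i]`.  As the companion of a bud is a proper prefix
of the bud, it is recorded by its length: `bud Γ l` at address `t` is a bud with sequent `Γ` and
companion `t.take l`.  Open leaves carry labels from `V`; for preproofs `V` is the set of sequents,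
for the derivations that interpret an `n`-ary rule `V` is `Fin n`. -/
inductive PTree (D : DerivSys) (V : Type) : Type
  | opn (v : V) : PTree D V
  | bud (Γ : D.Seq) (l : ℕ) : PTree D V
  | node (r : D.Rule) (ts : Fin (D.arity r) → PTree D V) : PTree D V

namespace PTree

variable {D : DerivSys} {V W : Type}

/-- The sequent at the root, if the open leaf `v` carries the sequent `lab v`. -/
def root (lab : V → D.Seq) : PTree D V → D.Seq
  | opn v => lab v
  | bud Γ _ => Γ
  | node r _ => D.concl r

/-- Correctness of the labelling below ancestors with sequents `anc` (root first): each rule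
is applied to the right premises, and a bud has a proper ancestor as companion, with the same
sequent. -/
def Wf (lab : V → D.Seq) : PTree D V → List D.Seq → Prop
  | opn _, _ => True
  | bud Γ l, anc => anc[l]? = some Γ
  | node r ts, anc =>
      ∀ i, (ts i).root lab = D.prem r i ∧ (ts i).Wf lab (anc ++ [D.concl r])

/-- The labels of the open leaves, from left to right. -/
def opens : PTree D V → List V
  | opn v => [v]
  | bud _ _ => []
  | node _ ts => (List.ofFn fun i => (ts i).opens).flatten

/-- The part of the tree above the node with a given address (`none` if there is no such node). -/
def sub : PTree D V → List ℕ → Option (PTree D V)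
  | t, [] => some t
  | node r ts, i :: a => if h : i < D.arity r then (ts ⟨i, h⟩).sub a else none
  | opn _, _ :: _ => none
  | bud _ _, _ :: _ => none

end PTree

/-- Labels of the nodes of a cyclic tree. -/
inductive Label (D : DerivSys) (V : Type) : Type
  | opn (v : V) : Label D V
  | bud (Γ : D.Seq) (l : ℕ) : Label D V
  | rule (r : D.Rule) : Label D V

/-- The label of the root. -/
def PTree.rootLabel {D : DerivSys} {V : Type} : PTree D V → Label D V
  | .opn v => .opn v
  | .bud Γ l => .bud Γ l
  | .node r _ => .rule r

/-- The label of the node with a given address (`none` if there is no such node). -/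
def PTree.label {D : DerivSys} {V : Type} (P : PTree D V) (a : List ℕ) : Option (Label D V) :=
  (P.sub a).map PTree.rootLabel

/-- Trees all of whose open leaves are labelled by sequents. -/
abbrev SeqTree (D : DerivSys) : Type := PTree D D.Seq

/-- The endsequent. -/
def SeqTree.endseq {D : DerivSys} (P : SeqTree D) : D.Seq := PTree.root id P

/-- `P` is a preproof of `D`. -/
def IsPreproof {D : DerivSys} (P : SeqTree D) : Prop := PTree.Wf id P []

/-! ### Preproof morphisms -/

/-- Replace each open leaf `v`, at depth `d`, by `k v d`; the tree itself is placed at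
depth `d₀`. -/
def PTree.graft {D : DerivSys} {V W : Type} (k : V → ℕ → PTree D W) (d₀ : ℕ) :
    PTree D V → ℕ → PTree D W
  | .opn v, d => k v d
  | .bud Γ l, _ => .bud Γ (d₀ + l)
  | .node r ts, d => .node r (fun i => (ts i).graft k d₀ (d + 1))

/-- A preproof morphism translates sequents, and each rule `r` of `D` into a preproof of `E`
that ends in the translated conclusion and has the translated premises, in this order, as its
open leaves. -/
structure PreproofMorphism (D E : DerivSys) where
  seq : D.Seq → E.Seq
  tmpl : (r : D.Rule) → PTree E (Fin (D.arity r))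
  root_eq : ∀ r, (tmpl r).root (fun i => seq (D.prem r i)) = seq (D.concl r)
  wf : ∀ r, (tmpl r).Wf (fun i => seq (D.prem r i)) []
  opens_eq : ∀ r, (tmpl r).opens = List.finRange (D.arity r)

/-- Translation of a part of a preproof; `env` lists the depths of the images of the
ancestors, `d` is the depth at which the image is placed. -/
def PreproofMorphism.trans {D E : DerivSys} (f : PreproofMorphism D E) :
    SeqTree D → List ℕ → ℕ → SeqTree E
  | .opn Γ, _, _ => .opn (f.seq Γ)
  | .bud Γ l, env, _ => .bud (f.seq Γ) (env.getD l 0)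
  | .node r ts, env, d =>
      (f.tmpl r).graft (fun i d' => f.trans (ts i) (env ++ [d]) d') d d

/-- The image of a preproof: every rule is replaced by its interpretation, and the image of a bud
leads back to the root of the image of its companion. -/
def PreproofMorphism.apply {D E : DerivSys} (f : PreproofMorphism D E) (P : SeqTree D) :
    SeqTree E :=
  f.trans P [] 0

/-! ### Unfoldings -/

/-- One unfolding step from `P` to `P'`, at the bud `t` of `P` with companion `c = t.take l`.
Here `o` (for `P`) and `o'` (for `P'`) assign to each node the node of the initial preproof of
which it is a copy.  The bud `t` is replaced by a copy of the part of `P` above `c`: the node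
`t ++ u` copies `c ++ u`.  The copy of a bud `s` is again a bud; its companion is a proper
ancestor that is a copy of the same initial node as the companion of `s`. -/
def UnfoldStep {D : DerivSys} (P : SeqTree D) (o : List ℕ → List ℕ)
    (P' : SeqTree D) (o' : List ℕ → List ℕ) : Prop :=
  ∃ (t : List ℕ) (Γ : D.Seq) (l : ℕ), P.label t = some (.bud Γ l) ∧
    (∀ a, ¬ t <+: a → P'.label a = P.label a ∧ o' a = o a) ∧
    (∀ u, o' (t ++ u) = o (t.take l ++ u)) ∧
    (∀ u, (∀ Δ m, P.label (t.take l ++ u) ≠ some (.bud Δ m)) →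
      P'.label (t ++ u) = P.label (t.take l ++ u)) ∧
    (∀ u Δ m, P.label (t.take l ++ u) = some (.bud Δ m) →
      ∃ m', m' < (t ++ u).length ∧ P'.label (t ++ u) = some (.bud Δ m') ∧
        o' ((t ++ u).take m') = o ((t.take l ++ u).take m))

/-- `P'`, with the assignment `o` of initial nodes, arises from `P` by finitely many
unfolding steps. -/
inductive UnfoldsTo {D : DerivSys} (P : SeqTree D) : SeqTree D → (List ℕ → List ℕ) → Prop
  | refl : UnfoldsTo P P id
  | step {Q Q' : SeqTree D} {o o' : List ℕ → List ℕ} :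
      UnfoldsTo P Q o → UnfoldStep Q o Q' o' → UnfoldsTo P Q' o'

/-- `P'` is an unfolding of `P`. -/
def IsUnfolding {D : DerivSys} (P P' : SeqTree D) : Prop := ∃ o, UnfoldsTo P P' o

/-! ### Activated traces and the global trace condition

Throughout, `A` is the join-semilattice of an activation algebra, with least element `⊥` and
activation element `α`.  The trace objects are finite sets of natural numbers. -/

/-- Relations `R ⊆ ℕ × A × ℕ`, given by `R x a y`. -/
abbrev TraceRel (A : Type) : Type := ℕ → A → ℕ → Prop

/-- The identity morphism on `X`. -/
def idRel {A : Type} [SemilatticeSup A] [OrderBot A] (X : Finset ℕ) : TraceRel A :=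
  fun x a y => x ∈ X ∧ a = ⊥ ∧ x = y

/-- Composition (first `R`, then `R'`). -/
def compRel {A : Type} [SemilatticeSup A] (R R' : TraceRel A) : TraceRel A :=
  fun x c z => ∃ y a b, R x a y ∧ R' y b z ∧ a ⊔ b = c

/-- The composite of the `n + 1` consecutive steps `τ i, …, τ (i + n)`. -/
def compSteps {A : Type} [SemilatticeSup A] (τ : ℕ → TraceRel A) (i : ℕ) : ℕ → TraceRel A
  | 0 => τ i
  | n + 1 => compRel (compSteps τ i n) (τ (i + n + 1))

/-- The trace condition: along some subpath, given by a strictly monotone `S`, there is a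
sequence of points in which any two consecutive ones are related by the value `α`. -/
def TraceCondition {A : Type} [SemilatticeSup A] (α : A) (τ : ℕ → TraceRel A) : Prop :=
  ∃ (S : ℕ → ℕ) (x : ℕ → ℕ), StrictMono S ∧
    ∀ i, compSteps τ (S i) (S (i + 1) - S i - 1) (x i) α (x (i + 1))

/-- A trace interpretation of `D`. -/
structure TraceInterp (D : DerivSys) (A : Type) where
  obj : D.Seq → Finset ℕ
  mor : (r : D.Rule) → Fin (D.arity r) → TraceRel A
  mor_supp : ∀ r i x a y, mor r i x a y → x ∈ obj (D.concl r) ∧ y ∈ obj (D.prem r i)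

/-- `BranchStep ι P s t R`: a branch through `P` can proceed from `s` to `t`, and the induced
morphism is `R`. -/
inductive BranchStep {D : DerivSys} {A : Type} [SemilatticeSup A] [OrderBot A]
    (ι : TraceInterp D A) (P : SeqTree D) : List ℕ → List ℕ → TraceRel A → Prop
  | child (s : List ℕ) (r : D.Rule) (ts : Fin (D.arity r) → SeqTree D) (i : Fin (D.arity r)) :
      P.sub s = some (.node r ts) → BranchStep ι P s (s ++ [i.1]) (ι.mor r i)
  | back (s : List ℕ) (Γ : D.Seq) (l : ℕ) :
      P.sub s = some (.bud Γ l) → BranchStep ι P s (s.take l) (idRel (ι.obj Γ))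

/-- `P` is a proof in the cyclic proof system induced by `ι`: a preproof without assumptions
such that every infinite branch satisfies the trace condition. -/
def IsTraceProof {D : DerivSys} {A : Type} [SemilatticeSup A] [OrderBot A] (α : A)
    (ι : TraceInterp D A) (P : SeqTree D) : Prop :=
  IsPreproof P ∧ P.opens = [] ∧
    ∀ (π : ℕ → List ℕ) (τ : ℕ → TraceRel A), π 0 = [] →
      (∀ i, BranchStep ι P (π i) (π (i + 1)) (τ i)) → TraceCondition α τ

/-! ### Safra boards -/

/-- The data of a Safra board; chips are natural numbers, and a finite linear order of chips is
a list without repetitions, least chip first. -/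
structure Board (A : Type) where
  control : List ℕ
  σ : ℕ → A → Set (Finset ℕ)

/-- `b` is a Safra board on `X`. -/
def IsBoard {A : Type} (X : Finset ℕ) (b : Board A) : Prop :=
  b.control.Nodup ∧ (∀ x a, x ∉ X → b.σ x a = ∅) ∧
    (∀ x a, ∀ S ∈ b.σ x a, ∀ c ∈ S, c ∈ b.control) ∧
    (∀ c ∈ b.control, ∃ x a, ∃ S ∈ b.σ x a, c ∈ S)

/-- The chip `c` lies on top of the stack `S`. -/
def IsTop (Θ : List ℕ) (S : Finset ℕ) (c : ℕ) : Prop :=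
  c ∈ S ∧ ∀ d ∈ S, Θ.idxOf d ≤ Θ.idxOf c

/-- A chip is covered if it is not on top of any stack. -/
def Covered {A : Type} (b : Board A) (c : ℕ) : Prop :=
  ∀ x a, ∀ S ∈ b.σ x a, ¬ IsTop b.control S c

/-- Moving the stacks along `τ`. -/
def moveStacks {A : Type} [SemilatticeSup A] (τ : TraceRel A) (σ : ℕ → A → Set (Finset ℕ)) :
    ℕ → A → Set (Finset ℕ) :=
  fun y a => {S | ∃ x b c, S ∈ σ x b ∧ τ x c y ∧ a = b ⊔ c}

/-- Taking the stacks at activated positions `(y, α)` back to `(y, ⊥)`, with a new chip `f y` on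
top. -/
def coverStacks {A : Type} [SemilatticeSup A] [OrderBot A] (α : A) (f : ℕ → ℕ)
    (σ : ℕ → A → Set (Finset ℕ)) : ℕ → A → Set (Finset ℕ) :=
  fun y a => {S | (a ≠ α ∧ S ∈ σ y a) ∨ (a ≠ α ∧ a = ⊥ ∧ ∃ S' ∈ σ y α, S = insert (f y) S')}

/-- `b'` is a `τ`-successor of `b`: stacks are moved, the chips that still occur (`old`) keep
their order, and the new chips (`new`) come last. -/
def IsSucc {A : Type} [SemilatticeSup A] [OrderBot A] (α : A) (τ : TraceRel A)
    (b b' : Board A) : Prop :=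
  ∃ (old new : List ℕ) (f : ℕ → ℕ),
    old.Sublist b.control ∧
    (∀ c, c ∈ old ↔ c ∈ b.control ∧ ∃ y a, ∃ S ∈ moveStacks τ b.σ y a, c ∈ S) ∧
    new.Nodup ∧ (∀ c ∈ new, c ∉ b.control) ∧
    Set.BijOn f {y | (moveStacks τ b.σ y α).Nonempty} {c | c ∈ new} ∧
    b'.control = old ++ new ∧
    b'.σ = coverStacks α f (moveStacks τ b.σ)

/-- `b'` is a weakening of `b`. -/
def IsWeakening {A : Type} (b b' : Board A) : Prop :=
  (∀ x a, b'.σ x a ⊆ b.σ x a) ∧ b'.control.Sublist b.control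

/-- The `c`-reset of a stack. -/
def resetStack (Θ : List ℕ) (c : ℕ) (S : Finset ℕ) : Finset ℕ :=
  if c ∈ S then S.filter (fun z => Θ.idxOf z ≤ Θ.idxOf c) else S

/-- `b'` is the `c`-reset of `b`, for a covered chip `c` of `b`. -/
def IsReset {A : Type} (c : ℕ) (b b' : Board A) : Prop :=
  c ∈ b.control ∧ Covered b c ∧
    (∀ x a, b'.σ x a = resetStack b.control c '' b.σ x a) ∧
    b'.control.Sublist b.control ∧
    (∀ z, z ∈ b'.control ↔ z ∈ b.control ∧ ∃ x a, ∃ S ∈ b'.σ x a, z ∈ S)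

/-- `b'` is a population of `b`. -/
def IsPopulation {A : Type} [SemilatticeSup A] [OrderBot A] (b b' : Board A) : Prop :=
  b'.control = b.control ∧
    (∀ x, b.σ x ⊥ ⊆ b'.σ x ⊥ ∧ b'.σ x ⊥ ⊆ b.σ x ⊥ ∪ {∅}) ∧
    (∀ x a, a ≠ ⊥ → b'.σ x a = b.σ x a)

/-! ### The derivation system of the reset proof system of `D` -/

/-- Sequents of `D` annotated with Safra boards. -/
structure BSeq (D : DerivSys) (A : Type) (ι : TraceInterp D A) where
  seq : D.Seq
  board : Board A
  isBoard : IsBoard (ι.obj seq) board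

/-- The rules of the reset proof system: the structural rules, from `b` below to `b'` above the
line, and for every rule `r` of `D` the rules given by successor boards. -/
inductive BRule (D : DerivSys) {A : Type} [SemilatticeSup A] [OrderBot A] (α : A)
    (ι : TraceInterp D A) : Type
  | weak (Γ : D.Seq) (b b' : Board A) (hb : IsBoard (ι.obj Γ) b) (hb' : IsBoard (ι.obj Γ) b')
      (h : IsWeakening b b')
  | reset (Γ : D.Seq) (c : ℕ) (b b' : Board A) (hb : IsBoard (ι.obj Γ) b)
      (hb' : IsBoard (ι.obj Γ) b') (h : IsReset c b b')
  | pop (Γ : D.Seq) (b b' : Board A) (hb : IsBoard (ι.obj Γ) b) (hb' : IsBoard (ι.obj Γ) b')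
      (h : IsPopulation b b')
  | rule (r : D.Rule) (b : Board A) (bs : Fin (D.arity r) → Board A)
      (hb : IsBoard (ι.obj (D.concl r)) b) (hbs : ∀ i, IsBoard (ι.obj (D.prem r i)) (bs i))
      (h : ∀ i, IsSucc α (ι.mor r i) b (bs i))

/-- The derivation system of the reset proof system induced by `ι`. -/
def resetSys (D : DerivSys) {A : Type} [SemilatticeSup A] [OrderBot A] (α : A)
    (ι : TraceInterp D A) : DerivSys where
  Seq := BSeq D A ι
  Rule := BRule D α ι
  arity
    | .weak .. => 1
    | .reset .. => 1
    | .pop .. => 1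
    | .rule r .. => D.arity r
  concl
    | .weak Γ b _ hb _ _ => ⟨Γ, b, hb⟩
    | .reset Γ _ b _ hb _ _ => ⟨Γ, b, hb⟩
    | .pop Γ b _ hb _ _ => ⟨Γ, b, hb⟩
    | .rule r b _ hb _ _ => ⟨D.concl r, b, hb⟩
  prem
    | .weak Γ _ b' _ hb' _ => fun _ => ⟨Γ, b', hb'⟩
    | .reset Γ _ _ b' _ hb' _ => fun _ => ⟨Γ, b', hb'⟩
    | .pop Γ _ b' _ hb' _ => fun _ => ⟨Γ, b', hb'⟩
    | .rule r _ bs _ hbs _ => fun i => ⟨D.prem r i, bs i, hbs i⟩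

/-- The tree consisting of one application of a rule. -/
def PTree.single {D : DerivSys} (r : D.Rule) : PTree D (Fin (D.arity r)) :=
  .node r (fun i => .opn i)

theorem flatten_ofFn_singleton (n : ℕ) :
    (List.ofFn fun i : Fin n => [i]).flatten = List.finRange n := by
  have h : (List.ofFn fun i : Fin n => [i]) = (List.finRange n).map (fun i => [i]) := by
    rw [List.ofFn_eq_map]
  rw [h, ← List.flatMap_def, List.flatMap_singleton']

/-- Stripping the boards off: structural rules disappear, all other rules turn into the rule of
`D` they come from. -/
def strip (D : DerivSys) {A : Type} [SemilatticeSup A] [OrderBot A] (α : A)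
    (ι : TraceInterp D A) : PreproofMorphism (resetSys D α ι) D where
  seq s := s.seq
  tmpl
    | .weak .. => .opn (0 : Fin 1)
    | .reset .. => .opn (0 : Fin 1)
    | .pop .. => .opn (0 : Fin 1)
    | .rule r .. => PTree.single r
  root_eq r := by cases r <;> rfl
  wf r := by
    cases r
    case rule => exact fun i => ⟨rfl, trivial⟩
    all_goals trivial
  opens_eq r := by
    cases r
    case rule r _ _ _ _ _ => exact flatten_ofFn_singleton _
    all_goals rfl

/-! ### Cyclic Gödel's T -/

/-- Types. -/
inductive Ty : Type
  | nat : Ty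
  | arr : Ty → Ty → Ty
  deriving DecidableEq

/-- Sequents `Γ ⇒ A`. -/
structure CSeq where
  ctx : List Ty
  ty : Ty

/-- The rules of cyclic Gödel's T. -/
inductive CRule : Type
  | id (A : Ty)
  | zero
  | succ
  | impL (Γ : List Ty) (A B C : Ty)
  | impR (Γ : List Ty) (A B : Ty)
  | cond (Γ : List Ty) (A : Ty)
  | ex (Γ : List Ty) (A B : Ty) (Δ : List Ty) (C : Ty)
  | wk (Γ : List Ty) (A B : Ty)
  | ctr (Γ : List Ty) (A B : Ty)
  | cut (Γ : List Ty) (A B : Ty)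

def CRule.concl : CRule → CSeq
  | .id A => ⟨[A], A⟩
  | .zero => ⟨[], .nat⟩
  | .succ => ⟨[.nat], .nat⟩
  | .impL Γ A B C => ⟨Γ ++ [.arr A B], C⟩
  | .impR Γ A B => ⟨Γ, .arr A B⟩
  | .cond Γ A => ⟨Γ ++ [.nat], A⟩
  | .ex Γ A B Δ C => ⟨Γ ++ [B, A] ++ Δ, C⟩
  | .wk Γ A B => ⟨Γ ++ [A], B⟩
  | .ctr Γ A B => ⟨Γ ++ [A], B⟩
  | .cut Γ A _ => ⟨Γ, A⟩

def CRule.prems : CRule → List CSeq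
  | .id _ => []
  | .zero => []
  | .succ => []
  | .impL Γ A B C => [⟨Γ, A⟩, ⟨Γ ++ [B], C⟩]
  | .impR Γ A B => [⟨Γ ++ [A], B⟩]
  | .cond Γ A => [⟨Γ, A⟩, ⟨Γ ++ [.nat], A⟩]
  | .ex Γ A B Δ C => [⟨Γ ++ [A, B] ++ Δ, C⟩]
  | .wk Γ _ B => [⟨Γ, B⟩]
  | .ctr Γ A B => [⟨Γ ++ [A, A], B⟩]
  | .cut Γ A B => [⟨Γ, B⟩, ⟨Γ ++ [B], A⟩]

/-- The derivation system of cyclic Gödel's T. -/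
def CGT : DerivSys where
  Seq := CSeq
  Rule := CRule
  arity r := r.prems.length
  concl := CRule.concl
  prem r i := r.prems[i]

/-- The number of occurrences of the ground type. -/
def numN (Γ : List Ty) : ℕ := Γ.count .nat

/-- `{(j, 0, j) | j < n}`. -/
def idUpTo (n : ℕ) : TraceRel Bool := fun x a y => x < n ∧ a = false ∧ x = y

/-- The trace relation from the conclusion to the premise with index `i`.  The occurrences of
the ground type in a context are numbered from left to right, starting with `0`. -/
def CRule.trace : CRule → ℕ → TraceRel Bool
  | .ex Γ A B Δ _, _ =>
      if A = .nat ∧ B = .nat then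
        fun x a y => a = false ∧
          (x < numN Γ ∧ y = x ∨
            numN Γ + 2 ≤ x ∧ x < numN (Γ ++ [.nat, .nat] ++ Δ) ∧ y = x ∨
            x = numN Γ ∧ y = numN Γ + 1 ∨
            x = numN Γ + 1 ∧ y = numN Γ)
      else idUpTo (numN (Γ ++ [B, A] ++ Δ))
  | .cond Γ _, 1 => fun x a y =>
      idUpTo (numN Γ) x a y ∨ x = numN Γ ∧ a = true ∧ y = numN Γ
  | .cond Γ _, _ => idUpTo (numN Γ)
  | .wk Γ _ _, _ => idUpTo (numN Γ)
  | .ctr Γ A _, _ =>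
      if A = .nat then fun x a y =>
        idUpTo (numN Γ + 1) x a y ∨ x = numN Γ ∧ a = false ∧ y = numN Γ + 1
      else idUpTo (numN Γ)
  | r, _ => idUpTo (numN r.concl.ctx)

/-- The trace interpretation of cyclic Gödel's T in the Booleans. -/
def cgtTrace : TraceInterp CGT Bool where
  obj s := Finset.range (numN s.ctx)
  mor r i := r.trace i
  mor_supp r i x a y h := by
    simp only [Finset.mem_range]
    change CRule at r
    cases r with
    | id | zero | succ => exact i.elim0
    | impL Γ A B C =>
      change Fin 2 at i
      fin_cases i
      · change x < numN (Γ ++ [.arr A B]) ∧ y < numN Γ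
        simp [CRule.trace, CRule.concl, idUpTo, numN] at h ⊢; omega
      · change x < numN (Γ ++ [.arr A B]) ∧ y < numN (Γ ++ [B])
        simp [CRule.trace, CRule.concl, idUpTo, numN] at h ⊢; omega
    | impR Γ A B =>
      change Fin 1 at i
      fin_cases i
      change x < numN Γ ∧ y < numN (Γ ++ [A])
      simp [CRule.trace, CRule.concl, idUpTo, numN] at h ⊢; omega
    | cond Γ A =>
      change Fin 2 at i
      fin_cases i
      · change x < numN (Γ ++ [.nat]) ∧ y < numN Γ
        simp [CRule.trace, idUpTo, numN] at h ⊢; omega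
      · change x < numN (Γ ++ [.nat]) ∧ y < numN (Γ ++ [.nat])
        simp [CRule.trace, idUpTo, numN] at h ⊢; omega
    | ex Γ A B Δ C =>
      change Fin 1 at i
      fin_cases i
      change x < numN (Γ ++ [B, A] ++ Δ) ∧ y < numN (Γ ++ [A, B] ++ Δ)
      simp only [CRule.trace] at h
      split_ifs at h with hAB
      · obtain ⟨rfl, rfl⟩ := hAB
        simp [numN] at h ⊢; omega
      · simp [numN, idUpTo, List.count_cons] at h ⊢; omega
    | wk Γ A B =>
      change Fin 1 at i
      fin_cases i
      change x < numN (Γ ++ [A]) ∧ y < numN Γ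
      simp [CRule.trace, idUpTo, numN] at h ⊢; omega
    | ctr Γ A B =>
      change Fin 1 at i
      fin_cases i
      change x < numN (Γ ++ [A]) ∧ y < numN (Γ ++ [A, A])
      simp only [CRule.trace] at h
      split_ifs at h with hA
      · subst hA
        simp [numN, idUpTo] at h ⊢; omega
      · simp [numN, idUpTo] at h ⊢; omega
    | cut Γ A B =>
      change Fin 2 at i
      fin_cases i
      · change x < numN Γ ∧ y < numN Γ
        simp [CRule.trace, CRule.concl, idUpTo, numN] at h ⊢; omega
      · change x < numN Γ ∧ y < numN (Γ ++ [B])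
        simp [CRule.trace, CRule.concl, idUpTo, numN] at h ⊢; omega

/-! ### Reset Gödel's T -/

/-- Annotated formulas `A ^ u`. -/
abbrev AFm : Type := Ty × List ℕ

/-- Expressions `Θ | Γ ⇒ A` with an annotated context. -/
structure ASeq where
  control : List ℕ
  ctx : List AFm
  ty : Ty

/-- The control has no repetitions, annotations are subsequences of the control, and only the
ground type may have a non-empty annotation. -/
def ASeq.IsSeq (s : ASeq) : Prop :=
  s.control.Nodup ∧ ∀ p ∈ s.ctx, p.2.Sublist s.control ∧ (p.2 ≠ [] → p.1 = .nat)

/-- The control without the letters that occur in no annotation. -/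
def restrict (Θ : List ℕ) (Γ : List AFm) : List ℕ := Θ.filter (fun c => ∃ p ∈ Γ, c ∈ p.2)

/-- Every annotation `u a v` in the context is replaced by `u a`. -/
def cutAt (u : List ℕ) (a : ℕ) (Γ : List AFm) : List AFm :=
  Γ.map fun p => if a ∈ p.2 then (p.1, u ++ [a]) else p

/-- The rules of reset Gödel's T, without their side conditions.  In `reset Θ Γ B u a`, the
context `Γ` is that of the conclusion. -/
inductive RSchema : Type
  | id (Θ : List ℕ) (A : Ty) (u : List ℕ)
  | zero (Θ : List ℕ)
  | succ (Θ u : List ℕ)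
  | impL (Θ : List ℕ) (Γ : List AFm) (A B : Ty) (u : List ℕ) (C : Ty)
  | impR (Θ : List ℕ) (Γ : List AFm) (A B : Ty)
  | cond (Θ : List ℕ) (Γ : List AFm) (u : List ℕ) (A : Ty) (a : ℕ)
  | ex (Θ : List ℕ) (Γ : List AFm) (A : Ty) (v : List ℕ) (B : Ty) (u : List ℕ) (Δ : List AFm)
      (C : Ty)
  | wk (Θ : List ℕ) (Γ : List AFm) (A : Ty) (u : List ℕ) (B : Ty)
  | ctr (Θ : List ℕ) (Γ : List AFm) (A : Ty) (u : List ℕ) (B : Ty)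
  | cut (Θ : List ℕ) (Γ : List AFm) (A B : Ty)
  | reset (Θ : List ℕ) (Γ : List AFm) (B : Ty) (u : List ℕ) (a : ℕ)

def RSchema.concl : RSchema → ASeq
  | .id Θ A u => ⟨Θ, [(A, u)], A⟩
  | .zero Θ => ⟨Θ, [], .nat⟩
  | .succ Θ u => ⟨Θ, [(.nat, u)], .nat⟩
  | .impL Θ Γ A B u C => ⟨Θ, Γ ++ [(.arr A B, u)], C⟩
  | .impR Θ Γ A B => ⟨Θ, Γ, .arr A B⟩
  | .cond Θ Γ u A _ => ⟨Θ, Γ ++ [(.nat, u)], A⟩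
  | .ex Θ Γ A v B u Δ C => ⟨Θ, Γ ++ [(B, u), (A, v)] ++ Δ, C⟩
  | .wk Θ Γ A u B => ⟨Θ, Γ ++ [(A, u)], B⟩
  | .ctr Θ Γ A u B => ⟨Θ, Γ ++ [(A, u)], B⟩
  | .cut Θ Γ A _ => ⟨Θ, Γ, A⟩
  | .reset Θ Γ B _ _ => ⟨Θ, Γ, B⟩

def RSchema.prems : RSchema → List ASeq
  | .id _ _ _ => []
  | .zero _ => []
  | .succ _ _ => []
  | .impL Θ Γ A B u C => [⟨restrict Θ Γ, Γ, A⟩, ⟨Θ, Γ ++ [(B, u)], C⟩]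
  | .impR Θ Γ A B => [⟨Θ, Γ ++ [(A, [])], B⟩]
  | .cond Θ Γ u A a => [⟨restrict Θ Γ, Γ, A⟩, ⟨Θ ++ [a], Γ ++ [(.nat, u ++ [a])], A⟩]
  | .ex Θ Γ A v B u Δ C => [⟨Θ, Γ ++ [(A, v), (B, u)] ++ Δ, C⟩]
  | .wk Θ Γ _ _ B => [⟨restrict Θ Γ, Γ, B⟩]
  | .ctr Θ Γ A u B => [⟨Θ, Γ ++ [(A, u), (A, u)], B⟩]
  | .cut Θ Γ A B => [⟨Θ, Γ, B⟩, ⟨Θ, Γ ++ [(B, [])], A⟩]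
  | .reset Θ Γ B u a => [⟨restrict Θ (cutAt u a Γ), cutAt u a Γ, B⟩]

/-- Side conditions: the letter added by `cond` is fresh; for `reset`, the letter `a` occurs in
the context, and every annotation containing it has the form `u a v` with `v` non-empty. -/
def RSchema.Side : RSchema → Prop
  | .cond Θ _ _ _ a => a ∉ Θ
  | .reset _ Γ _ u a =>
      (∃ p ∈ Γ, a ∈ p.2) ∧ ∀ p ∈ Γ, a ∈ p.2 → ∃ v, v ≠ [] ∧ p.2 = u ++ a :: v
  | _ => True

/-- The derivation system of reset Gödel's T. -/
def RGT : DerivSys where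
  Seq := {s : ASeq // s.IsSeq}
  Rule := {r : RSchema // r.Side ∧ r.concl.IsSeq ∧ ∀ p ∈ r.prems, p.IsSeq}
  arity r := r.1.prems.length
  concl r := ⟨r.1.concl, r.2.2.1⟩
  prem r i := ⟨r.1.prems[i], r.2.2.2 _ (List.getElem_mem _)⟩

/-- `r` is an application of the reset rule for the letter `a`. -/
def RSchema.IsResetOf (a : ℕ) : RSchema → Prop
  | .reset _ _ _ _ b => b = a
  | _ => False

/-- The bud with address `t` and companion `t.take l` has the letter `a` as invariant: up to and
including `a`, the controls on the way from the companion to the bud begin with the same letters,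
and a reset of `a` takes place there. -/
def HasInvariant (P : SeqTree RGT) (t : List ℕ) (l a : ℕ) : Prop :=
  (∃ p : List ℕ, ∀ k, l ≤ k → k ≤ t.length → ∀ Q : SeqTree RGT, P.sub (t.take k) = some Q →
    p ++ [a] <+: Q.endseq.1.control) ∧
  ∃ k r, l ≤ k ∧ k < t.length ∧ P.label (t.take k) = some (.rule r) ∧ r.1.IsResetOf a

/-- Proofs of reset Gödel's T. -/
def IsRGTProof (P : SeqTree RGT) : Prop :=
  IsPreproof P ∧ P.opens = [] ∧
    ∀ t Γ l, P.label t = some (.bud Γ l) → ∃ a, HasInvariant P t l a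

/-- The sequent `ε | Γ ^ ε ⇒ A`. -/
def CSeq.annotate (s : CSeq) : RGT.Seq :=
  ⟨⟨[], s.ctx.map fun A => (A, []), s.ty⟩, by simp [ASeq.IsSeq]⟩

/-! ### Embedding reset Gödel's T into the reset proof system of cyclic Gödel's T -/

/-- Removing the annotations. -/
def erase (Γ : List AFm) : List Ty := Γ.map Prod.fst

/-- The annotations of the occurrences of the ground type, from left to right. -/
def anns (Γ : List AFm) : List (List ℕ) := (Γ.filter (fun p => p.1 = .nat)).map Prod.snd

/-- The board of an annotated context: the control consists of the letters of `Θ` that occur in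
the context, and the `j`-th occurrence of the ground type, if annotated by `u`, has the letters
of `u` as its only stack, at position `(j, 0)`. -/
def boardOf (Θ : List ℕ) (Γ : List AFm) : Board Bool where
  control := restrict Θ Γ
  σ j a := {S | a = false ∧ ∃ u, (anns Γ)[j]? = some u ∧ S = u.toFinset}

theorem numN_erase (Γ : List AFm) : numN (erase Γ) = (anns Γ).length := by
  induction Γ with
  | nil => rfl
  | cons p Γ ih =>
    simp only [numN, erase, anns, List.map_cons, List.count_cons, List.filter_cons,
      List.length_map, beq_iff_eq] at ih ⊢
    split_ifs <;> simp_all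

theorem anns_append (Γ Δ : List AFm) : anns (Γ ++ Δ) = anns Γ ++ anns Δ := by
  simp [anns]

theorem anns_cons (p : AFm) (Γ : List AFm) :
    anns (p :: Γ) = (if p.1 = .nat then [p.2] else []) ++ anns Γ := by
  by_cases h : p.1 = .nat <;> simp [anns, h]

theorem anns_nil : anns [] = [] := rfl

theorem mem_anns {u : List ℕ} {Γ : List AFm} : u ∈ anns Γ ↔ (Ty.nat, u) ∈ Γ := by
  simp [anns]

theorem mem_restrict {c : ℕ} {Θ : List ℕ} {Γ : List AFm} :
    c ∈ restrict Θ Γ ↔ c ∈ Θ ∧ ∃ p ∈ Γ, c ∈ p.2 := by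
  simp [restrict]

theorem exists_anns {Θ : List ℕ} {Γ : List AFm} {A : Ty} (h : ASeq.IsSeq ⟨Θ, Γ, A⟩) (c : ℕ) :
    (∃ p ∈ Γ, c ∈ p.2) ↔ ∃ u ∈ anns Γ, c ∈ u := by
  constructor
  · rintro ⟨⟨B, u⟩, hp, hc⟩
    have := (h.2 _ hp).2 (List.ne_nil_of_mem hc)
    simp only at this
    subst this
    exact ⟨u, mem_anns.2 hp, hc⟩
  · rintro ⟨u, hu, hc⟩
    exact ⟨_, mem_anns.1 hu, hc⟩

theorem isBoard_boardOf {Θ : List ℕ} {Γ : List AFm} {A : Ty} (h : ASeq.IsSeq ⟨Θ, Γ, A⟩)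
    {X : Finset ℕ} (hX : ∀ j < (anns Γ).length, j ∈ X) : IsBoard X (boardOf Θ Γ) := by
  refine ⟨h.1.filter _, ?_, ?_, ?_⟩
  · intro x a hx
    ext S
    simp only [boardOf, Set.mem_ofPred_eq, Set.mem_empty_iff_false, iff_false]
    rintro ⟨-, u, hu, -⟩
    exact hx (hX x (List.getElem?_eq_some_iff.1 hu).1)
  · rintro x a S ⟨-, u, hu, rfl⟩ c hc
    have hu' := mem_anns.1 (List.mem_of_getElem? hu)
    rw [List.mem_toFinset] at hc
    exact mem_restrict.2 ⟨(h.2 _ hu').1.subset hc, _, hu', hc⟩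
  · intro c hc
    obtain ⟨u, hu, hcu⟩ := (exists_anns h c).1 (mem_restrict.1 hc).2
    obtain ⟨j, hj⟩ := List.getElem?_of_mem hu
    exact ⟨j, false, u.toFinset, ⟨rfl, u, hj, rfl⟩, by simpa using hcu⟩

/-- Successors along trace relations without progress. -/
theorem isSucc_plain {Θ Θ' : List ℕ} {Γ Γ' : List AFm} {A A' : Ty}
    (h : ASeq.IsSeq ⟨Θ, Γ, A⟩) (h' : ASeq.IsSeq ⟨Θ', Γ', A'⟩)
    (hΘ : restrict Θ' Γ' = restrict Θ Γ') {τ : TraceRel Bool}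
    (h1 : ∀ x a y, τ x a y → a = false)
    (h2 : ∀ y u, (anns Γ')[y]? = some u ↔ ∃ x, τ x false y ∧ (anns Γ)[x]? = some u) :
    IsSucc true τ (boardOf Θ Γ) (boardOf Θ' Γ') := by
  have hmove : moveStacks τ (boardOf Θ Γ).σ = (boardOf Θ' Γ').σ := by
    funext y a
    ext S
    constructor
    · rintro ⟨x, b, c, ⟨rfl, u, hu, rfl⟩, hτ, rfl⟩
      obtain rfl := h1 _ _ _ hτ
      exact ⟨rfl, u, (h2 y u).2 ⟨x, hτ, hu⟩, rfl⟩
    · rintro ⟨rfl, u, hu, rfl⟩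
      obtain ⟨x, hτ, hx⟩ := (h2 y u).1 hu
      exact ⟨x, false, false, ⟨rfl, u, hx, rfl⟩, hτ, rfl⟩
  have hsub : ∀ c, (∃ p ∈ Γ', c ∈ p.2) → ∃ p ∈ Γ, c ∈ p.2 := by
    intro c hc
    obtain ⟨u, hu, hcu⟩ := (exists_anns h' c).1 hc
    obtain ⟨j, hj⟩ := List.getElem?_of_mem hu
    obtain ⟨x, -, hx⟩ := (h2 j u).1 hj
    exact (exists_anns h c).2 ⟨u, List.mem_of_getElem? hx, hcu⟩
  have hempty : ∀ y, ¬ (moveStacks τ (boardOf Θ Γ).σ y true).Nonempty := by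
    rintro y ⟨S, hS⟩
    rw [hmove] at hS
    exact absurd hS.1 (by simp)
  refine ⟨restrict Θ' Γ', [], id, ?_, ?_, List.nodup_nil, by simp, ?_, by simp [boardOf], ?_⟩
  · rw [hΘ]
    refine List.monotone_filter_right _ ?_
    intro c hc
    simp only [decide_eq_true_eq] at hc ⊢
    exact hsub c hc
  · intro c
    rw [hmove, hΘ]
    constructor
    · intro hc
      obtain ⟨hcΘ, hcΓ⟩ := mem_restrict.1 hc
      refine ⟨mem_restrict.2 ⟨hcΘ, hsub c hcΓ⟩, ?_⟩
      obtain ⟨u, hu, hcu⟩ := (exists_anns h' c).1 hcΓ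
      obtain ⟨j, hj⟩ := List.getElem?_of_mem hu
      exact ⟨j, false, u.toFinset, ⟨rfl, u, hj, rfl⟩, by simpa using hcu⟩
    · rintro ⟨hc, y, a, S, ⟨-, u, hu, rfl⟩, hcS⟩
      exact mem_restrict.2 ⟨(mem_restrict.1 hc).1,
        (exists_anns h' c).2 ⟨u, List.mem_of_getElem? hu, by simpa using hcS⟩⟩
  · have : {y | (moveStacks τ (boardOf Θ Γ).σ y true).Nonempty} = ∅ := by
      ext y; simpa using hempty y
    rw [this]
    simp [Set.BijOn, Set.MapsTo, Set.SurjOn]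
  · rw [hmove]
    funext y a
    ext S
    simp only [coverStacks, Set.mem_ofPred_eq]
    constructor
    · intro hS
      exact Or.inl ⟨by simp [hS.1], hS⟩
    · rintro (⟨-, hS⟩ | ⟨-, -, S', hS', -⟩)
      · exact hS
      · exact absurd hS'.1 (by simp)

theorem isSucc_idUpTo {Θ Θ' : List ℕ} {Γ Γ' : List AFm} {A A' : Ty}
    (h : ASeq.IsSeq ⟨Θ, Γ, A⟩) (h' : ASeq.IsSeq ⟨Θ', Γ', A'⟩)
    (hΘ : restrict Θ' Γ' = restrict Θ Γ') {n : ℕ} (hn : n = (anns Γ').length)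
    (h2 : anns Γ' <+: anns Γ) :
    IsSucc true (idUpTo n) (boardOf Θ Γ) (boardOf Θ' Γ') := by
  refine isSucc_plain h h' hΘ (fun x a y h => h.2.1) ?_
  intro y u
  obtain ⟨t, ht⟩ := h2
  rw [← ht]
  constructor
  · intro hu
    have hy := (List.getElem?_eq_some_iff.1 hu).1
    exact ⟨y, ⟨by omega, rfl, rfl⟩, by rw [List.getElem?_append_left hy]; exact hu⟩
  · rintro ⟨x, ⟨hx, -, rfl⟩, hu⟩
    rwa [List.getElem?_append_left (by omega)] at hu

theorem restrict_restrict (Θ : List ℕ) (Γ : List AFm) :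
    restrict (restrict Θ Γ) Γ = restrict Θ Γ := by
  simp [restrict, List.filter_filter]

theorem idxOf_lt {Θ : List ℕ} (hΘ : Θ.Nodup) {x y : ℕ} (h : [x, y].Sublist Θ) :
    Θ.idxOf x < Θ.idxOf y := by
  induction Θ with
  | nil => simp at h
  | cons z Θ ih =>
    rw [List.nodup_cons] at hΘ
    cases h with
    | cons _ h =>
      have hx : x ≠ z := by rintro rfl; exact hΘ.1 (h.subset (by simp))
      have hy : y ≠ z := by rintro rfl; exact hΘ.1 (h.subset (by simp))
      rw [List.idxOf_cons_ne _ hx.symm, List.idxOf_cons_ne _ hy.symm]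
      exact Nat.succ_lt_succ (ih hΘ.2 h)
    | cons_cons _ h =>
      have hy : y ≠ x := by rintro rfl; exact hΘ.1 (h.subset (by simp))
      rw [List.idxOf_cons_self, List.idxOf_cons_ne _ hy.symm]
      exact Nat.succ_pos _

theorem isSucc_cond {Θ : List ℕ} {Γ : List AFm} {A : Ty} {u : List ℕ} {a : ℕ} (ha : a ∉ Θ)
    (h : ASeq.IsSeq ⟨Θ, Γ ++ [(.nat, u)], A⟩) :
    IsSucc true (CRule.trace (.cond (erase Γ) A) 1) (boardOf Θ (Γ ++ [(.nat, u)]))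
      (boardOf (Θ ++ [a]) (Γ ++ [(.nat, u ++ [a])])) := by
  have hL : anns (Γ ++ [(.nat, u)]) = anns Γ ++ [u] := by simp [anns]
  have hL' : anns (Γ ++ [(.nat, u ++ [a])]) = anns Γ ++ [u ++ [a]] := by simp [anns]
  have hmem : ∀ p ∈ Γ ++ [(Ty.nat, u)], a ∉ p.2 := fun p hp hap =>
    ha ((h.2 p hp).1.subset hap)
  have hau : a ∉ u := hmem (.nat, u) (by simp)
  have hm0 : ∀ y S, S ∈ moveStacks (CRule.trace (.cond (erase Γ) A) 1)
      (boardOf Θ (Γ ++ [(.nat, u)])).σ y false ↔ ∃ w, (anns Γ)[y]? = some w ∧ S = w.toFinset := by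
    intro y S
    constructor
    · rintro ⟨x, b, c, ⟨rfl, w, hw, rfl⟩, (⟨hx, rfl, rfl⟩ | ⟨rfl, rfl, rfl⟩), hb⟩
      · rw [numN_erase] at hx
        rw [hL, List.getElem?_append_left hx] at hw
        exact ⟨w, hw, rfl⟩
      · simp at hb
    · rintro ⟨w, hw, rfl⟩
      have hy := (List.getElem?_eq_some_iff.1 hw).1
      refine ⟨y, false, false, ⟨rfl, w, ?_, rfl⟩, Or.inl ⟨?_, rfl, rfl⟩, rfl⟩
      · rw [hL, List.getElem?_append_left hy, hw]
      · rwa [numN_erase]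
  have hm1 : ∀ y S, S ∈ moveStacks (CRule.trace (.cond (erase Γ) A) 1)
      (boardOf Θ (Γ ++ [(.nat, u)])).σ y true ↔ y = (anns Γ).length ∧ S = u.toFinset := by
    intro y S
    constructor
    · rintro ⟨x, b, c, ⟨rfl, w, hw, rfl⟩, (⟨hx, rfl, rfl⟩ | ⟨rfl, rfl, rfl⟩), hb⟩
      · simp at hb
      · rw [numN_erase] at hw ⊢
        rw [hL] at hw
        simp at hw
        exact ⟨rfl, by rw [hw]⟩
    · rintro ⟨rfl, rfl⟩
      refine ⟨(anns Γ).length, false, true, ⟨rfl, u, by simp [hL], rfl⟩, Or.inr ⟨?_, rfl, ?_⟩, rfl⟩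
        <;> rw [numN_erase]
  refine ⟨restrict Θ (Γ ++ [(.nat, u)]), [a], fun _ => a, List.Sublist.refl _, ?_, by simp, ?_, ?_,
    ?_, ?_⟩
  · intro c
    refine ⟨fun hc => ⟨hc, ?_⟩, fun hc => hc.1⟩
    obtain ⟨w, hw, hcw⟩ := (exists_anns h c).1 (mem_restrict.1 hc).2
    rw [hL, List.mem_append, List.mem_singleton] at hw
    rcases hw with hw | rfl
    · obtain ⟨j, hj⟩ := List.getElem?_of_mem hw
      exact ⟨j, false, w.toFinset, (hm0 _ _).2 ⟨w, hj, rfl⟩, by simpa using hcw⟩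
    · exact ⟨_, true, w.toFinset, (hm1 _ _).2 ⟨rfl, rfl⟩, by simpa using hcw⟩
  · intro c hc hc'
    rw [List.mem_singleton] at hc
    subst hc
    exact ha (mem_restrict.1 hc').1
  · have : {y | (moveStacks (CRule.trace (.cond (erase Γ) A) 1)
        (boardOf Θ (Γ ++ [(.nat, u)])).σ y true).Nonempty} = {(anns Γ).length} := by
      ext y
      simp only [Set.mem_ofPred_eq, Set.mem_singleton_iff]
      constructor
      · rintro ⟨S, hS⟩; exact ((hm1 _ _).1 hS).1
      · rintro rfl; exact ⟨_, (hm1 _ _).2 ⟨rfl, rfl⟩⟩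
    rw [this]
    simp [Set.BijOn, Set.MapsTo, Set.SurjOn]
  · simp only [boardOf, restrict, List.filter_append]
    congr 1
    · refine List.filter_congr fun c hc => ?_
      have hca : c ≠ a := by rintro rfl; exact ha hc
      simp [or_and_right, exists_or, hca]
    · simp
  · funext y b
    ext S
    simp only [coverStacks, Set.mem_ofPred_eq]
    constructor
    · rintro ⟨rfl, w, hw, rfl⟩
      rw [hL'] at hw
      by_cases hy : y < (anns Γ).length
      · rw [List.getElem?_append_left hy] at hw
        exact Or.inl ⟨by simp, (hm0 _ _).2 ⟨w, hw, rfl⟩⟩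
      · have hy' := (List.getElem?_eq_some_iff.1 hw).1
        simp only [List.length_append, List.length_singleton] at hy'
        obtain rfl : y = (anns Γ).length := by omega
        simp at hw
        subst hw
        refine Or.inr ⟨by simp, rfl, u.toFinset, (hm1 _ _).2 ⟨rfl, rfl⟩, ?_⟩
        ext; simp
    · rintro (⟨hb, hS⟩ | ⟨-, rfl, S', hS', rfl⟩)
      · obtain rfl : b = false := by simpa using hb
        obtain ⟨w, hw, rfl⟩ := (hm0 _ _).1 hS
        refine ⟨rfl, w, ?_, rfl⟩
        rw [hL', List.getElem?_append_left (List.getElem?_eq_some_iff.1 hw).1, hw]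
      · obtain ⟨rfl, rfl⟩ := (hm1 _ _).1 hS'
        refine ⟨rfl, u ++ [a], by simp [hL'], ?_⟩
        ext; simp

theorem anns_cutAt (u : List ℕ) (a : ℕ) (Γ : List AFm) :
    anns (cutAt u a Γ) = (anns Γ).map fun w => if a ∈ w then u ++ [a] else w := by
  induction Γ with
  | nil => rfl
  | cons p Γ ih =>
    have : cutAt u a (p :: Γ) =
      (if a ∈ p.2 then (p.1, u ++ [a]) else p) :: cutAt u a Γ := rfl
    rw [this, anns_cons, anns_cons, ih]
    split_ifs <;> simp_all

theorem erase_cutAt (u : List ℕ) (a : ℕ) (Γ : List AFm) : erase (cutAt u a Γ) = erase Γ := by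
  simp only [erase, cutAt, List.map_map]
  refine List.map_congr_left fun p _ => ?_
  simp only [Function.comp_apply]
  split_ifs <;> rfl

theorem resetStack_eq {Θ u v : List ℕ} {a : ℕ} (hΘ : Θ.Nodup)
    (h : (u ++ a :: v).Sublist Θ) :
    resetStack Θ a (u ++ a :: v).toFinset = (u ++ [a]).toFinset := by
  unfold resetStack
  rw [if_pos (by simp)]
  ext z
  simp only [Finset.mem_filter, List.mem_toFinset, List.mem_append, List.mem_cons,
    List.not_mem_nil, or_false]
  constructor
  · rintro ⟨hz | rfl | hz, hle⟩
    · exact Or.inl hz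
    · exact Or.inr rfl
    · have : [a, z].Sublist Θ := List.Sublist.trans
        ((List.singleton_sublist.2 hz).cons_cons a |>.trans (List.sublist_append_right u _)) h
      exact absurd hle (not_le.2 (idxOf_lt hΘ this))
  · rintro (hz | rfl)
    · refine ⟨Or.inl hz, (idxOf_lt hΘ (List.Sublist.trans ?_ h)).le⟩
      exact (List.singleton_sublist.2 hz).append (List.singleton_sublist.2 (by simp) :
        [a].Sublist (a :: v))
    · exact ⟨Or.inr (Or.inl rfl), le_rfl⟩

theorem sublist_restrict {Θ : List ℕ} {Γ : List AFm} {p : AFm} (hp : p ∈ Γ)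
    (h : p.2.Sublist Θ) : p.2.Sublist (restrict Θ Γ) := by
  have : p.2 = p.2.filter (fun c => ∃ q ∈ Γ, c ∈ q.2) := by
    rw [List.filter_eq_self.2]
    intro c hc
    simpa using ⟨p.1, p.2, hp, hc⟩
  rw [this]
  exact h.filter _

theorem isReset_boardOf {Θ : List ℕ} {Γ : List AFm} {B : Ty} {u : List ℕ} {a : ℕ}
    (h : ASeq.IsSeq ⟨Θ, Γ, B⟩) (h' : ASeq.IsSeq ⟨restrict Θ (cutAt u a Γ), cutAt u a Γ, B⟩)
    (ha : ∃ p ∈ Γ, a ∈ p.2)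
    (hu : ∀ p ∈ Γ, a ∈ p.2 → ∃ v, v ≠ [] ∧ p.2 = u ++ a :: v) :
    IsReset a (boardOf Θ Γ) (boardOf (restrict Θ (cutAt u a Γ)) (cutAt u a Γ)) := by
  have hnd : (restrict Θ Γ).Nodup := h.1.filter _
  have hw : ∀ w ∈ anns Γ, w.Sublist (restrict Θ Γ) := fun w hw =>
    sublist_restrict (mem_anns.1 hw) (h.2 _ (mem_anns.1 hw)).1
  have hval : ∀ w ∈ anns Γ, resetStack (restrict Θ Γ) a w.toFinset =
      (if a ∈ w then u ++ [a] else w).toFinset := by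
    intro w hwm
    split_ifs with haw
    · obtain ⟨v, -, hv⟩ := hu _ (mem_anns.1 hwm) haw
      simp only at hv
      subst hv
      exact resetStack_eq hnd (hw _ hwm)
    · unfold resetStack
      rw [if_neg (by simpa using haw)]
  have hle : ∀ c, (∃ p ∈ cutAt u a Γ, c ∈ p.2) → ∃ p ∈ Γ, c ∈ p.2 := by
    rintro c ⟨p, hp, hc⟩
    simp only [cutAt, List.mem_map] at hp
    obtain ⟨q, hq, rfl⟩ := hp
    split_ifs at hc with haq
    · obtain ⟨v, -, hv⟩ := hu q hq haq
      refine ⟨q, hq, ?_⟩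
      rw [hv]
      simp only [List.mem_append, List.mem_singleton] at hc
      simp only [List.mem_append, List.mem_cons]
      tauto
    · exact ⟨q, hq, hc⟩
  have hσ : ∀ x b, (boardOf (restrict Θ (cutAt u a Γ)) (cutAt u a Γ)).σ x b =
      resetStack (restrict Θ Γ) a '' (boardOf Θ Γ).σ x b := by
    intro x b
    ext S
    simp only [boardOf, Set.mem_ofPred_eq, Set.mem_image, anns_cutAt, List.getElem?_map,
      Option.map_eq_some_iff]
    constructor
    · rintro ⟨rfl, _, ⟨w, hx, rfl⟩, rfl⟩
      exact ⟨_, ⟨rfl, w, hx, rfl⟩, hval w (List.mem_of_getElem? hx)⟩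
    · rintro ⟨_, ⟨rfl, w, hx, rfl⟩, rfl⟩
      exact ⟨rfl, _, ⟨w, hx, rfl⟩, hval w (List.mem_of_getElem? hx)⟩
  refine ⟨?_, ?_, hσ, ?_, ?_⟩
  · obtain ⟨p, hp, hap⟩ := ha
    exact mem_restrict.2 ⟨(h.2 p hp).1.subset hap, p, hp, hap⟩
  · rintro x b S ⟨-, w, hx, rfl⟩ ⟨haw, htop⟩
    have hwm := List.mem_of_getElem? hx
    rw [List.mem_toFinset] at haw
    obtain ⟨v, hv0, hv⟩ := hu _ (mem_anns.1 hwm) haw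
    simp only at hv
    subst hv
    obtain ⟨z, v', rfl⟩ := List.exists_cons_of_ne_nil hv0
    have h2 : [a, z].Sublist (restrict Θ Γ) :=
      List.Sublist.trans (List.Sublist.trans (by simp) (List.sublist_append_right u _)) (hw _ hwm)
    exact absurd (htop z (by simp)) (not_le.2 (idxOf_lt hnd h2))
  · change (restrict (restrict Θ (cutAt u a Γ)) (cutAt u a Γ)).Sublist (restrict Θ Γ)
    rw [restrict_restrict]
    refine List.monotone_filter_right _ ?_
    intro c hc
    simp only [decide_eq_true_eq] at hc ⊢
    exact hle c hc
  · intro z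
    change z ∈ restrict (restrict Θ (cutAt u a Γ)) (cutAt u a Γ) ↔ z ∈ restrict Θ Γ ∧ _
    rw [restrict_restrict]
    constructor
    · intro hz
      obtain ⟨hzΘ, hzΓ⟩ := mem_restrict.1 hz
      refine ⟨mem_restrict.2 ⟨hzΘ, hle z hzΓ⟩, ?_⟩
      obtain ⟨w, hwm, hzw⟩ := (exists_anns h' z).1 hzΓ
      obtain ⟨j, hj⟩ := List.getElem?_of_mem hwm
      exact ⟨j, false, w.toFinset, ⟨rfl, w, hj, rfl⟩, by simpa using hzw⟩
    · rintro ⟨hz, y, b, S, ⟨-, w, hwm, rfl⟩, hzS⟩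
      exact mem_restrict.2 ⟨(mem_restrict.1 hz).1,
        (exists_anns h' z).2 ⟨w, List.mem_of_getElem? hwm, by simpa using hzS⟩⟩

theorem isPopulation_boardOf (Θ : List ℕ) (Γ : List AFm) (B : Ty) :
    IsPopulation (boardOf Θ Γ) (boardOf Θ (Γ ++ [(B, [])])) := by
  refine ⟨?_, ?_, ?_⟩
  · simp only [boardOf, restrict]
    refine List.filter_congr fun c _ => ?_
    simp [or_and_right, exists_or]
  · intro x
    constructor
    · rintro S ⟨h, w, hw, rfl⟩
      refine ⟨h, w, ?_, rfl⟩
      rw [anns_append, List.getElem?_append_left (List.getElem?_eq_some_iff.1 hw).1, hw]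
    · rintro S ⟨h, w, hw, rfl⟩
      by_cases hx : x < (anns Γ).length
      · rw [anns_append, List.getElem?_append_left hx] at hw
        exact Or.inl ⟨h, w, hw, rfl⟩
      · right
        rw [anns_append, List.getElem?_append_right (not_lt.1 hx)] at hw
        have := List.mem_of_getElem? hw
        rw [mem_anns] at this
        simp at this
        simp [this.2]
  · intro x b hb
    ext S
    simp only [boardOf, Set.mem_ofPred_eq]
    constructor <;> · rintro ⟨rfl, -⟩; exact absurd rfl hb

theorem isSucc_ex {Θ : List ℕ} {Γ Δ : List AFm} {A B C : Ty} {u v : List ℕ}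
    (h : ASeq.IsSeq ⟨Θ, Γ ++ [(B, u), (A, v)] ++ Δ, C⟩)
    (h' : ASeq.IsSeq ⟨Θ, Γ ++ [(A, v), (B, u)] ++ Δ, C⟩) :
    IsSucc true (CRule.trace (.ex (erase Γ) A B (erase Δ) C) 0)
      (boardOf Θ (Γ ++ [(B, u), (A, v)] ++ Δ)) (boardOf Θ (Γ ++ [(A, v), (B, u)] ++ Δ)) := by
  by_cases hAB : A = .nat ∧ B = .nat
  · obtain ⟨rfl, rfl⟩ := hAB
    have hlen : numN (erase Γ ++ [.nat, .nat] ++ erase Δ) = (anns Γ).length + 2 + (anns Δ).length := by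
      rw [← numN_erase, ← numN_erase]
      simp [numN]; omega
    refine isSucc_plain h h' rfl ?_ ?_
    · intro x a y hτ
      simp only [CRule.trace, and_self, if_true] at hτ
      exact hτ.1
    · intro y w
      simp only [CRule.trace, and_self, if_true, true_and, hlen, numN_erase, anns_append,
        anns_cons, anns_nil, List.append_nil, List.cons_append, List.nil_append]
      generalize anns Γ = L
      generalize anns Δ = M
      have key : ∀ p q : List ℕ, ∀ z, (L ++ [p, q] ++ M)[z]? =
          if z < L.length then L[z]? else if z = L.length then some p else
            if z = L.length + 1 then some q else M[z - (L.length + 2)]? := by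
        intro p q z
        split_ifs with h1 h2 h3
        · rw [List.append_assoc, List.getElem?_append_left h1]
        · subst h2; simp
        · subst h3; simp
        · rw [List.getElem?_append_right (by simp; omega)]; simp
      rw [key]
      constructor
      · intro hy
        split_ifs at hy with h1 h2 h3
        · exact ⟨y, Or.inl ⟨h1, rfl⟩, by rw [key, if_pos h1, hy]⟩
        · exact ⟨L.length + 1, by omega, by rw [key]; simpa using hy⟩
        · exact ⟨L.length, by omega, by rw [key]; simpa using hy⟩
        · have := (List.getElem?_eq_some_iff.1 hy).1
          exact ⟨y, by omega, by rw [key, if_neg h1, if_neg h2, if_neg h3, hy]⟩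
      · rintro ⟨x, hτ, hx⟩
        rw [key] at hx
        rcases hτ with ⟨h1, rfl⟩ | ⟨h1, h2, rfl⟩ | ⟨rfl, rfl⟩ | ⟨rfl, rfl⟩
        · rwa [if_pos h1] at hx ⊢
        · rw [if_neg (by omega), if_neg (by omega), if_neg (by omega)] at hx ⊢
          exact hx
        · simpa using hx
        · simpa using hx
  · have hanns : anns (Γ ++ [(A, v), (B, u)] ++ Δ) = anns (Γ ++ [(B, u), (A, v)] ++ Δ) := by
      simp only [anns_append, anns_cons, anns_nil]
      by_cases hA : A = .nat
      · have hB : B ≠ .nat := fun hB => hAB ⟨hA, hB⟩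
        simp [hA, hB]
      · simp [hA]
    have : CRule.trace (.ex (erase Γ) A B (erase Δ) C) 0 =
        idUpTo (numN (erase (Γ ++ [(B, u), (A, v)] ++ Δ))) := by
      simp only [CRule.trace, if_neg hAB]
      simp [erase]
    rw [this]
    exact isSucc_idUpTo h h' rfl (by rw [numN_erase, hanns]) (by rw [hanns])

theorem isSucc_ctr {Θ : List ℕ} {Γ : List AFm} {A B : Ty} {u : List ℕ}
    (h : ASeq.IsSeq ⟨Θ, Γ ++ [(A, u)], B⟩) (h' : ASeq.IsSeq ⟨Θ, Γ ++ [(A, u), (A, u)], B⟩) :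
    IsSucc true (CRule.trace (.ctr (erase Γ) A B) 0)
      (boardOf Θ (Γ ++ [(A, u)])) (boardOf Θ (Γ ++ [(A, u), (A, u)])) := by
  by_cases hA : A = .nat
  · subst hA
    refine isSucc_plain h h' rfl ?_ ?_
    · intro x a y hτ
      simp only [CRule.trace, if_true] at hτ
      rcases hτ with hτ | hτ
      · exact hτ.2.1
      · exact hτ.2.1
    · intro y w
      simp only [CRule.trace, if_true, true_and, numN_erase, anns_append, idUpTo,
        anns_cons, anns_nil, List.append_nil, List.cons_append, List.nil_append]
      generalize anns Γ = L
      have k1 : ∀ z, (L ++ [u])[z]? =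
          if z < L.length then L[z]? else if z = L.length then some u else none := by
        intro z
        split_ifs with h1 h2
        · rw [List.getElem?_append_left h1]
        · subst h2; simp
        · simp; omega
      have k2 : ∀ z, (L ++ [u, u])[z]? =
          if z < L.length then L[z]? else if z = L.length then some u else
            if z = L.length + 1 then some u else none := by
        intro z
        split_ifs with h1 h2 h3
        · rw [List.getElem?_append_left h1]
        · subst h2; simp
        · subst h3; simp
        · simp; omega
      rw [k2]
      constructor
      · intro hy
        split_ifs at hy with h1 h2 h3
        · exact ⟨y, Or.inl ⟨by omega, rfl⟩, by rw [k1, if_pos h1, hy]⟩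
        · exact ⟨y, Or.inl ⟨by omega, rfl⟩, by rw [k1, if_neg h1, if_pos h2, hy]⟩
        · exact ⟨L.length, Or.inr ⟨rfl, h3⟩, by rw [k1]; simpa using hy⟩
      · rintro ⟨x, hτ, hx⟩
        rw [k1] at hx
        rcases hτ with ⟨h1, rfl⟩ | ⟨rfl, rfl⟩
        · split_ifs at hx ⊢ with h2 h3
          · exact hx
          · exact hx
        · simpa using hx
  · have hanns : anns (Γ ++ [(A, u), (A, u)]) = anns Γ ∧ anns (Γ ++ [(A, u)]) = anns Γ := by
      simp [anns_append, anns_cons, anns_nil, hA]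
    simp only [CRule.trace, if_neg hA]
    exact isSucc_idUpTo h h' rfl (by rw [numN_erase, hanns.1]) (by rw [hanns.1, hanns.2])

/-- The derivation system of the reset proof system induced by cyclic Gödel's T. -/
noncomputable abbrev RCGT : DerivSys := resetSys CGT true cgtTrace

theorem isBoard_range {Θ : List ℕ} {Γ : List AFm} {A : Ty} (h : ASeq.IsSeq ⟨Θ, Γ, A⟩) {n : ℕ}
    (hn : (anns Γ).length ≤ n) : IsBoard (Finset.range n) (boardOf Θ Γ) :=
  isBoard_boardOf h fun _ hj => Finset.mem_range.2 (lt_of_lt_of_le hj hn)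

theorem BSeq.ext' {D : DerivSys} {A : Type} {ι : TraceInterp D A} {s t : BSeq D A ι}
    (h : s.seq = t.seq) (h' : s.board = t.board) : s = t := by
  cases s; cases t; cases h; cases h'; rfl

theorem isBoard_numN {Θ : List ℕ} {Γ : List AFm} {A : Ty} (h : ASeq.IsSeq ⟨Θ, Γ, A⟩)
    (Δ : List Ty) (hΔ : numN (erase Γ) ≤ numN Δ) :
    IsBoard (Finset.range (numN Δ)) (boardOf Θ Γ) :=
  isBoard_range h (by rwa [numN_erase] at hΔ)

theorem isSeq_init {Θ : List ℕ} {Γ Δ : List AFm} {A : Ty} (h : ASeq.IsSeq ⟨Θ, Γ ++ Δ, A⟩) :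
    ASeq.IsSeq ⟨Θ, Γ, A⟩ :=
  ⟨h.1, fun _ hp => h.2 _ (List.mem_append_left _ hp)⟩

theorem erase_append (Γ Δ : List AFm) : erase (Γ ++ Δ) = erase Γ ++ erase Δ := by
  simp [erase]

theorem boardOf_restrict (Θ : List ℕ) (Γ : List AFm) :
    boardOf (restrict Θ Γ) Γ = boardOf Θ Γ := by
  simp [boardOf, restrict_restrict]

theorem boardOf_append_ne (Θ : List ℕ) (Γ : List AFm) {B : Ty} (hB : B ≠ .nat) :
    boardOf Θ (Γ ++ [(B, [])]) = boardOf Θ Γ := by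
  have h1 : anns (Γ ++ [(B, [])]) = anns Γ := by simp [anns, hB]
  have h2 : restrict Θ (Γ ++ [(B, [])]) = restrict Θ Γ := by
    refine List.filter_congr fun c _ => ?_
    simp [or_and_right, exists_or]
  unfold boardOf
  rw [h1, h2]

/-- The translation of sequents. -/
def embedSeq (s : RGT.Seq) : RCGT.Seq where
  seq := (⟨erase s.1.ctx, s.1.ty⟩ : CSeq)
  board := boardOf s.1.control s.1.ctx
  isBoard := isBoard_range s.2 (by rw [numN_erase])

/-- If the formula `B` just introduced at the end of the context is the ground type, an
application of the population rule that puts the empty stack on it. -/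
noncomputable def popIf {V : Type} (Θ : List ℕ) (Γ : List AFm) (B C : Ty)
    (h : ASeq.IsSeq ⟨Θ, Γ ++ [(B, [])], C⟩) (v : V) : PTree RCGT V :=
  if B = .nat then
    .node (D := RCGT) (.pop (⟨erase (Γ ++ [(B, [])]), C⟩ : CSeq) (boardOf Θ Γ)
      (boardOf Θ (Γ ++ [(B, [])]))
      (isBoard_range (isSeq_init h) (by rw [numN_erase, anns_append, List.length_append]; omega))
      (isBoard_range h (by rw [numN_erase]))
      (isPopulation_boardOf Θ Γ B)) (fun _ => .opn v)
  else .opn v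

theorem popIf_root {V : Type} {Θ : List ℕ} {Γ : List AFm} {B C : Ty}
    (h : ASeq.IsSeq ⟨Θ, Γ ++ [(B, [])], C⟩) (v : V) (lab : V → RCGT.Seq)
    (hv : lab v = embedSeq ⟨⟨Θ, Γ ++ [(B, [])], C⟩, h⟩) (s : RCGT.Seq)
    (hs : s.seq = (⟨erase Γ ++ [B], C⟩ : CSeq)) (hb : s.board = boardOf Θ Γ) :
    (popIf Θ Γ B C h v).root lab = s := by
  unfold popIf
  split_ifs with hB
  · refine BSeq.ext' (Eq.trans ?_ hs.symm) hb.symm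
    exact congrArg (fun c => CSeq.mk c _) (erase_append _ _)
  · rw [PTree.root, hv]
    refine BSeq.ext' (Eq.trans ?_ hs.symm) (Eq.trans (boardOf_append_ne Θ Γ hB) hb.symm)
    exact congrArg (fun c => CSeq.mk c _) (erase_append _ _)

theorem popIf_wf {V : Type} {Θ : List ℕ} {Γ : List AFm} {B C : Ty}
    (h : ASeq.IsSeq ⟨Θ, Γ ++ [(B, [])], C⟩) (v : V) (lab : V → RCGT.Seq)
    (hv : lab v = embedSeq ⟨⟨Θ, Γ ++ [(B, [])], C⟩, h⟩) (anc : List RCGT.Seq) :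
    (popIf Θ Γ B C h v).Wf lab anc := by
  unfold popIf
  split_ifs with hB
  · exact fun _ => ⟨hv, trivial⟩
  · trivial

theorem popIf_opens {V : Type} {Θ : List ℕ} {Γ : List AFm} {B C : Ty}
    (h : ASeq.IsSeq ⟨Θ, Γ ++ [(B, [])], C⟩) (v : V) : (popIf Θ Γ B C h v).opens = [v] := by
  unfold popIf
  split_ifs <;> rfl

theorem isSucc_id {Θ Θ' : List ℕ} {Γ Γ' : List AFm} {A A' : Ty}
    (h : ASeq.IsSeq ⟨Θ, Γ, A⟩) (h' : ASeq.IsSeq ⟨Θ', Γ', A'⟩)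
    (hΘ : restrict Θ' Γ' = restrict Θ Γ') (Δ : List Ty) (hn : numN Δ = numN (erase Γ'))
    (h2 : anns Γ' <+: anns Γ) :
    IsSucc true (idUpTo (numN Δ)) (boardOf Θ Γ) (boardOf Θ' Γ') :=
  isSucc_idUpTo h h' hΘ (by rw [hn, numN_erase]) h2

theorem anns_prefix (Γ Δ : List AFm) : anns Γ <+: anns (Γ ++ Δ) := by
  rw [anns_append]
  exact List.prefix_append _ _

theorem numN_init (Γ : List AFm) (Δ : List Ty) : numN (erase Γ) ≤ numN (erase Γ ++ Δ) := by
  simp [numN]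

theorem numN_erase_append (Γ Δ : List AFm) :
    numN (erase (Γ ++ Δ)) ≤ numN (erase Γ ++ erase Δ) := by
  rw [erase_append]

/-- In a left implication rule, the annotation of the principal formula is empty. -/
theorem impL_isSeq {Θ : List ℕ} {Γ : List AFm} {A B C : Ty} {u : List ℕ}
    (h : ASeq.IsSeq ⟨Θ, Γ ++ [(Ty.arr A B, u)], C⟩) : u = [] := by
  by_contra hu
  exact absurd ((h.2 (Ty.arr A B, u) (by simp)).2 hu) (by simp)

theorem impL_isSeq' {Θ : List ℕ} {Γ : List AFm} {A B C : Ty} {u : List ℕ}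
    (h : ASeq.IsSeq ⟨Θ, Γ ++ [(Ty.arr A B, u)], C⟩) :
    ASeq.IsSeq ⟨Θ, Γ ++ [(B, [])], C⟩ := by
  refine ⟨h.1, fun p hp => ?_⟩
  rcases List.mem_append.1 hp with hp | hp
  · exact h.2 p (List.mem_append_left _ hp)
  · rw [List.mem_singleton] at hp
    subst hp
    simp

/-- The translation of rules: reset rules become reset rules, and all other rules become the
corresponding rules for the boards, followed by populations for newly introduced formulas. -/
noncomputable def embedTmpl : (r : RGT.Rule) → PTree RCGT (Fin (RGT.arity r))
  | ⟨.id Θ A u, hr⟩ =>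
      .node (D := RCGT) (.rule (CRule.id A) (boardOf Θ [(A, u)]) (fun i : Fin 0 => i.elim0)
        (isBoard_numN hr.2.1 [A] le_rfl) (fun i : Fin 0 => i.elim0)
        (fun i : Fin 0 => i.elim0)) (fun i : Fin 0 => i.elim0)
  | ⟨.zero Θ, hr⟩ =>
      .node (D := RCGT) (.rule CRule.zero (boardOf Θ []) (fun i : Fin 0 => i.elim0)
        (isBoard_numN hr.2.1 [] le_rfl) (fun i : Fin 0 => i.elim0)
        (fun i : Fin 0 => i.elim0)) (fun i : Fin 0 => i.elim0)
  | ⟨.succ Θ u, hr⟩ =>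
      .node (D := RCGT) (.rule CRule.succ (boardOf Θ [(.nat, u)]) (fun i : Fin 0 => i.elim0)
        (isBoard_numN hr.2.1 [.nat] le_rfl) (fun i : Fin 0 => i.elim0)
        (fun i : Fin 0 => i.elim0)) (fun i : Fin 0 => i.elim0)
  | ⟨.impL Θ Γ A B u C, hr⟩ =>
      .node (D := RCGT) (.rule (CRule.impL (erase Γ) A B C)
        (boardOf Θ (Γ ++ [((Ty.arr A B, u) : AFm)]))
        (![boardOf (restrict Θ Γ) Γ, boardOf Θ Γ] : Fin 2 → Board Bool)
        (isBoard_numN hr.2.1 (erase Γ ++ [Ty.arr A B]) (numN_erase_append _ _))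
        (Fin.forall_fin_two.2
          ⟨isBoard_numN (hr.2.2 _ List.mem_cons_self) (erase Γ) le_rfl,
            isBoard_numN (isSeq_init hr.2.1) (erase Γ ++ [B]) (numN_init _ _)⟩)
        (Fin.forall_fin_two.2
          ⟨isSucc_id hr.2.1 (hr.2.2 _ List.mem_cons_self) (restrict_restrict _ _)
              (erase Γ ++ [Ty.arr A B]) (by simp [numN]) (anns_prefix _ _),
            isSucc_id hr.2.1 (isSeq_init hr.2.1) rfl
              (erase Γ ++ [Ty.arr A B]) (by simp [numN]) (anns_prefix _ _)⟩))
        (![.opn (0 : Fin 2), popIf Θ Γ B C (impL_isSeq' hr.2.1) (1 : Fin 2)] :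
          Fin 2 → PTree RCGT (Fin 2))
  | ⟨.impR Θ Γ A B, hr⟩ =>
      .node (D := RCGT) (.rule (CRule.impR (erase Γ) A B) (boardOf Θ Γ)
        (fun _ : Fin 1 => boardOf Θ Γ)
        (isBoard_numN hr.2.1 (erase Γ) le_rfl)
        (Fin.forall_fin_one.2 (isBoard_numN hr.2.1 (erase Γ ++ [A]) (numN_init _ _)))
        (Fin.forall_fin_one.2
          (isSucc_id hr.2.1 hr.2.1 rfl (erase Γ) rfl (List.prefix_refl _))))
        (fun _ : Fin 1 => popIf Θ Γ A B (hr.2.2 _ List.mem_cons_self) (0 : Fin 1))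
  | ⟨.cond Θ Γ u A a, hr⟩ =>
      .node (D := RCGT) (.rule (CRule.cond (erase Γ) A) (boardOf Θ (Γ ++ [((Ty.nat, u) : AFm)]))
        (![boardOf (restrict Θ Γ) Γ, boardOf (Θ ++ [a]) (Γ ++ [((Ty.nat, u ++ [a]) : AFm)])] :
          Fin 2 → Board Bool)
        (isBoard_numN hr.2.1 (erase Γ ++ [Ty.nat]) (numN_erase_append _ _))
        (Fin.forall_fin_two.2
          ⟨isBoard_numN (hr.2.2 _ List.mem_cons_self) (erase Γ) le_rfl,
            isBoard_numN (hr.2.2 _ (List.mem_cons_of_mem _ List.mem_cons_self))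
              (erase Γ ++ [Ty.nat]) (numN_erase_append _ _)⟩)
        (Fin.forall_fin_two.2
          ⟨isSucc_id hr.2.1 (hr.2.2 _ List.mem_cons_self) (restrict_restrict _ _)
              (erase Γ) rfl (anns_prefix _ _),
            isSucc_cond hr.1 hr.2.1⟩))
        (fun i : Fin 2 => .opn i)
  | ⟨.ex Θ Γ A v B u Δ C, hr⟩ =>
      .node (D := RCGT) (.rule (CRule.ex (erase Γ) A B (erase Δ) C)
        (boardOf Θ (Γ ++ [(B, u), (A, v)] ++ Δ))
        (fun _ : Fin 1 => boardOf Θ (Γ ++ [(A, v), (B, u)] ++ Δ))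
        (isBoard_numN hr.2.1 (erase Γ ++ [B, A] ++ erase Δ) (by simp [erase]))
        (Fin.forall_fin_one.2 (isBoard_numN (hr.2.2 _ List.mem_cons_self)
          (erase Γ ++ [A, B] ++ erase Δ) (by simp [erase])))
        (Fin.forall_fin_one.2 (isSucc_ex hr.2.1 (hr.2.2 _ List.mem_cons_self))))
        (fun i : Fin 1 => .opn i)
  | ⟨.wk Θ Γ A u B, hr⟩ =>
      .node (D := RCGT) (.rule (CRule.wk (erase Γ) A B) (boardOf Θ (Γ ++ [(A, u)]))
        (fun _ : Fin 1 => boardOf (restrict Θ Γ) Γ)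
        (isBoard_numN hr.2.1 (erase Γ ++ [A]) (numN_erase_append _ _))
        (Fin.forall_fin_one.2
          (isBoard_numN (hr.2.2 _ List.mem_cons_self) (erase Γ) le_rfl))
        (Fin.forall_fin_one.2 (isSucc_id hr.2.1 (hr.2.2 _ List.mem_cons_self)
          (restrict_restrict _ _) (erase Γ) rfl (anns_prefix _ _))))
        (fun i : Fin 1 => .opn i)
  | ⟨.ctr Θ Γ A u B, hr⟩ =>
      .node (D := RCGT) (.rule (CRule.ctr (erase Γ) A B) (boardOf Θ (Γ ++ [(A, u)]))
        (fun _ : Fin 1 => boardOf Θ (Γ ++ [(A, u), (A, u)]))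
        (isBoard_numN hr.2.1 (erase Γ ++ [A]) (numN_erase_append _ _))
        (Fin.forall_fin_one.2 (isBoard_numN (hr.2.2 _ List.mem_cons_self)
          (erase Γ ++ [A, A]) (numN_erase_append _ _)))
        (Fin.forall_fin_one.2 (isSucc_ctr hr.2.1 (hr.2.2 _ List.mem_cons_self))))
        (fun i : Fin 1 => .opn i)
  | ⟨.cut Θ Γ A B, hr⟩ =>
      .node (D := RCGT) (.rule (CRule.cut (erase Γ) A B) (boardOf Θ Γ)
        (![boardOf Θ Γ, boardOf Θ Γ] : Fin 2 → Board Bool)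
        (isBoard_numN hr.2.1 (erase Γ) le_rfl)
        (Fin.forall_fin_two.2
          ⟨isBoard_numN hr.2.1 (erase Γ) le_rfl,
            isBoard_numN hr.2.1 (erase Γ ++ [B]) (numN_init _ _)⟩)
        (Fin.forall_fin_two.2
          ⟨isSucc_id hr.2.1 hr.2.1 rfl (erase Γ) rfl (List.prefix_refl _),
            isSucc_id hr.2.1 hr.2.1 rfl (erase Γ) rfl (List.prefix_refl _)⟩))
        (![.opn (0 : Fin 2), popIf Θ Γ B A
            (hr.2.2 _ (List.mem_cons_of_mem _ List.mem_cons_self)) (1 : Fin 2)] :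
          Fin 2 → PTree RCGT (Fin 2))
  | ⟨.reset Θ Γ B u a, hr⟩ =>
      .node (D := RCGT) (.reset (⟨erase Γ, B⟩ : CSeq) a (boardOf Θ Γ)
        (boardOf (restrict Θ (cutAt u a Γ)) (cutAt u a Γ))
        (isBoard_numN hr.2.1 (erase Γ) le_rfl)
        (isBoard_numN (hr.2.2 _ List.mem_cons_self) (erase Γ) (by rw [erase_cutAt]))
        (isReset_boardOf hr.2.1 (hr.2.2 _ List.mem_cons_self) hr.1.1 hr.1.2))
        (fun i : Fin 1 => .opn i)

theorem embedTmpl_root (r : RGT.Rule) :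
    (embedTmpl r).root (fun i => embedSeq (RGT.prem r i)) = embedSeq (RGT.concl r) := by
  obtain ⟨r, hr⟩ := r
  cases r
  case id | zero | succ | impR | cut | reset => exact BSeq.ext' rfl rfl
  all_goals
    refine BSeq.ext' (congrArg (fun c => CSeq.mk c _) ?_) rfl
    simp [erase, RGT, RSchema.concl]

theorem embedTmpl_wf (r : RGT.Rule) :
    (embedTmpl r).Wf (fun i => embedSeq (RGT.prem r i)) [] := by
  obtain ⟨r, hr⟩ := r
  cases r
  case id | zero | succ => exact fun i : Fin 0 => i.elim0
  case impL Θ Γ A B u C =>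
    obtain rfl := impL_isSeq hr.2.1
    exact Fin.forall_fin_two.2 ⟨⟨BSeq.ext' rfl rfl, trivial⟩,
      popIf_root _ (1 : Fin 2) _ rfl _ rfl rfl, popIf_wf _ (1 : Fin 2) _ rfl _⟩
  case impR Θ Γ A B =>
    exact Fin.forall_fin_one.2
      ⟨popIf_root _ (0 : Fin 1) _ rfl _ rfl rfl, popIf_wf _ (0 : Fin 1) _ rfl _⟩
  case cut Θ Γ A B =>
    exact Fin.forall_fin_two.2 ⟨⟨BSeq.ext' rfl rfl, trivial⟩,
      popIf_root _ (1 : Fin 2) _ rfl _ rfl rfl, popIf_wf _ (1 : Fin 2) _ rfl _⟩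
  case cond Θ Γ u A a =>
    exact Fin.forall_fin_two.2 ⟨⟨BSeq.ext' rfl rfl, trivial⟩,
      BSeq.ext' (congrArg (fun c => CSeq.mk c _) (erase_append _ _)) rfl, trivial⟩
  case ex Θ Γ A v B u Δ C =>
    exact Fin.forall_fin_one.2
      ⟨BSeq.ext' (congrArg (fun c => CSeq.mk c _)
        (by simp [erase] : erase (Γ ++ [(A, v), (B, u)] ++ Δ) = erase Γ ++ [A, B] ++ erase Δ)) rfl,
        trivial⟩
  case wk Θ Γ A u B => exact Fin.forall_fin_one.2 ⟨BSeq.ext' rfl rfl, trivial⟩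
  case ctr Θ Γ A u B =>
    exact Fin.forall_fin_one.2
      ⟨BSeq.ext' (congrArg (fun c => CSeq.mk c _) (erase_append _ _)) rfl, trivial⟩
  case reset Θ Γ B u a =>
    exact Fin.forall_fin_one.2
      ⟨BSeq.ext' (congrArg (fun c => CSeq.mk c _) (erase_cutAt _ _ _)) rfl, trivial⟩

theorem embedTmpl_opens (r : RGT.Rule) :
    (embedTmpl r).opens = List.finRange (RGT.arity r) := by
  obtain ⟨r, hr⟩ := r
  cases r
  case id | zero | succ | cond | ex | wk | ctr | reset => rfl
  case impR Θ Γ A B =>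
    change [(popIf Θ Γ A B _ (0 : Fin 1)).opens].flatten = [(0 : Fin 1)]
    rw [popIf_opens]; rfl
  case impL Θ Γ A B u C =>
    change [[(0 : Fin 2)], (popIf Θ Γ B C (impL_isSeq' hr.2.1) (1 : Fin 2)).opens].flatten = [(0 : Fin 2), 1]
    rw [popIf_opens]; rfl
  case cut Θ Γ A B =>
    change [[(0 : Fin 2)], (popIf Θ Γ B A (hr.2.2 _ (List.mem_cons_of_mem _ List.mem_cons_self))
      (1 : Fin 2)).opens].flatten = [(0 : Fin 2), 1]
    rw [popIf_opens]; rfl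

/-- The embedding of reset Gödel's T into the reset proof system of cyclic Gödel's T. -/
noncomputable def embed : PreproofMorphism RGT RCGT where
  seq := embedSeq
  tmpl := embedTmpl
  root_eq := embedTmpl_root
  wf := embedTmpl_wf
  opens_eq := embedTmpl_opens

/-- `P` is a proof of the sequent `s` in cyclic Gödel's T. -/
def IsCGTProofOf (P : SeqTree CGT) (s : CSeq) : Prop :=
  IsTraceProof true cgtTrace P ∧ P.endseq = s

/-- `P` is a proof of the sequent `s` in reset Gödel's T. -/
def IsRGTProofOf (P : SeqTree RGT) (s : CSeq) : Prop :=
  IsRGTProof P ∧ P.endseq = s.annotate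

end CyclicProofs

namespace CyclicProofs

/-! ### Nodes of cyclic trees -/

/-- Change the companion of a bud. -/
def Label.mapBud {D : DerivSys} {V : Type} (g : ℕ → ℕ) : Label D V → Label D V
  | .opn v => .opn v
  | .bud Γ l => .bud Γ (g l)
  | .rule r => .rule r

namespace PTree

variable {D : DerivSys} {V : Type}

@[simp] theorem sub_nil (P : PTree D V) : P.sub [] = some P := by
  cases P <;> rfl

theorem sub_append (P : PTree D V) (a b : List ℕ) :
    P.sub (a ++ b) = (P.sub a).bind (fun Q => Q.sub b) := by
  induction a generalizing P with
  | nil => simp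
  | cons i a ih =>
    cases P with
    | opn v => rfl
    | bud Γ l => rfl
    | node r ts =>
      simp only [List.cons_append, sub]
      split_ifs
      · exact ih _
      · rfl

theorem sub_append_singleton {P Q : PTree D V} {a : List ℕ} {i : ℕ} :
    P.sub (a ++ [i]) = some Q ↔
      ∃ r ts, P.sub a = some (.node r ts) ∧ ∃ h : i < D.arity r, ts ⟨i, h⟩ = Q := by
  rw [sub_append, Option.bind_eq_some_iff]
  constructor
  · rintro ⟨R, hR, hQ⟩
    cases R with
    | opn v => simp [sub] at hQ
    | bud Γ l => simp [sub] at hQ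
    | node r ts =>
      simp only [sub] at hQ
      split_ifs at hQ with h
      exact ⟨r, ts, hR, h, by simpa using hQ⟩
  · rintro ⟨r, ts, hR, h, rfl⟩
    exact ⟨_, hR, by simp [sub, h]⟩

theorem label_eq_rule {P : PTree D V} {a : List ℕ} {r : D.Rule} :
    P.label a = some (.rule r) ↔ ∃ ts, P.sub a = some (.node r ts) := by
  unfold label
  rw [Option.map_eq_some_iff]
  constructor
  · rintro ⟨Q, hQ, h⟩
    cases Q <;> simp [rootLabel] at h
    subst h
    exact ⟨_, hQ⟩
  · rintro ⟨ts, h⟩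
    exact ⟨_, h, rfl⟩

theorem label_eq_bud {P : PTree D V} {a : List ℕ} {Γ : D.Seq} {l : ℕ} :
    P.label a = some (.bud Γ l) ↔ P.sub a = some (.bud Γ l) := by
  unfold label
  rw [Option.map_eq_some_iff]
  constructor
  · rintro ⟨Q, hQ, h⟩
    cases Q <;> simp [rootLabel] at h
    obtain ⟨rfl, rfl⟩ := h
    exact hQ
  · rintro h
    exact ⟨_, h, rfl⟩

theorem label_eq_opn {P : PTree D V} {a : List ℕ} {v : V} :
    P.label a = some (.opn v) ↔ P.sub a = some (.opn v) := by
  unfold label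
  rw [Option.map_eq_some_iff]
  constructor
  · rintro ⟨Q, hQ, h⟩
    cases Q <;> simp [rootLabel] at h
    subst h
    exact hQ
  · rintro h
    exact ⟨_, h, rfl⟩

theorem label_eq_none {P : PTree D V} {a : List ℕ} : P.label a = none ↔ P.sub a = none := by
  simp [label]

theorem label_append {P Q : PTree D V} {a : List ℕ} (h : P.sub a = some Q) (b : List ℕ) :
    P.label (a ++ b) = Q.label b := by
  simp [label, sub_append, h]

/-- Below a node there is an application of a rule with sufficiently many premises. -/
theorem exists_rule_of_label {P : PTree D V} {a b : List ℕ} {i : ℕ}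
    (h : P.label a ≠ none) (hb : b ++ [i] <+: a) :
    ∃ r, P.label b = some (.rule r) ∧ i < D.arity r := by
  obtain ⟨c, rfl⟩ := hb
  rw [Ne, label_eq_none, sub_append] at h
  cases hs : P.sub (b ++ [i]) with
  | none => simp [hs] at h
  | some Q =>
    obtain ⟨r, ts, h1, h2, -⟩ := sub_append_singleton.1 hs
    exact ⟨r, label_eq_rule.2 ⟨ts, h1⟩, h2⟩

theorem exists_rule_take {P : PTree D V} {a : List ℕ} {m : ℕ}
    (h : P.label a ≠ none) (hm : m < a.length) :
    ∃ r, P.label (a.take m) = some (.rule r) ∧ a[m] < D.arity r := by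
  refine exists_rule_of_label h ?_
  rw [← List.take_succ_eq_append_getElem hm]
  exact List.take_prefix _ _

/-- Finiteness of preproofs enters through this lemma three times: for the set of bad buds, for the
bound on the contexts and for the number of configurations. -/
theorem finite_label (P : PTree D V) : {a | P.label a ≠ none}.Finite := by
  induction P with
  | opn v =>
    refine (Set.finite_singleton []).subset fun a ha => ?_
    cases a
    · rfl
    · exact absurd rfl ha
  | bud Γ l =>
    refine (Set.finite_singleton []).subset fun a ha => ?_
    cases a
    · rfl
    · exact absurd rfl ha
  | node r ts ih =>
    refine ((Set.finite_singleton []).union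
      (Set.finite_iUnion fun i => (ih i).image (fun a => i.1 :: a))).subset fun a ha => ?_
    cases a with
    | nil => exact Or.inl rfl
    | cons j a =>
      right
      by_cases hj : j < D.arity r
      · refine Set.mem_iUnion.2 ⟨⟨j, hj⟩, a, ?_, rfl⟩
        simpa [label, sub, hj] using ha
      · simp [label, sub, hj] at ha

theorem opens_sub {P : PTree D V} (h : P.opens = []) {a : List ℕ} {Q : PTree D V}
    (hQ : P.sub a = some Q) : Q.opens = [] := by
  induction a generalizing P with
  | nil => simp at hQ; rwa [← hQ]
  | cons i a ih =>
    cases P with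
    | opn v => simp [sub] at hQ
    | bud Γ l => simp [sub] at hQ
    | node r ts =>
      simp only [sub] at hQ
      split_ifs at hQ with hi
      refine ih ?_ hQ
      rw [opens, List.flatten_eq_nil_iff] at h
      exact h _ (List.mem_ofFn.2 ⟨_, rfl⟩)

/-- `H` lists the rules on the path to `Q`. It turns the index by which a bud refers to its
ancestors into a prefix `a.take k` of its address. -/
theorem wf_sub {lab : V → D.Seq} {P Q : PTree D V} {anc : List D.Seq} {a : List ℕ}
    (h : P.Wf lab anc) (hQ : P.sub a = some Q) :
    ∃ H : List D.Rule, H.length = a.length ∧ Q.Wf lab (anc ++ H.map D.concl) ∧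
      ∀ k (hk : k < H.length), P.label (a.take k) = some (.rule H[k]) := by
  induction a generalizing P anc with
  | nil =>
    simp at hQ
    subst hQ
    exact ⟨[], rfl, by simpa using h, by simp⟩
  | cons i a ih =>
    cases P with
    | opn v => simp [sub] at hQ
    | bud Γ l => simp [sub] at hQ
    | node r ts =>
      simp only [sub] at hQ
      split_ifs at hQ with hi
      obtain ⟨H, h1, h2, h3⟩ := ih (h ⟨i, hi⟩).2 hQ
      refine ⟨r :: H, by simp [h1], by simpa using h2, ?_⟩
      rintro (_ | k) hk
      · rfl
      · simpa [label, sub, hi] using h3 k (by simpa using hk)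

/-- Replace the part above the node `t` by `R`. -/
def replaceAt (R : PTree D V) : PTree D V → List ℕ → PTree D V
  | .node r ts, i :: a => .node r fun j => if j.1 = i then replaceAt R (ts j) a else ts j
  | .opn v, _ :: _ => .opn v
  | .bud Γ l, _ :: _ => .bud Γ l
  | _, [] => R

theorem label_replaceAt_append {P R Q : PTree D V} {t : List ℕ} (h : P.sub t = some Q)
    (u : List ℕ) : (replaceAt R P t).label (t ++ u) = R.label u := by
  induction t generalizing P with
  | nil => cases P <;> simp [replaceAt]
  | cons i t ih =>
    cases P with
    | opn v => simp [sub] at h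
    | bud Γ l => simp [sub] at h
    | node r ts =>
      simp only [sub] at h
      split_ifs at h with hi
      have := ih h
      simpa [replaceAt, label, sub, hi] using this

theorem label_replaceAt_of_not_prefix {P R : PTree D V} {t a : List ℕ} (h : ¬ t <+: a) :
    (replaceAt R P t).label a = P.label a := by
  induction t generalizing P a with
  | nil => simp at h
  | cons i t ih =>
    cases P with
    | opn v => rfl
    | bud Γ l => rfl
    | node r ts =>
      cases a with
      | nil => rfl
      | cons j a =>
        simp only [replaceAt, label, sub]
        split_ifs with hj hji
        · subst hji
          exact ih (by simpa using h)
        · rfl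
        · rfl

/-- Change the companion of each bud as prescribed by `f`; the tree itself is placed at the
given address. -/
def relabel (f : List ℕ → ℕ → ℕ) : PTree D V → List ℕ → PTree D V
  | .opn v, _ => .opn v
  | .bud Γ l, a => .bud Γ (f a l)
  | .node r ts, a => .node r fun i => (ts i).relabel f (a ++ [i.1])

theorem label_relabel (f : List ℕ → ℕ → ℕ) (P : PTree D V) (a u : List ℕ) :
    (P.relabel f a).label u = (P.label u).map (Label.mapBud (f (a ++ u))) := by
  induction u generalizing P a with
  | nil => cases P <;> simp [relabel, label, rootLabel, Label.mapBud]
  | cons i u ih =>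
    cases P with
    | opn v => rfl
    | bud Γ l => rfl
    | node r ts =>
      by_cases hi : i < D.arity r
      · have := ih (ts ⟨i, hi⟩) (a ++ [i])
        simpa [relabel, label, sub, hi] using this
      · simp [relabel, label, sub, hi]

end PTree

/-- In a preproof, a bud has a companion with the same sequent. -/
theorem IsPreproof.companion {D : DerivSys} {P : SeqTree D} (h : IsPreproof P) {t : List ℕ}
    {Γ : D.Seq} {l : ℕ} (ht : P.label t = some (.bud Γ l)) :
    l < t.length ∧ ∃ r, P.label (t.take l) = some (.rule r) ∧ D.concl r = Γ := by
  obtain ⟨H, h1, h2, h3⟩ := PTree.wf_sub h (PTree.label_eq_bud.1 ht)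
  simp only [PTree.Wf, List.nil_append, List.getElem?_map, Option.map_eq_some_iff] at h2
  obtain ⟨r, hr, rfl⟩ := h2
  obtain ⟨hl, rfl⟩ := List.getElem?_eq_some_iff.1 hr
  exact ⟨h1 ▸ hl, _, h3 l hl, rfl⟩

/-- In a preproof, the premises of a rule are as they should be. -/
theorem IsPreproof.premise {D : DerivSys} {P : SeqTree D} (h : IsPreproof P) {t : List ℕ}
    {r : D.Rule} {ts : Fin (D.arity r) → SeqTree D} (ht : P.sub t = some (.node r ts))
    (i : Fin (D.arity r)) : (ts i).endseq = D.prem r i := by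
  obtain ⟨H, h1, h2, h3⟩ := PTree.wf_sub h ht
  exact (h2 i).1

/-! ### Annotated sequents and the rules of reset Gödel's T -/

/-- Removing the control and the annotations of a sequent. -/
def ASeq.strip (S : ASeq) : CSeq := ⟨erase S.ctx, S.ty⟩

/-- The rule of cyclic Gödel's T from which a rule of reset Gödel's T comes. -/
def RSchema.strip : RSchema → Option CRule
  | .id _ A _ => some (.id A)
  | .zero _ => some .zero
  | .succ _ _ => some .succ
  | .impL _ Γ A B _ C => some (.impL (erase Γ) A B C)
  | .impR _ Γ A B => some (.impR (erase Γ) A B)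
  | .cond _ Γ _ A _ => some (.cond (erase Γ) A)
  | .ex _ Γ A _ B _ Δ C => some (.ex (erase Γ) A B (erase Δ) C)
  | .wk _ Γ A _ B => some (.wk (erase Γ) A B)
  | .ctr _ Γ A _ B => some (.ctr (erase Γ) A B)
  | .cut _ Γ A B => some (.cut (erase Γ) A B)
  | .reset .. => none

theorem exists_fresh (Θ : List ℕ) : ∃ c, c ∉ Θ := by
  obtain ⟨c, hc⟩ := Infinite.exists_notMem_finset Θ.toFinset
  exact ⟨c, by simpa using hc⟩

open Classical in
/-- The least letter that does not occur in `Θ`. -/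
noncomputable def fresh (Θ : List ℕ) : ℕ := Nat.find (exists_fresh Θ)

theorem fresh_notMem (Θ : List ℕ) : fresh Θ ∉ Θ := by
  classical
  exact Nat.find_spec (exists_fresh Θ)

/-- All smaller numbers occur in `Θ`. Taking the least letter is what keeps the supply of letters
finite. -/
theorem fresh_le_length (Θ : List ℕ) : fresh Θ ≤ Θ.length := by
  classical
  have : Finset.range (fresh Θ) ⊆ Θ.toFinset := by
    intro c hc
    have := Nat.find_min (exists_fresh Θ) (Finset.mem_range.1 hc)
    simpa using this
  simpa using (Finset.card_le_card this).trans (List.toFinset_card_le Θ)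

/-- The new letter of a case distinction is the least one available. -/
def RSchema.IsFresh : RSchema → Prop
  | .cond Θ _ _ _ a => a = fresh Θ
  | _ => True

theorem erase_eq_append {Γ : List AFm} {Γ₁ Γ₂ : List Ty} (h : erase Γ = Γ₁ ++ Γ₂) :
    ∃ Δ₁ Δ₂, Γ = Δ₁ ++ Δ₂ ∧ erase Δ₁ = Γ₁ ∧ erase Δ₂ = Γ₂ := by
  obtain ⟨Δ₁, Δ₂, h1, h2, h3⟩ := List.map_eq_append_iff.1 h
  exact ⟨Δ₁, Δ₂, h1, h2, h3⟩

theorem erase_eq_singleton {Γ : List AFm} {A : Ty} (h : erase Γ = [A]) :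
    ∃ u, Γ = [(A, u)] := by
  obtain ⟨⟨B, u⟩, h1, rfl⟩ := List.map_eq_singleton_iff.1 h
  exact ⟨u, h1⟩

/-- Every rule of cyclic Gödel's T can be applied to every annotation of its conclusion. -/
theorem exists_lift (r : CRule) (S : ASeq) (h : S.strip = r.concl) :
    ∃ R : RSchema, R.strip = some r ∧ R.concl = S ∧ R.Side ∧ R.IsFresh := by
  obtain ⟨Θ, Γ, C⟩ := S
  cases r
  all_goals
    simp only [ASeq.strip, CRule.concl, CSeq.mk.injEq] at h
    obtain ⟨h, rfl⟩ := h
  case id =>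
    obtain ⟨u, rfl⟩ := erase_eq_singleton h
    exact ⟨.id Θ C u, rfl, rfl, trivial, trivial⟩
  case zero =>
    obtain rfl : Γ = [] := by simpa [erase] using h
    exact ⟨.zero Θ, rfl, rfl, trivial, trivial⟩
  case succ =>
    obtain ⟨u, rfl⟩ := erase_eq_singleton h
    exact ⟨.succ Θ u, rfl, rfl, trivial, trivial⟩
  case impL A B =>
    obtain ⟨Γ, Δ, rfl, rfl, h1⟩ := erase_eq_append h
    obtain ⟨u, rfl⟩ := erase_eq_singleton h1
    exact ⟨.impL Θ Γ A B u C, rfl, rfl, trivial, trivial⟩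
  case impR A B =>
    subst h
    exact ⟨.impR Θ Γ A B, rfl, rfl, trivial, trivial⟩
  case cond =>
    obtain ⟨Γ, Δ, rfl, rfl, h1⟩ := erase_eq_append h
    obtain ⟨u, rfl⟩ := erase_eq_singleton h1
    exact ⟨.cond Θ Γ u C (fresh Θ), rfl, rfl, fresh_notMem Θ, rfl⟩
  case ex A B Δ =>
    obtain ⟨Γ, Δ, rfl, h1, rfl⟩ := erase_eq_append h
    obtain ⟨Γ, Δ', rfl, rfl, h2⟩ := erase_eq_append h1
    obtain ⟨Δ₁, Δ₂, rfl, h3, h4⟩ := erase_eq_append (Γ₁ := [B]) (Γ₂ := [A]) h2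
    obtain ⟨u, rfl⟩ := erase_eq_singleton h3
    obtain ⟨v, rfl⟩ := erase_eq_singleton h4
    exact ⟨.ex Θ Γ A v B u Δ C, rfl, rfl, trivial, trivial⟩
  case wk A =>
    obtain ⟨Γ, Δ, rfl, rfl, h1⟩ := erase_eq_append h
    obtain ⟨u, rfl⟩ := erase_eq_singleton h1
    exact ⟨.wk Θ Γ A u C, rfl, rfl, trivial, trivial⟩
  case ctr A =>
    obtain ⟨Γ, Δ, rfl, rfl, h1⟩ := erase_eq_append h
    obtain ⟨u, rfl⟩ := erase_eq_singleton h1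
    exact ⟨.ctr Θ Γ A u C, rfl, rfl, trivial, trivial⟩
  case cut B =>
    subst h
    exact ⟨.cut Θ Γ C B, rfl, rfl, trivial, trivial⟩

theorem RSchema.strip_prems {R : RSchema} {r : CRule} (h : R.strip = some r) :
    R.prems.map ASeq.strip = r.prems := by
  cases R <;> simp only [RSchema.strip, Option.some.injEq, reduceCtorEq] at h <;> subst h <;>
    simp [RSchema.prems, CRule.prems, ASeq.strip, erase]

/-! ### Tidy sequents and their preservation by the rules -/

/-- All annotations containing a given letter agree up to that letter. -/
def Coherent (Γ : List AFm) : Prop :=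
  ∀ p ∈ Γ, ∀ q ∈ Γ, ∀ (a : ℕ) (u v u' v' : List ℕ),
    p.2 = u ++ a :: v → q.2 = u' ++ a :: v' → u = u'

/-- Coherence survives deletion, duplication and truncation of annotations, and the addition of
empty ones. This covers all premises but the right one of `cond`, where an annotation grows. -/
theorem Coherent.of_prefix {Γ Γ' : List AFm} (h : Coherent Γ)
    (h' : ∀ p ∈ Γ', p.2 ≠ [] → ∃ q ∈ Γ, p.2 <+: q.2) : Coherent Γ' := by
  intro p hp q hq a u v u' v' hu hu'
  obtain ⟨p', hp', w, hw⟩ := h' p hp (by simp [hu])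
  obtain ⟨q', hq', w', hw'⟩ := h' q hq (by simp [hu'])
  refine h p' hp' q' hq' a u (v ++ w) u' (v' ++ w') ?_ ?_
  · rw [← hw, hu]; simp
  · rw [← hw', hu']; simp

/-- Sequents of reset Gödel's T in which every letter of the control occurs and the annotations
are coherent. -/
structure ASeq.Tidy (S : ASeq) : Prop where
  isSeq : S.IsSeq
  occurs : ∀ c ∈ S.control, ∃ p ∈ S.ctx, c ∈ p.2
  coherent : Coherent S.ctx

theorem ASeq.IsSeq.restrict {Θ : List ℕ} {Γ Δ : List AFm} {A B : Ty}
    (h : ASeq.IsSeq ⟨Θ, Γ ++ Δ, A⟩) : ASeq.IsSeq ⟨restrict Θ Γ, Γ, B⟩ :=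
  ⟨h.1.filter _, fun p hp => ⟨sublist_restrict hp (h.2 p (List.mem_append_left _ hp)).1,
    (h.2 p (List.mem_append_left _ hp)).2⟩⟩

theorem ASeq.Tidy.restrict {Θ : List ℕ} {Γ Δ : List AFm} {A B : Ty}
    (h : ASeq.Tidy ⟨Θ, Γ ++ Δ, A⟩) : ASeq.Tidy ⟨CyclicProofs.restrict Θ Γ, Γ, B⟩ :=
  ⟨h.isSeq.restrict, fun _ hc => (mem_restrict.1 hc).2, h.coherent.of_prefix
    fun p hp _ => ⟨p, List.mem_append_left _ hp, List.prefix_rfl⟩⟩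

/-- With a fixed control, tidiness depends only on the set of formulas with non-empty annotation.
Exchange, contraction, cut and the introduction of formulas annotated by `ε` do not change this set.
-/
theorem ASeq.Tidy.of_mem {Θ : List ℕ} {Γ Γ' : List AFm} {A A' : Ty}
    (h : ASeq.Tidy ⟨Θ, Γ, A⟩) (h1 : ∀ p ∈ Γ', p.2 = [] ∨ p ∈ Γ)
    (h2 : ∀ p ∈ Γ, p.2 = [] ∨ p ∈ Γ') : ASeq.Tidy ⟨Θ, Γ', A'⟩ := by
  refine ⟨⟨h.isSeq.1, fun p hp => ?_⟩, fun c hc => ?_, h.coherent.of_prefix fun p hp hne => ?_⟩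
  · rcases h1 p hp with h0 | h0
    · simp [h0]
    · exact h.isSeq.2 p h0
  · obtain ⟨p, hp, hcp⟩ := h.occurs c hc
    rcases h2 p hp with h0 | h0
    · simp [h0] at hcp
    · exact ⟨p, h0, hcp⟩
  · exact ⟨p, (h1 p hp).resolve_left hne, List.prefix_rfl⟩

theorem ASeq.Tidy.append_nil {Θ : List ℕ} {Γ : List AFm} {A A' B : Ty}
    (h : ASeq.Tidy ⟨Θ, Γ, A⟩) : ASeq.Tidy ⟨Θ, Γ ++ [(B, [])], A'⟩ := by
  refine h.of_mem (fun p hp => ?_) fun p hp => Or.inr (List.mem_append_left _ hp)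
  rcases List.mem_append.1 hp with hp | hp
  · exact Or.inr hp
  · rw [List.mem_singleton] at hp
    exact Or.inl (by rw [hp])

/-- The new letter occurs only at the end of `u ++ [a]`, so it is coherent with itself, and any
other letter of `u ++ [a]` is preceded by the same letters as in `u`. -/
theorem ASeq.Tidy.cond {Θ : List ℕ} {Γ : List AFm} {A : Ty} {u : List ℕ} {a : ℕ}
    (h : ASeq.Tidy ⟨Θ, Γ ++ [(.nat, u)], A⟩) (ha : a ∉ Θ) :
    ASeq.Tidy ⟨Θ ++ [a], Γ ++ [(.nat, u ++ [a])], A⟩ := by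
  have hmem : ∀ p ∈ Γ ++ [(Ty.nat, u)], a ∉ p.2 := fun p hp hap =>
    ha ((h.isSeq.2 p hp).1.subset hap)
  have hu := h.isSeq.2 (.nat, u) (by simp)
  refine ⟨⟨?_, ?_⟩, ?_, ?_⟩
  · simpa [List.nodup_append] using ⟨h.isSeq.1, fun x hx hxa => ha (hxa ▸ hx)⟩
  · intro p hp
    rcases List.mem_append.1 hp with hp | hp
    · have := h.isSeq.2 p (List.mem_append_left _ hp)
      exact ⟨this.1.trans (List.sublist_append_left _ _), this.2⟩
    · rw [List.mem_singleton] at hp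
      subst hp
      exact ⟨hu.1.append (List.Sublist.refl _), by simp⟩
  · intro c hc
    rcases List.mem_append.1 hc with hc | hc
    · obtain ⟨p, hp, hcp⟩ := h.occurs c hc
      rcases List.mem_append.1 hp with hp | hp
      · exact ⟨p, List.mem_append_left _ hp, hcp⟩
      · rw [List.mem_singleton] at hp
        subst hp
        exact ⟨(.nat, u ++ [a]), by simp, List.mem_append_left _ hcp⟩
    · exact ⟨(.nat, u ++ [a]), by simp, by simpa using Or.inr hc⟩
  · have key : ∀ p ∈ Γ ++ [(Ty.nat, u ++ [a])], ∀ c w v, p.2 = w ++ c :: v → c ≠ a →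
        ∃ q ∈ Γ ++ [(Ty.nat, u)], ∃ v', q.2 = w ++ c :: v' := by
      intro p hp c w v hpw hca
      rcases List.mem_append.1 hp with hp | hp
      · exact ⟨p, List.mem_append_left _ hp, v, hpw⟩
      · rw [List.mem_singleton] at hp
        subst hp
        -- As `c ≠ a`, the part `v` after `c` ends in the new letter `a`; dropping it leads back to
        -- `u`.
        refine ⟨(.nat, u), by simp, v.dropLast, ?_⟩
        have hv : v ≠ [] := by
          rintro rfl
          have := (List.append_inj' hpw rfl).2
          simp at this
          exact hca this.symm
        have := congrArg List.dropLast hpw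
        rwa [List.dropLast_concat, List.dropLast_append_of_ne_nil (by simp),
          List.dropLast_cons_of_ne_nil hv] at this
    have key' : ∀ p ∈ Γ ++ [(Ty.nat, u ++ [a])], ∀ w v, p.2 = w ++ a :: v → w = u := by
      intro p hp w v hpw
      rcases List.mem_append.1 hp with hp | hp
      · exact absurd (by simp [hpw]) (hmem p (List.mem_append_left _ hp))
      · rw [List.mem_singleton] at hp
        subst hp
        have hau : a ∉ u := hmem (.nat, u) (by simp)
        rcases List.append_eq_append_iff.1 hpw with ⟨x, rfl, hx⟩ | ⟨x, rfl, hx⟩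
        · cases x with
          | nil => simp
          | cons z x => simp at hx
        · cases x with
          | nil => simp
          | cons z x =>
            simp only [List.cons_append, List.cons.injEq] at hx
            exact absurd (by simp [hx.1]) hau
    intro p hp q hq c w v w' v' hpw hqw
    by_cases hca : c = a
    · subst hca
      rw [key' p hp w v hpw, key' q hq w' v' hqw]
    · obtain ⟨p', hp', x, hx⟩ := key p hp c w v hpw hca
      obtain ⟨q', hq', x', hx'⟩ := key q hq c w' v' hqw hca
      exact h.coherent p' hp' q' hq' c w x w' x' hx hx'

theorem cutAt_mem {u : List ℕ} {a : ℕ} {Γ : List AFm}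
    (hu : ∀ p ∈ Γ, a ∈ p.2 → ∃ v, v ≠ [] ∧ p.2 = u ++ a :: v) {p : AFm} (hp : p ∈ cutAt u a Γ) :
    ∃ q ∈ Γ, p.1 = q.1 ∧ p.2 <+: q.2 := by
  simp only [cutAt, List.mem_map] at hp
  obtain ⟨q, hq, rfl⟩ := hp
  split_ifs with haq
  · obtain ⟨v, -, hv⟩ := hu q hq haq
    exact ⟨q, hq, rfl, by rw [hv]; simp⟩
  · exact ⟨q, hq, rfl, List.prefix_rfl⟩

theorem ASeq.Tidy.reset {Θ : List ℕ} {Γ : List AFm} {A : Ty} {u : List ℕ} {a : ℕ}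
    (h : ASeq.Tidy ⟨Θ, Γ, A⟩)
    (hu : ∀ p ∈ Γ, a ∈ p.2 → ∃ v, v ≠ [] ∧ p.2 = u ++ a :: v) :
    ASeq.Tidy ⟨CyclicProofs.restrict Θ (cutAt u a Γ), cutAt u a Γ, A⟩ := by
  refine ⟨⟨h.isSeq.1.filter _, fun p hp => ?_⟩, fun _ hc => (mem_restrict.1 hc).2,
    h.coherent.of_prefix fun p hp _ => ?_⟩
  · obtain ⟨q, hq, h1, h2⟩ := cutAt_mem hu hp
    refine ⟨sublist_restrict hp (h2.sublist.trans (h.isSeq.2 q hq).1), fun hne => ?_⟩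
    rw [h1]
    exact (h.isSeq.2 q hq).2 fun h0 => hne (by simpa [h0] using h2)
  · obtain ⟨q, hq, -, h2⟩ := cutAt_mem hu hp
    exact ⟨q, hq, h2⟩

theorem RSchema.tidy_prems {R : RSchema} (h : R.concl.Tidy) (hs : R.Side) {p : ASeq}
    (hp : p ∈ R.prems) : p.Tidy := by
  cases R
  case id | zero | succ => simp [RSchema.prems] at hp
  case impL Θ Γ A B u C =>
    -- An implication has the empty annotation, so the one that `B` inherits is empty and admissible
    -- for every type `B`.
    obtain rfl := impL_isSeq h.isSeq
    simp only [RSchema.prems, List.mem_cons, List.not_mem_nil, or_false] at hp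
    rcases hp with rfl | rfl
    · exact h.restrict
    · refine h.of_mem ?_ ?_ <;>
      · intro p hp
        simp only [List.mem_append, List.mem_singleton] at hp ⊢
        rcases hp with hp | rfl <;> simp [*]
  case impR Θ Γ A B =>
    simp only [RSchema.prems, List.mem_cons, List.not_mem_nil, or_false] at hp
    subst hp
    exact h.append_nil
  case cond Θ Γ u A a =>
    simp only [RSchema.prems, List.mem_cons, List.not_mem_nil, or_false] at hp
    rcases hp with rfl | rfl
    · exact h.restrict
    · exact h.cond hs
  case ex Θ Γ A v B u Δ C =>
    simp only [RSchema.prems, List.mem_cons, List.not_mem_nil, or_false] at hp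
    subst hp
    refine h.of_mem ?_ ?_ <;>
    · intro p hp
      simp only [List.mem_append, List.mem_cons, List.not_mem_nil, or_false] at hp ⊢
      tauto
  case wk Θ Γ A u B =>
    simp only [RSchema.prems, List.mem_cons, List.not_mem_nil, or_false] at hp
    subst hp
    exact h.restrict
  case ctr Θ Γ A u B =>
    simp only [RSchema.prems, List.mem_cons, List.not_mem_nil, or_false] at hp
    subst hp
    refine h.of_mem ?_ ?_ <;>
    · intro p hp
      simp only [List.mem_append, List.mem_cons, List.not_mem_nil, or_false] at hp ⊢
      tauto
  case cut Θ Γ A B =>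
    simp only [RSchema.prems, List.mem_cons, List.not_mem_nil, or_false] at hp
    rcases hp with rfl | rfl
    · exact h.of_mem (fun _ => Or.inr) (fun _ => Or.inr)
    · exact h.append_nil
  case reset Θ Γ B u a =>
    simp only [RSchema.prems, List.mem_cons, List.not_mem_nil, or_false] at hp
    subst hp
    exact h.reset hs.2

theorem restrict_sublist (Θ : List ℕ) (Γ : List AFm) : (restrict Θ Γ).Sublist Θ :=
  List.filter_sublist

/-- From the conclusion to a premise, letters may be deleted and the fresh letter may be added. -/
theorem RSchema.control_prems {R : RSchema} {r : CRule} (h : R.strip = some r) (hf : R.IsFresh)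
    {p : ASeq} (hp : p ∈ R.prems) :
    ∃ Θ : List ℕ, Θ.Sublist R.concl.control ∧
      (p.control = Θ ∨ p.control = Θ ++ [fresh R.concl.control]) := by
  cases R
  case id | zero | succ => simp [RSchema.prems] at hp
  case reset => simp [RSchema.strip] at h
  case impR | ex | ctr =>
    simp only [RSchema.prems, List.mem_cons, List.not_mem_nil, or_false] at hp
    subst hp
    exact ⟨_, List.Sublist.refl _, Or.inl rfl⟩
  case wk =>
    simp only [RSchema.prems, List.mem_cons, List.not_mem_nil, or_false] at hp
    subst hp
    exact ⟨_, restrict_sublist _ _, Or.inl rfl⟩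
  case cond =>
    obtain rfl := hf
    simp only [RSchema.prems, List.mem_cons, List.not_mem_nil, or_false] at hp
    rcases hp with rfl | rfl
    · exact ⟨_, restrict_sublist _ _, Or.inl rfl⟩
    · exact ⟨_, List.Sublist.refl _, Or.inr rfl⟩
  case impL | cut =>
    simp only [RSchema.prems, List.mem_cons, List.not_mem_nil, or_false] at hp
    rcases hp with rfl | rfl
    · first
        | exact ⟨_, restrict_sublist _ _, Or.inl rfl⟩
        | exact ⟨_, List.Sublist.refl _, Or.inl rfl⟩
    · exact ⟨_, List.Sublist.refl _, Or.inl rfl⟩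

theorem anns_getElem?_left {Γ Δ Δ' : List AFm} {x : ℕ} {w : List ℕ} (hx : x < (anns Γ).length)
    (h : (anns (Γ ++ Δ))[x]? = some w) : (anns (Γ ++ Δ'))[x]? = some w := by
  rw [anns_append, List.getElem?_append_left hx] at h ⊢
  exact h

/-- Along a trace, annotations are copied, and the fresh letter is added if the trace has
value `1`. -/
theorem RSchema.trace_anns {R : RSchema} {r : CRule} (h : R.strip = some r) (hf : R.IsFresh)
    {i : ℕ} {p : ASeq} (hp : R.prems[i]? = some p) {x y : ℕ} {b : Bool} (ht : r.trace i x b y)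
    {w : List ℕ} (hw : (anns R.concl.ctx)[x]? = some w) :
    (anns p.ctx)[y]? = some (w ++ if b then [fresh R.concl.control] else []) := by
  -- The common situation: both contexts begin with `Γ`, and the trace relation is the identity on
  -- its occurrences of the ground type.
  have key : ∀ {Γ Δ Δ' : List AFm} {n : ℕ}, idUpTo n x b y → n = (anns Γ).length →
      (anns (Γ ++ Δ))[x]? = some w → (anns (Γ ++ Δ'))[y]? =
        some (w ++ if b then [fresh R.concl.control] else []) := by
    rintro Γ Δ Δ' n ⟨hx, rfl, rfl⟩ rfl hw
    simpa using anns_getElem?_left hx hw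
  cases R
  case reset => simp [RSchema.strip] at h
  all_goals
    simp only [RSchema.strip, Option.some.injEq] at h
    subst h
    rcases i with _ | _ | i <;>
      simp only [RSchema.prems, List.getElem?_cons_zero, List.getElem?_cons_succ,
        List.getElem?_nil, reduceCtorEq, Option.some.injEq] at hp <;> subst hp
  case impL.zero Θ Γ A B u C =>
    have := key (Γ := Γ) (Δ' := []) ht (by simp [CRule.concl, numN, ← numN_erase]) hw
    simpa using this
  case impL.succ.zero Θ Γ A B u C =>
    exact key (Γ := Γ) ht (by simp [CRule.concl, numN, ← numN_erase]) hw
  case impR.zero Θ Γ A B =>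
    exact key (Γ := Γ) (Δ := []) ht (by simp [CRule.concl, ← numN_erase])
      (by simpa [RSchema.concl] using hw)
  case cond.zero Θ Γ u A a =>
    have := key (Γ := Γ) (Δ' := []) ht (by simp [← numN_erase]) hw
    simpa using this
  case cond.succ.zero Θ Γ u A a =>
    obtain rfl := hf
    rcases ht with ht | ⟨rfl, rfl, rfl⟩
    · exact key (Γ := Γ) ht (by simp [← numN_erase]) hw
    · simp only [RSchema.concl, anns_append, numN_erase] at hw ⊢
      simp [anns] at hw ⊢
      simp [hw]
  case ex.zero Θ Γ A v B u Δ C =>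
    simp only [CRule.trace] at ht
    split_ifs at ht with hAB
    · obtain ⟨rfl, rfl⟩ := hAB
      obtain ⟨rfl, ht⟩ := ht
      simp only [RSchema.concl, numN_erase, anns_append, anns_cons, anns_nil, List.append_nil,
        if_true, List.cons_append, List.nil_append] at ht hw ⊢
      generalize anns Γ = L at *
      generalize anns Δ = M at *
      rcases ht with ⟨h1, rfl⟩ | ⟨h1, h2, rfl⟩ | ⟨rfl, rfl⟩ | ⟨rfl, rfl⟩
      · rw [List.append_assoc, List.getElem?_append_left h1] at hw ⊢
        simpa using hw
      · rw [List.getElem?_append_right (by simpa using h1)] at hw ⊢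
        simpa using hw
      · simp at hw ⊢; exact hw
      · simp at hw ⊢; exact hw
    · obtain ⟨-, rfl, rfl⟩ := ht
      have hanns : anns (Γ ++ [(A, v), (B, u)] ++ Δ) = anns (Γ ++ [(B, u), (A, v)] ++ Δ) := by
        simp only [anns_append, anns_cons, anns_nil]
        by_cases hA : A = .nat
        · have hB : B ≠ .nat := fun hB => hAB ⟨hA, hB⟩
          simp [hA, hB]
        · simp [hA]
      rw [hanns]
      simpa [RSchema.concl] using hw
  case wk.zero Θ Γ A u B =>
    have := key (Γ := Γ) (Δ' := []) ht (by simp [← numN_erase]) hw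
    simpa using this
  case ctr.zero Θ Γ A u B =>
    simp only [CRule.trace] at ht
    split_ifs at ht with hA
    · subst hA
      simp only [RSchema.concl, numN_erase] at ht hw ⊢
      rcases ht with ht | ⟨rfl, rfl, rfl⟩
      · have := key (Γ := Γ ++ [(.nat, u)]) (Δ := []) (Δ' := [(.nat, u)]) ht
          (by simp [anns]) (by simpa using hw)
        simpa [RSchema.concl] using this
      · simp only [anns_append] at hw ⊢
        simp [anns] at hw ⊢
        exact hw
    · exact key (Γ := Γ) ht (by simp [← numN_erase]) hw
  case cut.zero Θ Γ A B =>
    have := key (Γ := Γ) (Δ := []) (Δ' := []) ht (by simp [CRule.concl, ← numN_erase])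
      (by simpa [RSchema.concl] using hw)
    simpa using this
  case cut.succ.zero Θ Γ A B =>
    exact key (Γ := Γ) (Δ := []) ht (by simp [CRule.concl, ← numN_erase])
      (by simpa [RSchema.concl] using hw)

/-! ### Resetting a covered letter -/

/-- The reset rule with conclusion `S`, stack `u` and letter `a`. -/
def ASeq.resetRule (S : ASeq) (u : List ℕ) (a : ℕ) : RSchema :=
  .reset S.control S.ctx S.ty u a

open Classical in
/-- An application of the reset rule with conclusion `S`, if there is one. -/
noncomputable def ASeq.resets (S : ASeq) : List RSchema :=
  if h : ∃ x : List ℕ × ℕ, (S.resetRule x.1 x.2).Side then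
    [S.resetRule h.choose.1 h.choose.2]
  else []

open Classical in
/-- The premise of the reset, if there is one, and otherwise the sequent itself. -/
noncomputable def ASeq.afterReset (S : ASeq) : ASeq :=
  if h : ∃ x : List ℕ × ℕ, (S.resetRule x.1 x.2).Side then
    ⟨restrict S.control (cutAt h.choose.1 h.choose.2 S.ctx),
      cutAt h.choose.1 h.choose.2 S.ctx, S.ty⟩
  else S

/-- The interface to the choice made in `resets` and `afterReset`. Which of the possible resets is
chosen is immaterial: for the bound on letters one deletion per node suffices, and the stable letter
is found for any choice of resets. -/
theorem ASeq.reset_cases (S : ASeq) :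
    ((∀ u a, ¬ (S.resetRule u a).Side) ∧ S.resets = [] ∧ S.afterReset = S) ∨
    ∃ u a, (S.resetRule u a).Side ∧ S.resets = [S.resetRule u a] ∧
      (S.resetRule u a).prems = [S.afterReset] := by
  by_cases h : ∃ x : List ℕ × ℕ, (S.resetRule x.1 x.2).Side
  · exact Or.inr ⟨h.choose.1, h.choose.2, h.choose_spec, by rw [ASeq.resets, dif_pos h],
      by rw [ASeq.afterReset, dif_pos h]; rfl⟩
  · exact Or.inl ⟨fun u a h' => h ⟨(u, a), h'⟩, by rw [ASeq.resets, dif_neg h],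
      by rw [ASeq.afterReset, dif_neg h]⟩

theorem ASeq.strip_afterReset (S : ASeq) : S.afterReset.strip = S.strip := by
  rcases S.reset_cases with ⟨-, -, h⟩ | ⟨u, a, -, -, h⟩
  · rw [h]
  · simp only [ASeq.resetRule, RSchema.prems, List.cons.injEq, and_true] at h
    rw [← h]
    simp [ASeq.strip, erase_cutAt]

theorem ASeq.Tidy.afterReset {S : ASeq} (h : S.Tidy) : S.afterReset.Tidy := by
  rcases S.reset_cases with ⟨-, -, h'⟩ | ⟨u, a, hs, -, h'⟩
  · rwa [h']
  · exact RSchema.tidy_prems (R := S.resetRule u a) h hs (by simp [h'])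

theorem ASeq.afterReset_control (S : ASeq) : S.afterReset.control.Sublist S.control := by
  rcases S.reset_cases with ⟨-, -, h⟩ | ⟨u, a, -, -, h⟩
  · rw [h]
  · simp only [ASeq.resetRule, RSchema.prems, List.cons.injEq, and_true] at h
    rw [← h]
    exact restrict_sublist _ _

/-- The effect of the reset on a single stack, in the form of the step condition of
`exists_stable_letter`. -/
theorem ASeq.anns_afterReset {S : ASeq} {y : ℕ} {w : List ℕ} (hw : (anns S.ctx)[y]? = some w) :
    ∃ w', (anns S.afterReset.ctx)[y]? = some w' ∧ (w' = w ∨ ∃ u a v, v ≠ [] ∧ w = u ++ a :: v ∧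
      w' = u ++ [a] ∧ S.resets = [S.resetRule u a]) := by
  rcases S.reset_cases with ⟨-, -, h⟩ | ⟨u, a, hs, hr, h⟩
  · exact ⟨w, by rwa [h], Or.inl rfl⟩
  · simp only [ASeq.resetRule, RSchema.prems, List.cons.injEq, and_true] at h
    rw [← h]
    by_cases ha : a ∈ w
    · obtain ⟨v, hv, hwv⟩ := hs.2 _ (mem_anns.1 (List.mem_of_getElem? hw)) ha
      exact ⟨u ++ [a], by simp [anns_cutAt, hw, ha], Or.inr ⟨u, a, v, hv, hwv, rfl, hr⟩⟩
    · exact ⟨w, by simp [anns_cutAt, hw, ha], Or.inl rfl⟩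

/-- If no reset is possible, every letter is on top of some annotation. -/
theorem ASeq.Tidy.length_le_of_no_reset {S : ASeq} (h : S.Tidy)
    (hs : ∀ u a, ¬ (S.resetRule u a).Side) : S.control.length ≤ S.ctx.length := by
  -- If `a` were last in no annotation, then by coherence all annotations containing it would have
  -- the form `u a v` with the same `u` and non-empty `v`, so `a` could be reset.
  have hsub : S.control ⊆ S.ctx.filterMap fun p => p.2.getLast? := by
    intro a ha
    obtain ⟨p, hp, hap⟩ := h.occurs a ha
    obtain ⟨u, v, huv⟩ := List.append_of_mem hap
    by_contra hcon
    refine hs u a ⟨⟨p, hp, hap⟩, fun q hq haq => ?_⟩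
    obtain ⟨u', v', huv'⟩ := List.append_of_mem haq
    obtain rfl := h.coherent p hp q hq a u v u' v' huv huv'
    refine ⟨v', ?_, huv'⟩
    rintro rfl
    exact hcon (List.mem_filterMap.2 ⟨q, hq, by simp [huv']⟩)
  exact (List.subperm_of_subset h.isSeq.1 hsub).length_le.trans (List.length_filterMap_le _ _)

/-- If a reset is possible, it deletes a letter. -/
theorem ASeq.Tidy.length_reset_lt {S : ASeq} (h : S.Tidy) {u : List ℕ} {a : ℕ}
    (hs : (S.resetRule u a).Side) :
    (CyclicProofs.restrict S.control (cutAt u a S.ctx)).length < S.control.length := by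
  refine lt_of_le_of_ne (restrict_sublist _ _).length_le fun heq => ?_
  have heq := (restrict_sublist _ _).eq_of_length heq
  obtain ⟨⟨p, hp, hap⟩, hu⟩ := hs
  obtain ⟨v, hv, hpv⟩ := hu p hp hap
  -- The letter `z` directly after `a` is lost: by coherence `a` precedes `z` wherever `z` occurs,
  -- so every annotation with `z` is cut below it.
  obtain ⟨z, v, rfl⟩ := List.exists_cons_of_ne_nil hv
  have hz : z ∈ S.control := (h.isSeq.2 p hp).1.subset (by simp [hpv])
  rw [← heq] at hz
  obtain ⟨-, q, hq, hzq⟩ := mem_restrict.1 hz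
  have hnd := h.isSeq.1.sublist (h.isSeq.2 p hp).1
  rw [hpv] at hnd
  simp only [cutAt, List.mem_map] at hq
  obtain ⟨q, hq, rfl⟩ := hq
  split_ifs at hzq with haq
  · simp only [List.mem_append, List.mem_singleton] at hzq
    rw [List.nodup_append] at hnd
    rcases hzq with hzq | rfl
    · exact hnd.2.2 z hzq z (by simp) rfl
    · simp at hnd
  · obtain ⟨w, w', hw⟩ := List.append_of_mem hzq
    have := h.coherent p hp q hq z (u ++ [a]) v w w' (by simp [hpv]) hw
    exact haq (by simp [hw, ← this])

/-- The letters are among `0, …, K`, where `K` bounds the size of the context. -/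
theorem ASeq.Tidy.afterReset_length {S : ASeq} (h : S.Tidy) {K : ℕ} (hK : S.ctx.length ≤ K)
    (hc : ∀ c ∈ S.control, c ≤ K) : S.afterReset.control.length ≤ K := by
  rcases S.reset_cases with ⟨hs, -, h'⟩ | ⟨u, a, hs, -, h'⟩
  · rw [h']
    exact (h.length_le_of_no_reset hs).trans hK
  · simp only [ASeq.resetRule, RSchema.prems, List.cons.injEq, and_true] at h'
    rw [← h']
    -- At most `K + 1` letters exist and one of them is deleted, which leaves at most `K`.
    have h1 := h.length_reset_lt hs
    have h2 : S.control.length ≤ K + 1 := by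
      have : S.control.toFinset ⊆ Finset.range (K + 1) := fun c hc' =>
        Finset.mem_range.2 (Nat.lt_succ_of_le (hc c (List.mem_toFinset.1 hc')))
      have := Finset.card_le_card this
      rwa [List.toFinset_card_of_nodup h.isSeq.1, Finset.card_range] at this
    exact Nat.le_of_lt_succ (lt_of_lt_of_le h1 h2)

/-! ### Annotating the infinite unfolding -/

open Classical in
/-- An application of reset Gödel's T with conclusion `S` that comes from the rule `r`. -/
noncomputable def ASeq.lift (S : ASeq) (r : CRule) : RSchema :=
  -- The value `.zero []` is irrelevant: at the nodes of the infinite unfolding the sequents always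
  -- match.
  if h : S.strip = r.concl then (exists_lift r S h).choose else .zero []

theorem ASeq.lift_spec {S : ASeq} {r : CRule} (h : S.strip = r.concl) :
    (S.lift r).strip = some r ∧ (S.lift r).concl = S ∧ (S.lift r).Side ∧ (S.lift r).IsFresh := by
  rw [ASeq.lift, dif_pos h]
  exact (exists_lift r S h).choose_spec

/-- The rules of reset Gödel's T that replace the rule `r` with annotated conclusion `S`. -/
noncomputable def ASeq.chunk (S : ASeq) (r : CRule) : List RSchema :=
  S.resets ++ [S.afterReset.lift r]

/-- A configuration of the annotation procedure: a node of the given preproof, an annotation of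
its sequent, and the rules of reset Gödel's T applied below. -/
structure Conf where
  node : List ℕ
  seq : ASeq
  hist : List RSchema

/-- At a bud, proceed to the companion. -/
def resolve (P : SeqTree CGT) (q : List ℕ) : List ℕ :=
  match P.label q with
  | some (.bud _ l) => q.take l
  | _ => q

theorem resolve_of_rule {P : SeqTree CGT} {q : List ℕ} {r : CGT.Rule}
    (h : P.label q = some (.rule r)) : resolve P q = q := by
  simp [resolve, h]

theorem resolve_of_bud {P : SeqTree CGT} {q : List ℕ} {Γ : CGT.Seq} {l : ℕ}
    (h : P.label q = some (.bud Γ l)) : resolve P q = q.take l := by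
  simp [resolve, h]

/-- Proceed to the `i`-th premise. -/
noncomputable def Conf.next (P : SeqTree CGT) (c : Conf) (i : ℕ) : Conf :=
  match P.label (resolve P c.node) with
  | some (.rule r) =>
      -- This default, like the second branch of the `match`, is used only at addresses outside the
      -- infinite unfolding.
      ⟨resolve P c.node ++ [i], ((c.seq.afterReset.lift r).prems[i]?).getD c.seq,
        c.hist ++ c.seq.chunk r⟩
  | _ => ⟨resolve P c.node ++ [i], c.seq, c.hist⟩

/-- The configuration at a node of the infinite unfolding of `P`. -/
noncomputable def run (P : SeqTree CGT) (a : List ℕ) : Conf :=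
  a.foldl (Conf.next P) ⟨[], (CSeq.annotate P.endseq).1, []⟩

/-- The node of `P` that a node of the infinite unfolding is a copy of, with buds replaced by
their companions. -/
noncomputable def loc (P : SeqTree CGT) (a : List ℕ) : List ℕ := resolve P (run P a).node

theorem run_concat (P : SeqTree CGT) (a : List ℕ) (i : ℕ) :
    run P (a ++ [i]) = (run P a).next P i := by
  simp [run]

theorem node_concat (P : SeqTree CGT) (a : List ℕ) (i : ℕ) :
    (run P (a ++ [i])).node = loc P a ++ [i] := by
  rw [run_concat, Conf.next]
  split <;> rfl

theorem run_concat_of_rule {P : SeqTree CGT} {a : List ℕ} {r : CGT.Rule}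
    (h : P.label (loc P a) = some (.rule r)) (i : ℕ) :
    run P (a ++ [i]) = ⟨loc P a ++ [i],
      (((run P a).seq.afterReset.lift r).prems[i]?).getD (run P a).seq,
      (run P a).hist ++ (run P a).seq.chunk r⟩ := by
  rw [loc] at h
  simp [run_concat, Conf.next, h, loc]

/-- Nodes with the same origin have the same origins above them. -/
theorem loc_append {P : SeqTree CGT} {a b : List ℕ} (h : loc P a = loc P b) (u : List ℕ) :
    loc P (a ++ u) = loc P (b ++ u) := by
  induction u using List.reverseRecOn with
  | nil => simpa using h
  | append_singleton u i ih =>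
    rw [loc, loc, ← List.append_assoc, ← List.append_assoc, node_concat, node_concat, ih]

/-- For `u = []` this may fail, since one of the two nodes can be a bud and the other its companion.
-/
theorem node_append {P : SeqTree CGT} {a b : List ℕ} (h : loc P a = loc P b) {u : List ℕ}
    (hu : u ≠ []) : (run P (a ++ u)).node = (run P (b ++ u)).node := by
  obtain ⟨u, i, rfl⟩ := (List.eq_nil_or_concat' u).resolve_left hu
  rw [← List.append_assoc, ← List.append_assoc, node_concat, node_concat, loc_append h]

/-- The nodes of the infinite unfolding of `P`. -/
def IsNode (P : SeqTree CGT) (a : List ℕ) : Prop :=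
  ∀ b i, b ++ [i] <+: a → ∃ r, P.label (loc P b) = some (.rule r) ∧ i < CGT.arity r

theorem IsNode.of_prefix {P : SeqTree CGT} {a b : List ℕ} (h : IsNode P a) (hb : b <+: a) :
    IsNode P b := fun c i hc => h c i (hc.trans hb)

theorem CSeq.strip_annotate (s : CSeq) : (s.annotate).1.strip = s := by
  obtain ⟨Γ, A⟩ := s
  simp [CSeq.annotate, ASeq.strip, erase, Function.comp_def]

theorem CSeq.tidy_annotate (s : CSeq) : (s.annotate).1.Tidy := by
  refine ⟨s.annotate.2, by simp [CSeq.annotate], ?_⟩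
  intro p hp q hq a u v u' v' h
  simp only [CSeq.annotate, List.mem_map] at hp
  obtain ⟨A, -, rfl⟩ := hp
  simp at h

/-- If the annotated sequent is that of the node, then the node is an application of a rule with
this sequent as its conclusion, or a bud whose companion is one. -/
theorem exists_rule_resolve {P : SeqTree CGT} (hP : IsPreproof P) (ho : P.opens = [])
    {q : List ℕ} {Q : SeqTree CGT} (hq : P.sub q = some Q) :
    ∃ r ts, P.sub (resolve P q) = some (.node r ts) ∧ CRule.concl r = SeqTree.endseq Q := by
  cases Q with
  | opn v => simpa [PTree.opens] using PTree.opens_sub ho hq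
  | bud Γ l =>
    have hb := PTree.label_eq_bud.2 hq
    obtain ⟨-, r, hr, rfl⟩ := hP.companion hb
    obtain ⟨ts, hts⟩ := PTree.label_eq_rule.1 hr
    exact ⟨r, ts, by rwa [resolve_of_bud hb], rfl⟩
  | node r ts =>
    exact ⟨r, ts, by rwa [resolve_of_rule (PTree.label_eq_rule.2 ⟨ts, hq⟩)], rfl⟩

/-- The invariant of the procedure. It passes through buds because a bud has the same sequent as its
companion, whose rule can therefore be lifted to the annotation found at the bud. -/
theorem run_spec {P : SeqTree CGT} (hP : IsPreproof P) (ho : P.opens = [])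
    {a : List ℕ} (ha : IsNode P a) :
    (∃ Q, P.sub (run P a).node = some Q ∧ SeqTree.endseq Q = (run P a).seq.strip) ∧
      (run P a).seq.Tidy := by
  induction a using List.reverseRecOn with
  | nil => exact ⟨⟨P, PTree.sub_nil P, (CSeq.strip_annotate _).symm⟩, CSeq.tidy_annotate _⟩
  | append_singleton a i ih =>
    obtain ⟨⟨Q, hQ, hQe⟩, ht⟩ := ih (ha.of_prefix (List.prefix_append _ _))
    obtain ⟨r, ts, hr, hre⟩ := exists_rule_resolve hP ho hQ
    obtain ⟨r', hr', hi⟩ := ha a i List.prefix_rfl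
    have hl := PTree.label_eq_rule.2 ⟨ts, hr⟩
    change P.sub (loc P a) = _ at hr
    change P.label (loc P a) = _ at hl
    obtain rfl : r' = r := by simpa [hl] using hr'.symm
    have hs : (run P a).seq.afterReset.strip = CRule.concl r' := by
      rw [ASeq.strip_afterReset, hre, hQe]
    obtain ⟨h1, h2, h3, h4⟩ := ASeq.lift_spec hs
    have hpr := RSchema.strip_prems h1
    have hi' : i < ((run P a).seq.afterReset.lift r').prems.length := by
      rw [← List.length_map (f := ASeq.strip), hpr]; exact hi
    rw [run_concat_of_rule hl, List.getElem?_eq_getElem hi', Option.getD_some]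
    refine ⟨⟨ts ⟨i, hi⟩, PTree.sub_append_singleton.2 ⟨r', ts, hr, hi, rfl⟩, ?_⟩,
      RSchema.tidy_prems (by rw [h2]; exact ht.afterReset) h3 (List.getElem_mem _)⟩
    rw [hP.premise hr]
    have : (CRule.prems r')[i]'hi = _ := (List.getElem_of_eq hpr.symm hi).trans (List.getElem_map _)
    exact this

theorem exists_rule_loc {P : SeqTree CGT} (hP : IsPreproof P) (ho : P.opens = [])
    {a : List ℕ} (ha : IsNode P a) :
    ∃ r, P.label (loc P a) = some (.rule r) := by
  obtain ⟨⟨Q, hQ, -⟩, -⟩ := run_spec hP ho ha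
  obtain ⟨r, ts, hr, -⟩ := exists_rule_resolve hP ho hQ
  exact ⟨r, PTree.label_eq_rule.2 ⟨ts, hr⟩⟩

theorem strip_eq_concl {P : SeqTree CGT} (hP : IsPreproof P) (ho : P.opens = [])
    {a : List ℕ} (ha : IsNode P a) {r : CGT.Rule}
    (hr : P.label (loc P a) = some (.rule r)) : (run P a).seq.strip = CRule.concl r := by
  obtain ⟨⟨Q, hQ, hQe⟩, -⟩ := run_spec hP ho ha
  obtain ⟨r', ts, hr', hre⟩ := exists_rule_resolve hP ho hQ
  have := PTree.label_eq_rule.2 ⟨ts, hr'⟩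
  change P.label (loc P a) = _ at this
  obtain rfl : r' = r := by simpa [this] using hr
  rw [hre, hQe]

theorem afterReset_strip {P : SeqTree CGT} (hP : IsPreproof P) (ho : P.opens = [])
    {a : List ℕ} (ha : IsNode P a) {r : CGT.Rule}
    (hr : P.label (loc P a) = some (.rule r)) :
    (run P a).seq.afterReset.strip = CRule.concl r := by
  rw [ASeq.strip_afterReset, strip_eq_concl hP ho ha hr]

/-- The annotated sequent of a premise. -/
theorem run_premise {P : SeqTree CGT} (hP : IsPreproof P) (ho : P.opens = [])
    {a : List ℕ} {i : ℕ} (ha : IsNode P (a ++ [i])) {r : CGT.Rule}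
    (hr : P.label (loc P a) = some (.rule r)) :
    ((run P a).seq.afterReset.lift r).prems[i]? = some (run P (a ++ [i])).seq := by
  obtain ⟨r', hr', hi⟩ := ha a i List.prefix_rfl
  obtain rfl : r' = r := by simpa [hr] using hr'.symm
  have hpr := RSchema.strip_prems (ASeq.lift_spec (afterReset_strip hP ho
    (ha.of_prefix (List.prefix_append _ _)) hr)).1
  have hi' : i < ((run P a).seq.afterReset.lift r').prems.length := by
    rw [← List.length_map (f := ASeq.strip), hpr]; exact hi
  rw [run_concat_of_rule hr, List.getElem?_eq_getElem hi', Option.getD_some]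

/-! ### Unfoldings that follow the annotation procedure -/

/-- The bud position `t` can be closed with companion `t.take m`. -/
def GoodAt (P : SeqTree CGT) (t : List ℕ) (m : ℕ) : Prop :=
  m < t.length ∧ loc P (t.take m) = loc P t ∧ (run P (t.take m)).seq = (run P t).seq ∧
    ∃ (p : List ℕ) (a : ℕ), p ++ [a] <+: (run P t).seq.control ∧
      (∀ R ∈ (run P t).hist.drop (run P (t.take m)).hist.length, p ++ [a] <+: R.concl.control) ∧
      ∃ R ∈ (run P t).hist.drop (run P (t.take m)).hist.length, R.IsResetOf a

/-- The copies of buds that cannot be closed. -/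
def Bad (P : SeqTree CGT) (t : List ℕ) : Prop :=
  IsNode P t ∧ (∃ Γ l, P.label (run P t).node = some (.bud Γ l)) ∧ ¬ ∃ m, GoodAt P t m

/-- The order by extension on bad positions. -/
def BadExt (P : SeqTree CGT) (t' t : List ℕ) : Prop :=
  Bad P t' ∧ Bad P t ∧ t <+: t' ∧ t ≠ t'

/-- `Q`, with the assignment `o` of initial nodes, is a finite part of the infinite unfolding
of `P` in which buds are closed properly where possible. -/
structure IsPart (P Q : SeqTree CGT) (o : List ℕ → List ℕ) : Prop where
  opn : ∀ a v, Q.label a ≠ some (.opn v)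
  rule : ∀ a r, Q.label a = some (.rule r) → P.label (loc P a) = some (.rule r) ∧ o a = loc P a
  bud : ∀ a Γ m, Q.label a = some (.bud Γ m) → o a = (run P a).node ∧ m < a.length ∧
    (∃ l, P.label (o a) = some (.bud Γ l) ∧ o (a.take m) = (o a).take l) ∧
    ((∃ m', GoodAt P a m') → GoodAt P a m)

theorem IsPart.isNode {P Q : SeqTree CGT} {o : List ℕ → List ℕ} (h : IsPart P Q o) {a : List ℕ}
    (ha : Q.label a ≠ none) : IsNode P a := by
  intro b i hb
  obtain ⟨r, hr, hi⟩ := PTree.exists_rule_of_label ha hb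
  exact ⟨r, (h.rule b r hr).1, hi⟩

/-- Each node of `P` is its own origin. So the only proper ancestor of a bud with the right origin
is its companion, and if the bud can be closed at all, it is closed properly already. -/
theorem isPart_self {P : SeqTree CGT} (hP : IsPreproof P) (ho : P.opens = []) :
    IsPart P P id := by
  have hnode : ∀ a, P.label a ≠ none → (run P a).node = a := by
    intro a ha
    induction a using List.reverseRecOn with
    | nil => rfl
    | append_singleton a i ih =>
      obtain ⟨r, hr, -⟩ := PTree.exists_rule_of_label ha List.prefix_rfl
      rw [node_concat, loc, ih (by simp [hr]), resolve_of_rule hr]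
  have hloc : ∀ a r, P.label a = some (.rule r) → loc P a = a := fun a r hr => by
    rw [loc, hnode a (by simp [hr]), resolve_of_rule hr]
  refine ⟨fun a v h => ?_, fun a r hr => ?_, fun a Γ m hb => ?_⟩
  · simpa [PTree.opens] using PTree.opens_sub ho (PTree.label_eq_opn.1 h)
  · rw [hloc a r hr]
    exact ⟨hr, rfl⟩
  · have ha : P.label a ≠ none := by simp [hb]
    obtain ⟨hm, -⟩ := hP.companion hb
    refine ⟨(hnode a ha).symm, hm, ⟨m, hb, rfl⟩, ?_⟩
    rintro ⟨m', hm'⟩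
    have h1 := hm'.2.1
    obtain ⟨r, hr, -⟩ := PTree.exists_rule_take ha hm'.1
    rw [hloc _ r hr, loc, hnode a ha, resolve_of_bud hb] at h1
    have h2 := congrArg List.length h1
    rw [List.length_take_of_le hm'.1.le, List.length_take_of_le hm.le] at h2
    rwa [← h2]

open Classical in
/-- The companion of the copy `b` of a bud, when the part above a node of depth `c` is copied to
a node of depth `t`: the copy is closed properly if possible. -/
noncomputable def newCompanion (P : SeqTree CGT) (c t : ℕ) (b : List ℕ) (m : ℕ) : ℕ :=
  -- By default, companions below the copied part are kept, and those inside it move along with the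
  -- copy.
  if h : ∃ m', GoodAt P b m' then h.choose else if m < c then m else m - c + t

/-- A bud and its companion have the same `loc`, and `loc` determines all origins above, so the
copied part fits into the same infinite unfolding. The annotations in the copy are new, however;
each copied bud is therefore tested afresh for a good companion, which the free choice of companions
in `UnfoldStep` permits. -/
theorem IsPart.unfold {P Q : SeqTree CGT} {o : List ℕ → List ℕ} (h : IsPart P Q o)
    {t : List ℕ} {Γ : CGT.Seq} {m : ℕ} (ht : Q.label t = some (.bud Γ m)) :
    ∃ Q' o', UnfoldStep Q o Q' o' ∧ IsPart P Q' o' ∧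
      (∀ a, ¬ t <+: a → Q'.label a = Q.label a) ∧ ∃ r, Q'.label t = some (.rule r) := by
  classical
  obtain ⟨ht1, hm, ⟨l, hl, hol⟩, -⟩ := h.bud t Γ m ht
  obtain ⟨r₀, hr₀, -⟩ := PTree.exists_rule_take (P := Q) (a := t) (by simp [ht]) hm
  obtain ⟨ts, hts⟩ := PTree.label_eq_rule.1 hr₀
  set c := t.take m with hc
  have hclen : c.length = m := by rw [hc, List.length_take_of_le hm.le]
  set C : SeqTree CGT := .node r₀ ts
  set Q' : SeqTree CGT :=
    PTree.replaceAt (C.relabel (newCompanion P c.length t.length) t) Q t with hQ'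
  set o' : List ℕ → List ℕ := fun a => if t <+: a then o (c ++ a.drop t.length) else o a with ho'
  have hsubt : Q.sub t = some (.bud Γ m) := PTree.label_eq_bud.1 ht
  have hlab1 : ∀ a, ¬ t <+: a → Q'.label a = Q.label a := fun a ha =>
    PTree.label_replaceAt_of_not_prefix ha
  have hlab2 : ∀ u, Q'.label (t ++ u) = (Q.label (c ++ u)).map
      (Label.mapBud (newCompanion P c.length t.length (t ++ u))) := fun u => by
    rw [hQ', PTree.label_replaceAt_append hsubt, PTree.label_relabel,
      ← PTree.label_append hts u]
  have ho1 : ∀ a, ¬ t <+: a → o' a = o a := fun a ha => if_neg ha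
  have ho2 : ∀ u, o' (t ++ u) = o (c ++ u) := fun u => by
    simp [ho', List.prefix_append]
  have hrule0 := h.rule c r₀ hr₀
  have hloc : loc P t = loc P c := by
    rw [← hrule0.2, hol, loc, ← ht1, resolve_of_bud hl]
  have hrule : ∀ a r, Q'.label a = some (.rule r) →
      P.label (loc P a) = some (.rule r) ∧ o' a = loc P a := by
    intro a r hr
    by_cases ha : t <+: a
    · obtain ⟨u, rfl⟩ := ha
      rw [hlab2] at hr
      have hr' : Q.label (c ++ u) = some (.rule r) := by
        revert hr
        cases Q.label (c ++ u) with
        | none => simp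
        | some x => cases x <;> simp [Label.mapBud]
      rw [ho2, loc_append hloc]
      exact h.rule _ _ hr'
    · rw [hlab1 a ha] at hr
      rw [ho1 a ha]
      exact h.rule _ _ hr
  have hbud' : ∀ u Δ k, Q.label (c ++ u) = some (.bud Δ k) →
      newCompanion P c.length t.length (t ++ u) k < (t ++ u).length ∧
      o' ((t ++ u).take (newCompanion P c.length t.length (t ++ u) k)) =
        o ((c ++ u).take k) ∧
      o (c ++ u) = (run P (t ++ u)).node := by
    intro u Δ k hk
    obtain ⟨h1, h2, ⟨l', h3, h4⟩, -⟩ := h.bud _ _ _ hk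
    -- The node `c` carries a rule, so the bud lies properly above it and `node_append` applies.
    have hu : u ≠ [] := by
      rintro rfl
      simp [hr₀] at hk
    have hnode : o (c ++ u) = (run P (t ++ u)).node := by rw [h1, node_append hloc hu]
    have hne : Q'.label (t ++ u) ≠ none := by simp [hlab2, hk]
    by_cases hg : ∃ m', GoodAt P (t ++ u) m'
    · have hn : newCompanion P c.length t.length (t ++ u) k = hg.choose := dif_pos hg
      have hs := hg.choose_spec
      rw [← hn] at hs
      refine ⟨hs.1, ?_, hnode⟩
      -- A proper ancestor carries a rule, so its origin is its `loc`, which `GoodAt` equates with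
      -- that of the bud.
      obtain ⟨r, hr, -⟩ := PTree.exists_rule_take hne hs.1
      rw [(hrule _ _ hr).2, hs.2.1, h4, loc, ← hnode, resolve_of_bud h3]
    · have hn : newCompanion P c.length t.length (t ++ u) k =
        if k < c.length then k else k - c.length + t.length := dif_neg hg
      rw [hn]
      rw [List.length_append] at h2
      split_ifs with hk'
      · refine ⟨by rw [List.length_append]; omega, ?_, hnode⟩
        rw [List.take_append_of_le_length (by omega), List.take_append_of_le_length hk'.le]
        rw [ho1 _ fun hp => ?_, hc, List.take_take, min_eq_left (by omega)]
        have := hp.length_le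
        rw [List.length_take] at this
        omega
      · refine ⟨by rw [List.length_append]; omega, ?_, hnode⟩
        have e1 : (t ++ u).take (k - c.length + t.length) = t ++ u.take (k - c.length) := by
          rw [add_comm, List.take_length_add_append]
        have e2 : (c ++ u).take k = c ++ u.take (k - c.length) := by
          conv_lhs => rw [show k = c.length + (k - c.length) by omega]
          rw [List.take_length_add_append]
        rw [e1, e2, ho2]
  refine ⟨Q', o', ⟨t, Γ, m, ht, fun a ha => ⟨hlab1 a ha, ho1 a ha⟩, ho2, ?_, ?_⟩, ⟨?_, hrule, ?_⟩,
    hlab1, r₀, ?_⟩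
  · intro u hu
    rw [hlab2]
    change _ = Q.label (c ++ u)
    change ∀ Δ m, Q.label (c ++ u) ≠ _ at hu
    revert hu
    cases Q.label (c ++ u) with
    | none => simp
    | some x => cases x <;> simp [Label.mapBud]
  · intro u Δ k hk
    change Q.label (c ++ u) = _ at hk
    obtain ⟨h1, h2, -⟩ := hbud' u Δ k hk
    exact ⟨_, h1, by rw [hlab2, hk]; rfl, h2⟩
  · intro a v hv
    by_cases ha : t <+: a
    · obtain ⟨u, rfl⟩ := ha
      rw [hlab2] at hv
      have := h.opn (c ++ u)
      revert hv this
      cases Q.label (c ++ u) with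
      | none => simp
      | some x => cases x <;> simp [Label.mapBud]
    · rw [hlab1 a ha] at hv
      exact h.opn _ _ hv
  · intro a Δ k hk
    by_cases ha : t <+: a
    · obtain ⟨u, rfl⟩ := ha
      rw [hlab2] at hk
      obtain ⟨k', hk', rfl⟩ : ∃ k', Q.label (c ++ u) = some (.bud Δ k') ∧
          newCompanion P c.length t.length (t ++ u) k' = k := by
        revert hk
        cases Q.label (c ++ u) with
        | none => simp
        | some x => cases x <;> simp [Label.mapBud]
      obtain ⟨h1, h2, h3⟩ := hbud' u Δ k' hk'
      obtain ⟨-, -, ⟨l', h4, h5⟩, -⟩ := h.bud _ _ _ hk'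
      rw [ho2]
      refine ⟨h3, h1, ⟨l', h4, h2.trans h5⟩, fun hg => ?_⟩
      have hn : newCompanion P c.length t.length (t ++ u) k' = hg.choose := dif_pos hg
      rw [hn]
      exact hg.choose_spec
    · rw [hlab1 a ha] at hk
      rw [ho1 a ha]
      obtain ⟨h1, h2, ⟨l', h3, h4⟩, h5⟩ := h.bud _ _ _ hk
      refine ⟨h1, h2, ⟨l', h3, ?_⟩, h5⟩
      rw [ho1 _ fun hp => ha (hp.trans (List.take_prefix _ _)), h4]
  · have := hlab2 []
    rw [List.append_nil, List.append_nil, hr₀] at this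
    exact this

/-- The copies of buds in `Q` that are not closed properly. -/
noncomputable def badBuds (P Q : SeqTree CGT) : Finset (List ℕ) :=
  (Q.finite_label.subset (t := {a | (∃ Γ m, Q.label a = some (.bud Γ m)) ∧ Bad P a})
    (by rintro a ⟨⟨Γ, m, h⟩, -⟩; simp [h])).toFinset

theorem mem_badBuds {P Q : SeqTree CGT} {a : List ℕ} :
    a ∈ badBuds P Q ↔ (∃ Γ m, Q.label a = some (.bud Γ m)) ∧ Bad P a := by
  simp [badBuds]

/-- Unfolding at `t` exchanges one bad bud for finitely many that properly extend it, `t` itself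
having become an inner node. This is a single step down in the multiset extension of `BadExt`. -/
theorem cutExpand_badBuds {P Q Q' : SeqTree CGT} {t : List ℕ} (ht : t ∈ badBuds P Q)
    (h1 : ∀ a, ¬ t <+: a → Q'.label a = Q.label a) (h2 : ∃ r, Q'.label t = some (.rule r)) :
    Relation.CutExpand (BadExt P) (badBuds P Q').val (badBuds P Q).val := by
  classical
  obtain ⟨⟨Γ, m, hb⟩, hbad⟩ := mem_badBuds.1 ht
  refine ⟨((badBuds P Q').filter fun a => t <+: a).val, t, ?_, ?_⟩
  · intro a ha
    rw [Finset.mem_val, Finset.mem_filter, mem_badBuds] at ha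
    refine ⟨ha.1.2, hbad, ha.2, ?_⟩
    rintro rfl
    obtain ⟨⟨⟨_, _, h3⟩, -⟩, -⟩ := ha
    obtain ⟨_, h2⟩ := h2
    rw [h2] at h3
    simp at h3
  -- Outside `t` nothing changes, and as `t` is a leaf of `Q`, no other bud of `Q` extends it.
  · have e1 : (badBuds P Q').filter (fun a => ¬ t <+: a) = (badBuds P Q).erase t := by
      ext a
      rw [Finset.mem_filter, Finset.mem_erase, mem_badBuds, mem_badBuds]
      constructor
      · rintro ⟨h, ha⟩
        rw [h1 a ha] at h
        exact ⟨fun e => ha (e ▸ List.prefix_rfl), h⟩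
      · rintro ⟨hne, h⟩
        have ha : ¬ t <+: a := by
          rintro ⟨u, rfl⟩
          obtain ⟨⟨Δ, k, h⟩, -⟩ := h
          cases u with
          | nil => simp at hne
          | cons i u =>
            rw [PTree.label_append (PTree.label_eq_bud.1 hb)] at h
            simp [PTree.label, PTree.sub] at h
        rw [h1 a ha]
        exact ⟨h, ha⟩
    have e2 := Multiset.filter_add_not (fun a => t <+: a) (badBuds P Q').val
    rw [← Finset.filter_val, ← Finset.filter_val, e1, Finset.erase_val] at e2
    rw [← e2, add_assoc, add_comm (Multiset.erase _ _) {t}, Multiset.singleton_add,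
      Multiset.cons_erase (show t ∈ (badBuds P Q).val from ht), add_comm]

/-- Unfolding bad buds as long as possible leads to a tree all of whose buds are closed
properly. -/
theorem IsPart.exists_unfolding {P : SeqTree CGT} (hwf : WellFounded (BadExt P)) {Q : SeqTree CGT}
    {o : List ℕ → List ℕ} (hQ : UnfoldsTo P Q o) (h : IsPart P Q o) :
    ∃ Q' o', UnfoldsTo P Q' o' ∧ IsPart P Q' o' ∧
      ∀ a Γ m, Q'.label a = some (.bud Γ m) → GoodAt P a m := by
  generalize hM : (badBuds P Q).val = M
  induction M using hwf.cutExpand.induction generalizing Q o with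
  | _ M ih =>
    by_cases he : ∃ t, t ∈ badBuds P Q
    · obtain ⟨t, ht⟩ := he
      obtain ⟨⟨Γ, m, hb⟩, -⟩ := mem_badBuds.1 ht
      obtain ⟨Q', o', h1, h2, h3, h4⟩ := h.unfold hb
      exact ih _ (hM ▸ cutExpand_badBuds ht h3 h4) (hQ.step h1) h2 rfl
    · refine ⟨Q, o, hQ, h, fun a Γ m ha => ?_⟩
      obtain ⟨h1, h2, ⟨l, h3, h4⟩, h5⟩ := h.bud a Γ m ha
      by_contra hcon
      exact he ⟨a, mem_badBuds.2 ⟨⟨Γ, m, ha⟩, h.isNode (by simp [ha]), ⟨Γ, l, h1 ▸ h3⟩,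
        fun hg => hcon (h5 hg)⟩⟩

/-! ### Traces and stacks along infinite branches -/

/-- A composite unravels into its single steps. A join of Booleans is `true` only if one of them is,
so a composite value `1` stems from some step. -/
theorem exists_path_of_compSteps {τ : ℕ → TraceRel Bool} {i n x z : ℕ} {c : Bool}
    (h : compSteps τ i n x c z) :
    ∃ (y : ℕ → ℕ) (b : ℕ → Bool), y i = x ∧ y (i + n + 1) = z ∧
      (∀ k, i ≤ k → k ≤ i + n → τ k (y k) (b k) (y (k + 1))) ∧
      (c = true → ∃ k, i ≤ k ∧ k ≤ i + n ∧ b k = true) := by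
  induction n generalizing c z with
  | zero =>
    refine ⟨fun k => if k = i then x else z, fun _ => c, by simp, by simp, ?_,
      fun hc => ⟨i, le_rfl, le_rfl, hc⟩⟩
    intro k h1 h2
    obtain rfl : k = i := by omega
    simpa [compSteps] using h
  | succ n ih =>
    obtain ⟨y', b₁, b₂, h1, h2, rfl⟩ := h
    obtain ⟨y, b, hy1, hy2, hy3, hy4⟩ := ih h1
    refine ⟨fun k => if k ≤ i + n + 1 then y k else z,
      fun k => if k ≤ i + n then b k else b₂, ?_, ?_, ?_, ?_⟩
    · simpa [show i ≤ i + n + 1 by omega] using hy1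
    · simp
    · intro k hk1 hk2
      by_cases hk : k ≤ i + n
      · simpa [hk, show k ≤ i + n + 1 by omega] using hy3 k hk1 hk
      · obtain rfl : k = i + n + 1 := by omega
        simpa [hy2] using h2
    · intro hc
      cases hb : b₁ with
      | true =>
        obtain ⟨k, hk1, hk2, hk3⟩ := hy4 hb
        exact ⟨k, hk1, by omega, by simpa [hk2] using hk3⟩
      | false => exact ⟨i + n + 1, by omega, by omega, by simpa [hb] using hc⟩

/-- The trace condition yields a trace from some point on, with value `1` infinitely often. -/
theorem TraceCondition.exists_trace {τ : ℕ → TraceRel Bool} (h : TraceCondition true τ) :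
    ∃ (k₀ : ℕ) (Y : ℕ → ℕ) (B : ℕ → Bool), (∀ k, k₀ ≤ k → τ k (Y k) (B k) (Y (k + 1))) ∧
      ∀ M, ∃ k, M ≤ k ∧ k₀ ≤ k ∧ B k = true := by
  obtain ⟨S, x, hS, hx⟩ := h
  choose y b h1 h2 h3 h4 using fun i => exists_path_of_compSteps (hx i)
  have hlt : ∀ i, S i < S (i + 1) := fun i => hS (Nat.lt_succ_self i)
  have hsucc : ∀ i, S i + (S (i + 1) - S i - 1) + 1 = S (i + 1) := fun i => by
    have := hlt i; omega
  -- For `S 0 ≤ k`, `idx k` is the index `j` of the segment `[S j, S (j + 1))` containing `k`;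
  -- searching up to `k` is enough because `j ≤ S j`.
  set idx : ℕ → ℕ := fun k => Nat.findGreatest (fun j => S j ≤ k) k with hidx
  have hidx1 : ∀ k, S 0 ≤ k → S (idx k) ≤ k := fun k hk =>
    Nat.findGreatest_spec (P := fun j => S j ≤ k) (Nat.zero_le k) hk
  have hidx2 : ∀ j k, S j ≤ k → j ≤ idx k := fun j k hk =>
    Nat.le_findGreatest ((hS.id_le j).trans hk) hk
  have hidx3 : ∀ j k, S j ≤ k → k < S (j + 1) → idx k = j := by
    intro j k hj hk
    refine le_antisymm ?_ (hidx2 j k hj)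
    have := hidx1 k ((hS.monotone (Nat.zero_le j)).trans hj)
    exact Nat.le_of_lt_succ (hS.lt_iff_lt.1 (lt_of_le_of_lt this hk))
  have hidx4 : ∀ k, k < S (idx k + 1) := by
    intro k
    by_contra hk
    exact absurd (hidx2 _ k (not_lt.1 hk)) (by omega)
  refine ⟨S 0, fun k => y (idx k) k, fun k => b (idx k) k, fun k hk => ?_, fun M => ?_⟩
  · have e := h3 (idx k) k (hidx1 k hk) (by have := hidx4 k; have := hsucc (idx k); omega)
    have : y (idx (k + 1)) (k + 1) = y (idx k) (k + 1) := by
      rcases Nat.lt_or_ge (k + 1) (S (idx k + 1)) with hk' | hk'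
      · rw [hidx3 (idx k) (k + 1) ((hidx1 k hk).trans (Nat.le_succ k)) hk']
      -- At a boundary the end of one segment's path is the start of the next one's, both being `x
      -- (idx k + 1)`.
      · have hk'' : k + 1 = S (idx k + 1) := le_antisymm (hidx4 k) hk'
        rw [hidx3 (idx k + 1) (k + 1) hk''.ge (hk'' ▸ hlt _)]
        have e2 := h2 (idx k)
        rw [hsucc, ← hk''] at e2
        rw [e2, hk'', h1]
    simpa only [this] using e
  · obtain ⟨k, hk1, hk2, hk3⟩ := h4 M rfl
    have hk4 : k < S (M + 1) := by have := hsucc M; omega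
    refine ⟨k, (hS.id_le M).trans hk1, (hS.monotone (Nat.zero_le M)).trans hk1, ?_⟩
    simpa only [hidx3 M k hk1 hk4] using hk3

/-! ### The stable letter of a stack -/

/-- If a stack of bounded height is extended infinitely often, then some letter stays on it from
some point on and is uncovered by infinitely many truncations. -/
theorem exists_stable_letter {w : ℕ → List ℕ} {b : ℕ → Bool} {f : ℕ → ℕ} {R : ℕ → ℕ → Prop}
    {L : ℕ} (hL : ∀ n, (w n).length ≤ L)
    (hstep : ∀ n, w (n + 1) = w n ++ (if b n then [f n] else []) ∨
      ∃ u c t, t ≠ [] ∧ w n ++ (if b n then [f n] else []) = u ++ c :: t ∧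
        w (n + 1) = u ++ [c] ∧ R (n + 1) c)
    (hb : ∀ M, ∃ n, M ≤ n ∧ b n = true) :
    ∃ N c, (∀ n, N ≤ n → c ∈ w n) ∧ ∀ M, ∃ n, M ≤ n ∧ R n c := by
  classical
  have hex : ∃ h, ∀ M, ∃ n, M ≤ n ∧ (w n).length ≤ h := ⟨L, fun M => ⟨M, le_rfl, hL M⟩⟩
  -- `h` is the limit inferior of the heights: heights of at most `h` recur for ever, while from
  -- some `N` on no height is less than `h`.
  set h := Nat.find hex with hh
  have h1 : ∀ M, ∃ n, M ≤ n ∧ (w n).length ≤ h := Nat.find_spec hex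
  obtain ⟨N, hN⟩ : ∃ N, ∀ n, N ≤ n → h ≤ (w n).length := by
    by_cases h0 : h = 0
    · exact ⟨0, fun n _ => by omega⟩
    · have := Nat.find_min hex (m := h - 1) (by omega)
      push Not at this
      obtain ⟨N, hN⟩ := this
      exact ⟨N, fun n hn => by have := hN n hn; omega⟩
  -- No truncation after `N` reaches below height `h`, so the lowest `h` letters are frozen.
  set q := (w N).take h with hq
  have hconst : ∀ n, N ≤ n → (w n).take h = q := by
    intro n hn
    induction n, hn using Nat.le_induction with
    | base => rfl
    | succ n hn ih =>
      have e1 : (w n ++ (if b n then [f n] else [])).take h = q := by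
        rw [List.take_append_of_le_length (hN n hn), ih]
      have hle := hN (n + 1) (hn.trans (Nat.le_succ n))
      rcases hstep n with e | ⟨u, c, t, -, e, e', -⟩
      · rw [e, e1]
      · rw [e, List.append_cons, ← e', List.take_append_of_le_length hle] at e1
        exact e1
  -- From above `h` the stack can come down to `h` only by a truncation, and the letter uncovered by
  -- it is then the last one of `q`.
  have hstep' : ∀ n, N ≤ n → h + 1 ≤ (w n ++ (if b n then [f n] else [])).length →
      h + 1 ≤ (w (n + 1)).length ∨ ∃ u c, u ++ [c] = q ∧ R (n + 1) c := by
    intro n hn hlen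
    have hle := hN (n + 1) (hn.trans (Nat.le_succ n))
    rcases hstep n with e | ⟨u, c, t, -, e, e', hR⟩
    · exact Or.inl (e ▸ hlen)
    · rcases hle.lt_or_eq with hlt | heq
      · exact Or.inl hlt
      · refine Or.inr ⟨u, c, ?_, hR⟩
        rw [← e', ← hconst (n + 1) (hn.trans (Nat.le_succ n)), heq, List.take_length]
  -- Otherwise the next push after `M` would take the height above `h` once and for all. In passing
  -- this shows that `q` is not empty.
  have key : ∀ M, N ≤ M → ∃ n, M ≤ n ∧ ∃ u c, u ++ [c] = q ∧ R n c := by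
    intro M hM
    by_contra hcon
    push Not at hcon
    have hstep'' : ∀ n, M ≤ n → h + 1 ≤ (w n ++ (if b n then [f n] else [])).length →
        h + 1 ≤ (w (n + 1)).length := by
      intro n hn hlen
      refine (hstep' n (hM.trans hn) hlen).resolve_right ?_
      rintro ⟨u, c, hu, hR⟩
      exact hcon (n + 1) (hn.trans (Nat.le_succ n)) u c hu hR
    obtain ⟨n₂, hn₂, hbn⟩ := hb M
    have hall : ∀ n, n₂ + 1 ≤ n → h + 1 ≤ (w n).length := by
      intro n hn
      induction n, hn using Nat.le_induction with
      | base =>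
        refine hstep'' n₂ hn₂ ?_
        have := hN n₂ (hM.trans hn₂)
        simpa [hbn] using this
      | succ n hn ih =>
        refine hstep'' n (by omega) ?_
        rw [List.length_append]
        omega
    obtain ⟨n, hn, hle⟩ := h1 (n₂ + 1)
    exact absurd (hall n hn) (by omega)
  obtain ⟨-, -, u, c, hc, -⟩ := key N le_rfl
  refine ⟨N, c, fun n hn => ?_, fun M => ?_⟩
  · have : c ∈ (w n).take h := by rw [hconst n hn, ← hc]; simp
    exact List.mem_of_mem_take this
  · obtain ⟨n, hn, u', c', hc', hR⟩ := key (max M N) (le_max_right _ _)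
    rw [← hc] at hc'
    obtain ⟨-, h'⟩ := List.append_inj' hc' rfl
    obtain rfl : c' = c := by simpa using h'
    exact ⟨n, (le_max_left _ _).trans hn, hR⟩

/-! ### Controls before a letter, finite sets of lists, infinite branches -/

/-- The part of a control preceding the letter `a`. -/
def before (a : ℕ) (Θ : List ℕ) : List ℕ := Θ.takeWhile (· ≠ a)

theorem before_prefix {a : ℕ} {Θ : List ℕ} (h : a ∈ Θ) : before a Θ ++ [a] <+: Θ := by
  induction Θ with
  | nil => simp at h
  | cons z Θ ih =>
    unfold before at ih ⊢
    by_cases hz : z = a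
    · subst hz
      simp
    · have : a ∈ Θ := by
        rcases List.mem_cons.1 h with rfl | h
        · exact absurd rfl hz
        · exact h
      rw [List.takeWhile_cons_of_pos (by simpa using hz), List.cons_append,
        List.cons_prefix_cons]
      exact ⟨rfl, ih this⟩

/-- Without repetitions the surviving `a` is the only one, so deletions can do no more than thin out
what precedes it. -/
theorem before_sublist {a : ℕ} {Θ Θ' : List ℕ} (h : Θ'.Sublist Θ) (hΘ : Θ.Nodup)
    (ha : a ∈ Θ') : (before a Θ').Sublist (before a Θ) := by
  unfold before
  induction h with
  | slnil => exact List.Sublist.refl _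
  | @cons l₁ l₂ z h ih =>
    rw [List.nodup_cons] at hΘ
    have hz : z ≠ a := by rintro rfl; exact hΘ.1 (h.subset ha)
    rw [List.takeWhile_cons_of_pos (by simpa using hz)]
    exact (ih hΘ.2 ha).cons _
  | @cons_cons l₁ l₂ z h ih =>
    rw [List.nodup_cons] at hΘ
    by_cases hz : z = a
    · subst hz
      simp
    · rw [List.takeWhile_cons_of_pos (by simpa using hz),
        List.takeWhile_cons_of_pos (by simpa using hz)]
      refine (ih hΘ.2 ?_).cons_cons _
      rcases List.mem_cons.1 ha with rfl | ha
      · exact absurd rfl hz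
      · exact ha

theorem before_append {a f : ℕ} {Θ : List ℕ} (ha : a ∈ Θ) :
    before a (Θ ++ [f]) = before a Θ := by
  unfold before
  induction Θ with
  | nil => simp at ha
  | cons z Θ ih =>
    by_cases hz : z = a
    · subst hz
      simp
    · rw [List.cons_append, List.takeWhile_cons_of_pos (by simpa using hz),
        List.takeWhile_cons_of_pos (by simpa using hz), ih]
      rcases List.mem_cons.1 ha with rfl | ha
      · exact absurd rfl hz
      · exact ha

theorem finite_lists {α : Type} {s : Set α} (hs : s.Finite) (n : ℕ) :
    {l : List α | l.length ≤ n ∧ ∀ x ∈ l, x ∈ s}.Finite := by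
  have := hs.to_subtype
  refine ((List.finite_length_le s n).image (List.map Subtype.val)).subset ?_
  rintro l ⟨h1, h2⟩
  refine ⟨l.attach.map fun x => ⟨x.1, h2 x.1 x.2⟩, by simpa using h1, ?_⟩
  simp [Function.comp_def]

/-- The first `n` elements of a sequence. -/
def initial (d : ℕ → ℕ) (n : ℕ) : List ℕ := (List.range n).map d

theorem initial_succ (d : ℕ → ℕ) (n : ℕ) : initial d (n + 1) = initial d n ++ [d n] := by
  simp [initial, List.range_succ]

@[simp] theorem length_initial (d : ℕ → ℕ) (n : ℕ) : (initial d n).length = n := by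
  simp [initial]

theorem initial_prefix (d : ℕ → ℕ) {m n : ℕ} (h : m ≤ n) : initial d m <+: initial d n := by
  induction n, h using Nat.le_induction with
  | base => exact List.prefix_rfl
  | succ n h ih => exact ih.trans (by rw [initial_succ]; exact List.prefix_append _ _)

/-- A strictly increasing sequence of nodes determines an infinite branch. -/
theorem exists_branch {f : ℕ → List ℕ} (h : ∀ n, f n <+: f (n + 1) ∧ f n ≠ f (n + 1)) :
    (∀ n, n ≤ (f n).length) ∧ (∀ m n, m ≤ n → f m <+: f n) ∧
      ∃ d, ∀ n, f n = initial d (f n).length := by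
  have hlen : ∀ n, n ≤ (f n).length := by
    intro n
    induction n with
    | zero => exact Nat.zero_le _
    | succ n ih =>
      refine Nat.succ_le_of_lt (lt_of_le_of_lt ih (lt_of_le_of_ne (h n).1.length_le fun he => ?_))
      exact (h n).2 ((h n).1.eq_of_length he)
  have hmono : ∀ m n, m ≤ n → f m <+: f n := by
    intro m n hmn
    induction n, hmn using Nat.le_induction with
    | base => exact List.prefix_rfl
    | succ n _ ih => exact ih.trans (h n).1
  -- `f (k + 1)` has length at least `k + 1`, so the default `0` is never taken.
  refine ⟨hlen, hmono, fun k => (f (k + 1)).getD k 0, fun n => ?_⟩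
  refine List.ext_getElem (by simp) fun k hk _ => ?_
  have hk' : k < (f (k + 1)).length := hlen (k + 1)
  simp only [initial, List.getElem_map, List.getElem_range]
  rw [List.getD_eq_getElem _ _ hk']
  rcases le_total n (k + 1) with hle | hle
  · exact (hmono _ _ hle).getElem hk
  · exact ((hmono _ _ hle).getElem hk').symm

/-! ### Branches of the infinite unfolding as branches of the preproof -/

section

variable {P : SeqTree CGT} {d : ℕ → ℕ}

open Classical in
/-- The infinite branch through `P` that corresponds to a branch through its infinite unfolding
has additional steps at the buds; `(true, n)` stands for such a step after `n` rules. -/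
noncomputable def branchIndex (P : SeqTree CGT) (d : ℕ → ℕ) : ℕ → Bool × ℕ
  | 0 => (false, 0)
  | k + 1 =>
    match branchIndex P d k with
    | (true, n) => (false, n)
    | (false, n) =>
        (decide (∃ Γ l, P.label (run P (initial d (n + 1))).node = some (.bud Γ l)), n + 1)

/-- The nodes of this branch. -/
noncomputable def branchNode (P : SeqTree CGT) (d : ℕ → ℕ) (k : ℕ) : List ℕ :=
  if (branchIndex P d k).1 then (run P (initial d (branchIndex P d k).2)).node
  else loc P (initial d (branchIndex P d k).2)

theorem branchIndex_of_true {k : ℕ} (h : (branchIndex P d k).1 = true) :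
    ∃ Γ l, P.label (run P (initial d (branchIndex P d k).2)).node = some (.bud Γ l) := by
  cases k with
  | zero => simp [branchIndex] at h
  | succ k =>
    rw [branchIndex] at h ⊢
    split at h
    · simp at h
    · simpa using h

/-- At `(false, n)` the branch follows the rule after `n` steps of the unfolding; at `(true, n)` it
returns from a bud to its companion, which neither moves a trace nor gives it value `1`. So
`branchNode` is a branch to which the global trace condition applies. -/
theorem exists_branchStep (hd : ∀ n, IsNode P (initial d n)) (k : ℕ) :
    ∃ R, BranchStep cgtTrace P (branchNode P d k) (branchNode P d (k + 1)) R ∧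
      (∀ n, branchIndex P d k = (false, n) → ∀ r, P.label (loc P (initial d n)) = some (.rule r) →
        R = CRule.trace r (d n)) ∧
      (∀ n, branchIndex P d k = (true, n) → ∀ x b y, R x b y → b = false ∧ x = y) := by
  rcases hb : branchIndex P d k with ⟨b, n⟩
  cases b with
  | true =>
    obtain ⟨Γ, l, hl⟩ := branchIndex_of_true (P := P) (d := d) (k := k) (by simp [hb])
    rw [hb] at hl
    have h1 : branchNode P d k = (run P (initial d n)).node := by simp [branchNode, hb]
    have h2 : branchNode P d (k + 1) = (run P (initial d n)).node.take l := by
      simp only [branchNode, branchIndex, hb]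
      rw [if_neg (by simp), loc, resolve_of_bud hl]
    refine ⟨idRel (cgtTrace.obj Γ), ?_, by simp, ?_⟩
    · rw [h1, h2]
      exact .back _ _ _ (PTree.label_eq_bud.1 hl)
    · rintro m - x b y ⟨-, h, h'⟩
      exact ⟨h, h'⟩
  | false =>
    obtain ⟨r, hr, hi⟩ := hd (n + 1) (initial d n) (d n) (by rw [initial_succ])
    obtain ⟨ts, hts⟩ := PTree.label_eq_rule.1 hr
    have h1 : branchNode P d k = loc P (initial d n) := by simp [branchNode, hb]
    have h2 : branchNode P d (k + 1) = loc P (initial d n) ++ [d n] := by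
      rw [← node_concat, ← initial_succ]
      simp only [branchNode, branchIndex, hb]
      split_ifs with hbud
      · rfl
      · rw [loc, resolve]
        split
        · next Γ l hl => exact absurd (by simpa using ⟨Γ, l, hl⟩) hbud
        · rfl
    refine ⟨cgtTrace.mor r ⟨d n, hi⟩, ?_, ?_, by simp⟩
    · rw [h1, h2]
      exact .child _ r ts ⟨d n, hi⟩ hts
    · intro m hm r' hr'
      obtain rfl : n = m := by simpa using hm
      obtain rfl : r = r' := by simpa [hr] using hr'
      rfl

open Classical in
/-- The number of steps of the branch through `P` that correspond to `n` rules. -/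
noncomputable def branchTime (P : SeqTree CGT) (d : ℕ → ℕ) : ℕ → ℕ
  | 0 => 0
  | n + 1 => branchTime P d n +
      if ∃ Γ l, P.label (run P (initial d (n + 1))).node = some (.bud Γ l) then 2 else 1

theorem branchIndex_branchTime (n : ℕ) : branchIndex P d (branchTime P d n) = (false, n) := by
  induction n with
  | zero => rfl
  | succ n ih =>
    rw [branchTime]
    split_ifs with h
    · simp [branchIndex, ih, h]
    · simp [branchIndex, ih, h]

theorem branchTime_strictMono : StrictMono (branchTime P d) :=
  strictMono_nat_of_lt_succ fun n => by rw [branchTime]; split_ifs <;> omega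

/-- Every step of the branch belongs to a rule or is the return following one. With this, progress
somewhere on the branch can be attributed to a rule. -/
theorem exists_branchTime (k : ℕ) :
    ∃ n, k = branchTime P d n ∨ k = branchTime P d n + 1 ∧ branchIndex P d k = (true, n + 1) := by
  induction k with
  | zero => exact ⟨0, Or.inl rfl⟩
  | succ k ih =>
    obtain ⟨n, rfl | ⟨rfl, h⟩⟩ := ih
    · by_cases hb : ∃ Γ l, P.label (run P (initial d (n + 1))).node = some (.bud Γ l)
      · exact ⟨n, Or.inr ⟨rfl, by simp [branchIndex, branchIndex_branchTime, hb]⟩⟩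
      · exact ⟨n + 1, Or.inl (by rw [branchTime, if_neg hb])⟩
    · obtain ⟨Γ, l, hb⟩ := branchIndex_of_true (P := P) (d := d) (by rw [h])
      rw [h] at hb
      exact ⟨n + 1, Or.inl (by rw [branchTime, if_pos ⟨Γ, l, hb⟩])⟩

/-- In a proof, every branch of the infinite unfolding carries a trace with value `1` infinitely
often. -/
theorem exists_trace_run (hP : IsTraceProof true cgtTrace P)
    (hd : ∀ n, IsNode P (initial d n)) :
    ∃ (n₀ : ℕ) (y : ℕ → ℕ) (b : ℕ → Bool),
      (∀ n, n₀ ≤ n → ∀ r, P.label (loc P (initial d n)) = some (.rule r) →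
        CRule.trace r (d n) (y n) (b n) (y (n + 1))) ∧
      ∀ M, ∃ n, M ≤ n ∧ n₀ ≤ n ∧ b n = true := by
  choose τ h1 h2 h3 using exists_branchStep hd
  have h0 : branchNode P d 0 = [] := by
    change resolve P [] = []
    rw [resolve]
    split <;> simp
  obtain ⟨k₀, Y, B, hY, hB⟩ := (hP.2.2 (branchNode P d) τ h0 h1).exists_trace
  have hle : ∀ n, n ≤ branchTime P d n := branchTime_strictMono.id_le
  refine ⟨k₀, fun n => Y (branchTime P d n), fun n => B (branchTime P d n), ?_, ?_⟩
  · intro n hn r hr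
    have e := hY (branchTime P d n) (hn.trans (hle n))
    rw [h2 _ n (branchIndex_branchTime n) r hr] at e
    -- If a return to a companion comes in between, the trace stays put during it.
    have : Y (branchTime P d (n + 1)) = Y (branchTime P d n + 1) := by
      rw [branchTime]
      split_ifs with hb
      · have hi : branchIndex P d (branchTime P d n + 1) = (true, n + 1) := by
          simp [branchIndex, branchIndex_branchTime, hb]
        exact (h3 _ _ hi _ _ _ (hY (branchTime P d n + 1)
          ((hn.trans (hle n)).trans (Nat.le_succ _)))).2.symm
      · rfl
    rwa [← this] at e
  · intro M
    -- A step with value `1` is not a return. Searching beyond this time forces the index of the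
    -- rule to be at least both `M` and `k₀`.
    obtain ⟨k, hk1, hk2, hk3⟩ := hB (branchTime P d (max M k₀))
    obtain ⟨n, rfl | ⟨rfl, h⟩⟩ := exists_branchTime (P := P) (d := d) k
    · have := branchTime_strictMono.le_iff_le.1 hk1
      exact ⟨n, (le_max_left _ _).trans this, (le_max_right _ _).trans this, hk3⟩
    · have := (h3 _ _ h _ _ _ (hY _ hk2)).1
      rw [hk3] at this
      simp at this

/-! ### Bounds for contexts and letters, and the invariant of a branch -/

/-- A bound for the sizes of the contexts in `P`. -/
theorem exists_ctx_bound (P : SeqTree CGT) :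
    ∃ K, ∀ q Q, P.sub q = some Q → (SeqTree.endseq Q : CSeq).ctx.length ≤ K := by
  obtain ⟨K, hK⟩ := (P.finite_label.image fun q =>
    ((P.sub q).map fun Q => (SeqTree.endseq Q : CSeq).ctx.length).getD 0).bddAbove
  refine ⟨K, fun q Q hQ => ?_⟩
  have : P.label q ≠ none := by rw [Ne, PTree.label_eq_none, hQ]; simp
  simpa [hQ] using hK (Set.mem_image_of_mem _ this)

theorem ctx_length_run (hP : IsPreproof P) (ho : P.opens = []) {K : ℕ}
    (hK : ∀ q Q, P.sub q = some Q → (SeqTree.endseq Q : CSeq).ctx.length ≤ K) {a : List ℕ}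
    (ha : IsNode P a) : (run P a).seq.ctx.length ≤ K := by
  obtain ⟨⟨Q, hQ, hQe⟩, -⟩ := run_spec hP ho ha
  have := hK _ _ hQ
  rw [hQe] at this
  simpa [ASeq.strip, erase] using this

/-- After the reset at most `K` letters are in use, so the least unused one is again at most `K`. -/
theorem letter_le_run (hP : IsPreproof P) (ho : P.opens = []) {K : ℕ}
    (hK : ∀ q Q, P.sub q = some Q → (SeqTree.endseq Q : CSeq).ctx.length ≤ K) {a : List ℕ}
    (ha : IsNode P a) : ∀ c ∈ (run P a).seq.control, c ≤ K := by
  induction a using List.reverseRecOn with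
  | nil => simp [run, CSeq.annotate]
  | append_singleton a i ih =>
    intro c hc
    have ha' := ha.of_prefix (List.prefix_append _ _)
    obtain ⟨r, hr⟩ := exists_rule_loc hP ho ha'
    have hpr := run_premise hP ho ha hr
    obtain ⟨h1, h2, h3, h4⟩ := ASeq.lift_spec (afterReset_strip hP ho ha' hr)
    obtain ⟨Θ, hΘ, hΘ'⟩ := RSchema.control_prems h1 h4 (List.mem_of_getElem? hpr)
    rw [h2] at hΘ hΘ'
    have hle : ∀ c ∈ Θ, c ≤ K := fun c hc =>
      ih ha' c ((ASeq.afterReset_control _).subset (hΘ.subset hc))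
    rcases hΘ' with h | h
    · exact hle c (h ▸ hc)
    · rw [h, List.mem_append, List.mem_singleton] at hc
      rcases hc with hc | rfl
      · exact hle c hc
      · exact (fresh_le_length _).trans
          ((run_spec hP ho ha').2.afterReset_length (ctx_length_run hP ho hK ha') (ih ha'))

/-- The rules applied between two nodes of a branch. -/
theorem exists_hist (hr : ∀ n, ∃ r, P.label (loc P (initial d n)) = some (.rule r))
    {m n : ℕ} (h : m ≤ n) :
    ∃ L, (run P (initial d n)).hist = (run P (initial d m)).hist ++ L ∧
      ∀ R, R ∈ L ↔ ∃ k r, m ≤ k ∧ k < n ∧ P.label (loc P (initial d k)) = some (.rule r) ∧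
        R ∈ (run P (initial d k)).seq.chunk r := by
  induction n, h using Nat.le_induction with
  | base => exact ⟨[], by simp, fun R => ⟨by simp, by rintro ⟨k, r, h1, h2, -⟩; omega⟩⟩
  | succ n h ih =>
    obtain ⟨L, hL, hL'⟩ := ih
    obtain ⟨r, hr⟩ := hr n
    refine ⟨L ++ (run P (initial d n)).seq.chunk r, ?_, fun R => ?_⟩
    · rw [initial_succ, run_concat_of_rule hr, hL, List.append_assoc]
    · rw [List.mem_append, hL']
      constructor
      · rintro (⟨k, r', h1, h2, h3, h4⟩ | h')
        · exact ⟨k, r', h1, by omega, h3, h4⟩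
        · exact ⟨n, r, h, by omega, hr, h'⟩
      · rintro ⟨k, r', h1, h2, h3, h4⟩
        rcases (Nat.lt_succ_iff.1 h2).lt_or_eq with h5 | rfl
        · exact Or.inl ⟨k, r', h1, h5, h3, h4⟩
        · obtain rfl : r = r' := by simpa [hr] using h3
          exact Or.inr h4

/-- On every branch of the infinite unfolding of a proof, some letter is an invariant from some
point on. -/
theorem exists_invariant (hP : IsTraceProof true cgtTrace P)
    (hd : ∀ n, IsNode P (initial d n)) :
    ∃ N a p, (∀ n, N ≤ n → p ++ [a] <+: (run P (initial d n)).seq.control ∧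
        p ++ [a] <+: (run P (initial d n)).seq.afterReset.control) ∧
      ∀ M, ∃ n, M ≤ n ∧ ∃ R ∈ (run P (initial d n)).seq.resets, R.IsResetOf a := by
  obtain ⟨hP1, hP2, -⟩ := id hP
  obtain ⟨n₀, y, b, hy, hb⟩ := exists_trace_run hP hd
  obtain ⟨K, hK⟩ := exists_ctx_bound P
  set S : ℕ → ASeq := fun n => (run P (initial d n)).seq with hS
  have hT : ∀ n, (S n).Tidy := fun n => (run_spec hP1 hP2 (hd n)).2
  have hT' : ∀ n, (S n).afterReset.Tidy := fun n => (hT n).afterReset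
  choose r hr using fun n => exists_rule_loc hP1 hP2 (hd n)
  have hlift := fun n => ASeq.lift_spec (afterReset_strip hP1 hP2 (hd n) (hr n))
  have hprem : ∀ n, ((S n).afterReset.lift (r n)).prems[d n]? = some (S (n + 1)) := fun n => by
    simp only [hS, initial_succ]
    exact run_premise hP1 hP2 (by rw [← initial_succ]; exact hd (n + 1)) (hr n)
  have hcontrol : ∀ n, ∃ Θ : List ℕ, Θ.Sublist (S n).afterReset.control ∧
      ((S (n + 1)).control = Θ ∨
        (S (n + 1)).control = Θ ++ [fresh (S n).afterReset.control]) := fun n => by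
    have := RSchema.control_prems (hlift n).1 (hlift n).2.2.2 (List.mem_of_getElem? (hprem n))
    rwa [(hlift n).2.1] at this
  have hw : ∀ n, n₀ ≤ n → ∃ w, (anns (S n).afterReset.ctx)[y n]? = some w := by
    intro n hn
    obtain ⟨r', hr', hi⟩ := hd (n + 1) (initial d n) (d n) (by rw [initial_succ])
    obtain rfl : r' = r n := by simpa [hr] using hr'.symm
    have h1 : y n < numN (CRule.concl (r n)).ctx :=
      Finset.mem_range.1 (cgtTrace.mor_supp (r n) ⟨d n, hi⟩ _ _ _ (hy n hn _ (hr n))).1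
    rw [← afterReset_strip hP1 hP2 (hd n) (hr n), ASeq.strip, numN_erase] at h1
    exact ⟨_, List.getElem?_eq_getElem h1⟩
  -- `w n` is the traced annotation after the reset at the node. One step of the stack is thus a
  -- possible push by the rule there, followed by a possible truncation by the reset at the next
  -- node.
  choose w hw using fun n => hw (n₀ + n) (Nat.le_add_right _ _)
  have hsub : ∀ n, (w n).Sublist (S (n₀ + n)).afterReset.control := fun n =>
    ((hT' _).isSeq.2 _ (mem_anns.1 (List.mem_of_getElem? (hw n)))).1
  obtain ⟨N, a, hN, hR⟩ := exists_stable_letter (w := w) (b := fun n => b (n₀ + n))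
    (f := fun n => fresh (S (n₀ + n)).afterReset.control)
    (R := fun n c => ∃ R ∈ (S (n₀ + n)).resets, R.IsResetOf c) (L := K)
    (fun n => (hsub n).length_le.trans ((hT _).afterReset_length
      (ctx_length_run hP1 hP2 hK (hd _)) (letter_le_run hP1 hP2 hK (hd _))))
    (fun n => by
      have e := RSchema.trace_anns (hlift (n₀ + n)).1 (hlift (n₀ + n)).2.2.2 (hprem (n₀ + n))
        (hy (n₀ + n) (Nat.le_add_right _ _) _ (hr _)) (w := w n)
        (by rw [(hlift (n₀ + n)).2.1]; exact hw n)
      rw [(hlift (n₀ + n)).2.1] at e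
      obtain ⟨w', h1, h2⟩ := ASeq.anns_afterReset e
      obtain rfl : w' = w (n + 1) := Option.some.inj (h1.symm.trans (hw (n + 1)))
      refine h2.imp_right ?_
      rintro ⟨u, c, v, hv, h3, h4, h5⟩
      refine ⟨u, c, v, hv, h3, h4, (S (n₀ + (n + 1))).resetRule u c, ?_, rfl⟩
      rw [← add_assoc, h5]
      exact List.mem_singleton_self _)
    (fun M => by
      obtain ⟨n, h1, h2, h3⟩ := hb (n₀ + M)
      exact ⟨n - n₀, by omega, by rwa [Nat.add_sub_cancel' h2]⟩)
  have ha' : ∀ n, n₀ + N ≤ n → a ∈ (S n).afterReset.control := fun n hn => by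
    have := (hsub (n - n₀)).subset (hN (n - n₀) (by omega))
    rwa [Nat.add_sub_cancel' (by omega)] at this
  have ha : ∀ n, n₀ + N ≤ n → a ∈ (S n).control := fun n hn =>
    (ASeq.afterReset_control _).subset (ha' n hn)
  have hb1 : ∀ n, n₀ + N ≤ n →
      (before a (S n).afterReset.control).Sublist (before a (S n).control) := fun n hn =>
    before_sublist (ASeq.afterReset_control _) (hT n).isSeq.1 (ha' n hn)
  have hb2 : ∀ n, n₀ + N ≤ n →
      (before a (S (n + 1)).control).Sublist (before a (S n).afterReset.control) := by
    intro n hn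
    obtain ⟨Θ, hΘ, h | h⟩ := hcontrol n
    · have := ha (n + 1) (by omega)
      rw [h] at this ⊢
      exact before_sublist hΘ (hT' n).isSeq.1 this
    · have := ha (n + 1) (by omega)
      rw [h, List.mem_append, List.mem_singleton] at this
      -- The new letter differs from `a`, which is in use, so it is appended after `a` and leaves
      -- the part before `a` alone.
      have haΘ : a ∈ Θ := this.resolve_right fun e => fresh_notMem _ (e ▸ ha' n hn)
      rw [h, before_append haΘ]
      exact before_sublist hΘ (hT' n).isSeq.1 haΘ
  -- The part before `a` only shrinks, so it is constant from any point where its length is minimal.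
  obtain ⟨M, hM, hmin⟩ := WellFounded.has_min
    (InvImage.wf (fun n => (before a (S n).control).length) Nat.lt_wfRel.wf)
    {n | n₀ + N ≤ n} ⟨n₀ + N, by simp⟩
  have hconst : ∀ n, M ≤ n → before a (S n).control = before a (S M).control := by
    intro n hn
    induction n, hn using Nat.le_induction with
    | base => rfl
    | succ n hn ih =>
      have hn' : n₀ + N ≤ n := hM.trans hn
      have hs := (hb2 n hn').trans (hb1 n hn')
      rw [ih] at hs
      exact hs.eq_of_length (le_antisymm hs.length_le
        (not_lt.1 (hmin (n + 1) (by simpa using hn'.trans (Nat.le_succ n)))))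
  refine ⟨M, a, before a (S M).control, fun n hn => ?_, fun L => ?_⟩
  · have hn' : n₀ + N ≤ n := hM.trans hn
    refine ⟨?_, ?_⟩
    · rw [← hconst n hn]
      exact before_prefix (ha n hn')
    -- Between the reset and the rule, the part before `a` is squeezed between its equal values at
    -- `n` and `n + 1`.
    · have : before a (S n).afterReset.control = before a (S M).control := by
        refine (hconst n hn ▸ hb1 n hn').antisymm ?_
        have := hb2 n hn'
        rwa [hconst (n + 1) (hn.trans (Nat.le_succ n))] at this
      rw [← this]
      exact before_prefix (ha' n hn')
  · obtain ⟨n, hn, h⟩ := hR L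
    exact ⟨n₀ + n, by omega, h⟩

end

/-! ### Finitely many configurations, and no infinite chain of bad positions -/

theorem resets_concl {S : ASeq} {R : RSchema} (h : R ∈ S.resets) : R.concl = S := by
  rcases S.reset_cases with ⟨-, h', -⟩ | ⟨u, a, -, h', -⟩
  · simp [h'] at h
  · rw [h', List.mem_singleton] at h
    rw [h]
    rfl

/-- The annotated sequent at a node, as an element of a finite set. -/
theorem finite_run {P : SeqTree CGT} (hP : IsPreproof P) (ho : P.opens = []) :
    ((fun a => ((run P a).node, (run P a).seq)) '' {a | IsNode P a}).Finite := by
  obtain ⟨K, hK⟩ := exists_ctx_bound P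
  have hA := finite_lists (Set.finite_Iic K) (K + 1)
  -- The types need no coding, as the node of `P` determines them.
  set code : List ℕ × ASeq → List ℕ × List ℕ × List (List ℕ) :=
    fun x => (x.1, x.2.control, x.2.ctx.map Prod.snd) with hcode
  refine Set.Finite.of_finite_image (f := code)
    ((P.finite_label.prod (hA.prod (finite_lists hA K))).subset ?_) ?_
  · rintro _ ⟨_, ⟨a, ha, rfl⟩, rfl⟩
    have ha : IsNode P a := ha
    obtain ⟨⟨Q, hQ, -⟩, ht⟩ := run_spec hP ho ha
    have hl := letter_le_run hP ho hK ha
    have hlen : (run P a).seq.control.length ≤ K + 1 := by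
      have : (run P a).seq.control.toFinset ⊆ Finset.range (K + 1) := fun c hc =>
        Finset.mem_range.2 (Nat.lt_succ_of_le (hl c (List.mem_toFinset.1 hc)))
      have := Finset.card_le_card this
      rwa [List.toFinset_card_of_nodup ht.isSeq.1, Finset.card_range] at this
    refine ⟨?_, ⟨hlen, hl⟩, ?_, ?_⟩
    · change P.label (run P a).node ≠ none
      rw [Ne, PTree.label_eq_none, hQ]; simp
    · simpa [hcode] using ctx_length_run hP ho hK ha
    · intro u hu
      obtain ⟨p, hp, rfl⟩ := List.mem_map.1 hu
      have hs := (ht.isSeq.2 p hp).1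
      exact ⟨hs.length_le.trans hlen, fun c hc => hl c (hs.subset hc)⟩
  · rintro _ ⟨a, ha, rfl⟩ _ ⟨b, hb, rfl⟩ h
    simp only [hcode, Prod.mk.injEq] at h
    obtain ⟨h1, h2, h3⟩ := h
    obtain ⟨⟨Q, hQ, hQe⟩, -⟩ := run_spec hP ho ha
    obtain ⟨⟨Q', hQ', hQe'⟩, -⟩ := run_spec hP ho hb
    rw [h1, hQ', Option.some.injEq] at hQ
    have h4 : (run P a).seq.strip = (run P b).seq.strip := by rw [← hQe, ← hQ, hQe']
    simp only [ASeq.strip, CSeq.mk.injEq] at h4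
    have h5 : (run P a).seq.ctx = (run P b).seq.ctx := by
      rw [← List.zip_unzip (run P a).seq.ctx, ← List.zip_unzip (run P b).seq.ctx]
      have h6 := h4.1
      simp only [erase] at h6
      simp only [List.unzip_eq_map, h6, h3]
    refine Prod.ext h1 ?_
    change (run P a).seq = (run P b).seq
    revert h2 h4 h5
    generalize (run P a).seq = S
    generalize (run P b).seq = T
    cases S; cases T
    rintro rfl ⟨-, rfl⟩ rfl
    rfl

/-- Bad positions cannot be extended indefinitely. -/
theorem wellFounded_badExt {P : SeqTree CGT} (hP : IsTraceProof true cgtTrace P) :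
    WellFounded (BadExt P) := by
  rw [wellFounded_iff_isEmpty_descending_chain]
  refine ⟨fun ⟨f, hf⟩ => ?_⟩
  obtain ⟨hlen, hmono, d, hd⟩ := exists_branch fun n => (hf n).2.2
  have hbad : ∀ n, Bad P (f n) := fun n => (hf n).2.1
  have hnode : ∀ n, IsNode P (initial d n) := fun n =>
    (hbad n).1.of_prefix (by rw [hd n]; exact initial_prefix d (hlen n))
  have hrule := fun n => exists_rule_loc hP.1 hP.2.1 (hnode n)
  obtain ⟨N, a, p, hN, hR⟩ := exists_invariant hP hnode
  have hfin := (finite_run hP.1 hP.2.1).to_subtype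
  obtain ⟨⟨x, hx⟩, hinf⟩ := Finite.exists_infinite_fiber fun n =>
    (⟨_, f n, (hbad n).1, rfl⟩ :
      (fun a => ((run P a).node, (run P a).seq)) '' {a | IsNode P a})
  have hinf' := Set.infinite_coe_iff.1 hinf
  -- The order of choices is `f i` where the invariant already holds, then a reset of `a` above `f
  -- i`, then `f j` above this reset with the same node and annotation as `f i`. So `f j` can be
  -- closed at `f i`, although it is bad.
  obtain ⟨i, hi, hiN⟩ := hinf'.exists_gt N
  obtain ⟨n, hn, R, hRn, hRa⟩ := hR (f i).length
  obtain ⟨j, hj, hjn⟩ := hinf'.exists_gt (max i n)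
  have hij : f i <+: f j := hmono i j ((le_max_left _ _).trans hjn.le)
  have hnj : n < (f j).length := ((le_max_right _ _).trans_lt hjn).trans_le (hlen j)
  have hlt : (f i).length < (f j).length := lt_of_le_of_lt hn hnj
  have htake : (f j).take (f i).length = f i := (List.prefix_iff_eq_take.1 hij).symm
  have heq : ((run P (f i)).node, (run P (f i)).seq) = ((run P (f j)).node, (run P (f j)).seq) := by
    have h1 := congrArg Subtype.val (Set.mem_singleton_iff.1 hi)
    have h2 := congrArg Subtype.val (Set.mem_singleton_iff.1 hj)
    exact h1.trans h2.symm
  rw [Prod.mk.injEq] at heq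
  obtain ⟨L, hL, hL'⟩ := exists_hist (d := d) hrule hlt.le
  rw [← hd i, ← hd j] at hL
  have hNi : N ≤ (f i).length := hiN.le.trans (hlen i)
  refine (hbad j).2.2 ⟨(f i).length, hlt, ?_, ?_, p, a, ?_, ?_, ?_⟩
  · rw [htake, loc, loc, heq.1]
  · rw [htake, heq.2]
  · rw [hd j]
    exact (hN _ (hNi.trans hlt.le)).1
  · rw [htake, hL, List.drop_left]
    intro R' hR'
    obtain ⟨k, r, h1, h2, h3, h4⟩ := (hL' R').1 hR'
    rcases List.mem_append.1 h4 with h4 | h4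
    · rw [resets_concl h4]
      exact (hN k (hNi.trans h1)).1
    · rw [List.mem_singleton.1 h4,
        (ASeq.lift_spec (afterReset_strip hP.1 hP.2.1 (hnode k) h3)).2.1]
      exact (hN k (hNi.trans h1)).2
  · rw [htake, hL, List.drop_left]
    obtain ⟨r, hr⟩ := hrule n
    exact ⟨R, (hL' R).2 ⟨n, r, hn, hnj, hr, List.mem_append_left _ hRn⟩, hRa⟩

/-! ### Building the reset proof -/

/-- The form of a rule of reset Gödel's T. -/
def RGT.schema (ρ : RGT.Rule) : RSchema := ρ.1

/-- The bud condition of reset Gödel's T, for a tree placed above the rules `H`. -/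
def BudsClosed : SeqTree RGT → List RGT.Rule → Prop
  | .opn _, _ => True
  | .bud Γ l, H => ∃ (p : List ℕ) (a : ℕ), p ++ [a] <+: Γ.1.control ∧
      (∀ R ∈ H.drop l, p ++ [a] <+: (RGT.schema R).concl.control) ∧
      ∃ R ∈ H.drop l, (RGT.schema R).IsResetOf a
  | .node r ts, H => ∀ i, BudsClosed (ts i) (H ++ [r])

theorem BudsClosed.sub {P Q : SeqTree RGT} {H : List RGT.Rule} {a : List ℕ}
    (h : BudsClosed P H) (hQ : P.sub a = some Q) :
    ∃ H' : List RGT.Rule, H'.length = a.length ∧ BudsClosed Q (H ++ H') ∧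
      ∀ k (hk : k < H'.length), P.label (a.take k) = some (.rule H'[k]) := by
  induction a generalizing P H with
  | nil =>
    simp at hQ
    subst hQ
    exact ⟨[], rfl, by simpa using h, by simp⟩
  | cons i a ih =>
    cases P with
    | opn v => simp [PTree.sub] at hQ
    | bud Γ l => simp [PTree.sub] at hQ
    | node r ts =>
      simp only [PTree.sub] at hQ
      split_ifs at hQ with hi
      obtain ⟨H', h1, h2, h3⟩ := ih (h ⟨i, hi⟩) hQ
      refine ⟨r :: H', by simp [h1], by simpa using h2, ?_⟩
      rintro (_ | k) hk
      · rfl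
      · simpa [PTree.label, PTree.sub, hi] using h3 k (by simpa using hk)

/-- `BudsClosed` is the version of the bud condition suited to building a tree from its leaves. The
rules in `H.drop l` are those from the companion up to just below the bud, and the control of the
bud itself is treated separately. -/
theorem BudsClosed.hasInvariant {P : SeqTree RGT} (h : BudsClosed P []) {t : List ℕ}
    {Γ : RGT.Seq} {l : ℕ} (ht : P.label t = some (.bud Γ l)) : ∃ a, HasInvariant P t l a := by
  obtain ⟨H, h1, ⟨p, a, hp, h2, R, hR, hRa⟩, h3⟩ := h.sub (PTree.label_eq_bud.1 ht)
  rw [List.nil_append] at h2 hR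
  refine ⟨a, ⟨p, fun k hlk hkt Q hQ => ?_⟩, ?_⟩
  · rcases hkt.lt_or_eq with hk | rfl
    · rw [← h1] at hk
      obtain ⟨ts, hts⟩ := PTree.label_eq_rule.1 (h3 k hk)
      rw [hts, Option.some.injEq] at hQ
      subst hQ
      refine h2 _ ?_
      rw [List.mem_drop_iff_getElem]
      exact ⟨k - l, by omega, by simp [Nat.add_sub_cancel' hlk]⟩
    · rw [List.take_length, PTree.label_eq_bud.1 ht, Option.some.injEq] at hQ
      subst hQ
      exact hp
  · obtain ⟨k, hk, rfl⟩ := List.mem_drop_iff_getElem.1 hR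
    exact ⟨l + k, _, Nat.le_add_right _ _, by omega, h3 (l + k) (by omega), hRa⟩

/-- Embedding and stripping a rule that comes from the rule `r` yields `r`. -/
theorem strip_embed_node {ρ : RGT.Rule} {r : CGT.Rule} (h : (RGT.schema ρ).strip = some r)
    {Rs : Fin (RGT.arity ρ) → SeqTree RGT} {ts : Fin (CGT.arity r) → SeqTree CGT}
    {env env' : List ℕ} {d n : ℕ}
    (h1 : ∀ i j, i.1 = j.1 → (strip CGT true cgtTrace).trans
      (embed.trans (Rs i) (env ++ [d]) (d + 1)) (env' ++ [n]) (n + 1) = ts j)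
    (h2 : ∀ i j, i.1 = j.1 → (strip CGT true cgtTrace).trans
      (embed.trans (Rs i) (env ++ [d]) (d + 1 + 1)) (env' ++ [n] ++ [n + 1]) (n + 1) = ts j) :
    (strip CGT true cgtTrace).trans (embed.trans (.node ρ Rs) env d) env' n = .node r ts := by
  -- A population is one more node in the image under `embed`, hence the depth `d + 1 + 1` and the
  -- extra entry of the environment of `strip`. It vanishes under `strip`, so the final depth
  -- remains `n + 1`. This is why the premises are assumed in two versions, `h1` and `h2`.
  have hpop : ∀ {V : Type} (Θ : List ℕ) (Γ : List AFm) (B C : Ty)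
      (h : ASeq.IsSeq ⟨Θ, Γ ++ [(B, [])], C⟩) (v : V) (k : V → ℕ → SeqTree RCGT)
      (T : SeqTree CGT),
      (strip CGT true cgtTrace).trans (k v (d + 1)) (env' ++ [n]) (n + 1) = T →
      (strip CGT true cgtTrace).trans (k v (d + 1 + 1)) (env' ++ [n] ++ [n + 1]) (n + 1) = T →
      (strip CGT true cgtTrace).trans ((popIf Θ Γ B C h v).graft k d (d + 1)) (env' ++ [n])
        (n + 1) = T := by
    intro V Θ Γ B C h v k T hk1 hk2
    unfold popIf
    split_ifs
    · exact hk2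
    · exact hk1
  obtain ⟨ρ, hρ⟩ := ρ
  cases ρ
  case reset => exact absurd h (Option.some_ne_none r).symm
  all_goals
    obtain rfl := Option.some.inj h
    refine congrArg (PTree.node _) (funext fun j => ?_)
  case id | zero | succ => exact (show Fin 0 from j).elim0
  case impL =>
    revert j
    refine Fin.forall_fin_two.2 ⟨?_, ?_⟩
    · exact h1 (0 : Fin 2) (0 : Fin 2) rfl
    · exact hpop _ _ _ _ (impL_isSeq' hρ.2.1) (1 : Fin 2) _ _
        (h1 (1 : Fin 2) (1 : Fin 2) rfl) (h2 (1 : Fin 2) (1 : Fin 2) rfl)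
  case cut =>
    revert j
    refine Fin.forall_fin_two.2 ⟨?_, ?_⟩
    · exact h1 (0 : Fin 2) (0 : Fin 2) rfl
    · exact hpop _ _ _ _ (hρ.2.2 _ (List.mem_cons_of_mem _ List.mem_cons_self)) (1 : Fin 2) _ _
        (h1 (1 : Fin 2) (1 : Fin 2) rfl) (h2 (1 : Fin 2) (1 : Fin 2) rfl)
  case impR =>
    revert j
    refine Fin.forall_fin_one.2 ?_
    exact hpop _ _ _ _ (hρ.2.2 _ List.mem_cons_self) (0 : Fin 1) _ _
      (h1 (0 : Fin 1) (0 : Fin 1) rfl) (h2 (0 : Fin 1) (0 : Fin 1) rfl)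
  case cond | ex | wk | ctr => exact h1 _ _ rfl

/-! ### Depths of companions under the two translations, and realization of trees -/

/-- The nodes of `env'`, at the positions that `env` lists for the marked nodes, are the images
of the marked nodes, in this order. -/
def EnvMarks (M env env' : List ℕ) : Prop :=
  ∀ m (h : m < M.length), M[m] < env.length ∧ env.getD M[m] 0 < env'.length ∧
    env'.getD (env.getD M[m] 0) 0 = m

theorem EnvMarks.append {M env env' : List ℕ} (h : EnvMarks M env env') (L L' : List ℕ) :
    EnvMarks M (env ++ L) (env' ++ L') := by
  intro m hm
  obtain ⟨h1, h2, h3⟩ := h m hm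
  have e : (env ++ L).getD M[m] 0 = env.getD M[m] 0 := List.getD_append _ _ _ _ h1
  refine ⟨by rw [List.length_append]; omega, by rw [e, List.length_append]; omega, ?_⟩
  rw [e, List.getD_append _ _ _ _ h2, h3]

/-- The marked node has depth `env.length` in the reset proof, `env'.length` in its embedding and
`M.length` after stripping. -/
theorem EnvMarks.mark {M env env' : List ℕ} (h : EnvMarks M env env') :
    EnvMarks (M ++ [env.length]) (env ++ [env'.length]) (env' ++ [M.length]) := by
  intro m hm
  rcases Nat.lt_or_ge m M.length with hm' | hm'
  · simp only [List.getElem_append_left hm']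
    exact h.append _ _ m hm'
  · obtain rfl : m = M.length := by simp at hm; omega
    simp

/-- The tree `R`, placed above the rules `H`, is a part of a reset proof with annotated
endsequent `S`, whose image at depth `n` under embedding and stripping is `T`; the list `M`
contains the depths of the nodes to which the nodes below `T` correspond. -/
structure Realizes (H : List RGT.Rule) (M : List ℕ) (n : ℕ) (S : ASeq) (R : SeqTree RGT)
    (T : SeqTree CGT) : Prop where
  endseq : R.endseq.1 = S
  opens : R.opens = []
  wf : R.Wf id (H.map RGT.concl)
  buds : BudsClosed R H
  image : ∀ env env' : List ℕ, env.length = H.length → EnvMarks M env env' →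
    (strip CGT true cgtTrace).trans (embed.trans R env env'.length) env' n = T

/-- A reset is erased by `strip`, so the depth `M.length` of the image is the same above and below
it. The mark is placed at the reset and not at the rule above, since buds return to the sequent
before the reset. -/
theorem Realizes.reset {H : List RGT.Rule} {M : List ℕ} {S S' : ASeq} {R : SeqTree RGT}
    {T : SeqTree CGT} {ρ : RGT.Rule} {Θ : List ℕ} {Γ : List AFm} {B : Ty} {u : List ℕ} {a : ℕ}
    (hρ : RGT.schema ρ = .reset Θ Γ B u a) (hS : (RGT.schema ρ).concl = S)
    (hS' : (RGT.schema ρ).prems = [S'])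
    (h : Realizes (H ++ [ρ]) (M ++ [H.length]) M.length S' R T) :
    Realizes H M M.length S (.node ρ fun _ => R) T := by
  obtain ⟨ρ, hside⟩ := ρ
  change ρ = _ at hρ
  subst hρ
  subst hS
  simp only [RGT.schema, RSchema.prems, List.cons.injEq, and_true] at hS'
  subst hS'
  refine ⟨rfl, ?_, ?_, ?_, ?_⟩
  · change [PTree.opens R].flatten = []
    simp [h.opens]
  · refine Fin.forall_fin_one.2 ⟨Subtype.ext h.endseq, ?_⟩
    have := h.wf
    rwa [List.map_append] at this
  · exact fun _ => h.buds
  · intro env env' he hM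
    have := h.image (env ++ [env'.length]) (env' ++ [M.length])
      (by rw [List.length_append, List.length_append, he]; rfl) (he ▸ hM.mark)
    rw [List.length_append, List.length_singleton] at this
    exact this

/-- `hM` allows both cases: the rule receives the mark itself, or a reset directly below has
received it. A population above a premise only lengthens the environments, over which `image`
quantifies. -/
theorem Realizes.rule {H : List RGT.Rule} {M M' : List ℕ} {n : ℕ} {ρ : RGT.Rule}
    {r : CGT.Rule} (hr : (RGT.schema ρ).strip = some r) {Rs : Fin (RGT.arity ρ) → SeqTree RGT}
    {ts : Fin (CGT.arity r) → SeqTree CGT}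
    (hM : ∀ env env', env.length = H.length → EnvMarks M env env' →
      EnvMarks M' (env ++ [env'.length]) (env' ++ [n]))
    (h : ∀ i j, i.1 = j.1 → Realizes (H ++ [ρ]) M' (n + 1) (RGT.prem ρ i).1 (Rs i) (ts j)) :
    Realizes H M n (RGT.schema ρ).concl (.node ρ Rs) (.node r ts) := by
  have harity : RGT.arity ρ = CGT.arity r := by
    have := congrArg List.length (RSchema.strip_prems hr)
    rwa [List.length_map] at this
  have h' : ∀ i, Realizes (H ++ [ρ]) M' (n + 1) (RGT.prem ρ i).1 (Rs i) (ts (i.cast harity)) :=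
    fun i => h i _ rfl
  refine ⟨rfl, ?_, fun i => ⟨Subtype.ext (h' i).endseq, ?_⟩, fun i => (h' i).buds, ?_⟩
  · rw [PTree.opens, List.flatten_eq_nil_iff]
    intro l hl
    obtain ⟨i, rfl⟩ := List.mem_ofFn.1 hl
    exact (h' i).opens
  · have := (h' i).wf
    rwa [List.map_append] at this
  · intro env env' he hE
    refine strip_embed_node hr (fun i j hij => ?_) (fun i j hij => ?_)
    · have := (h i j hij).image (env ++ [env'.length]) (env' ++ [n]) (by simp [he]) (hM _ _ he hE)
      rwa [List.length_append] at this
    · have := (h i j hij).image (env ++ [env'.length]) (env' ++ [n] ++ [n + 1]) (by simp [he])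
        (by simpa using (hM _ _ he hE).append [] [n + 1])
      rwa [List.length_append, List.length_append] at this

/-- The lengths of the histories at the nodes below `a`. -/
noncomputable def marks (P : SeqTree CGT) (a : List ℕ) : List ℕ :=
  (List.range a.length).map fun m => (run P (a.take m)).hist.length

theorem marks_concat (P : SeqTree CGT) (a : List ℕ) (i : ℕ) :
    marks P (a ++ [i]) = marks P a ++ [(run P a).hist.length] := by
  unfold marks
  rw [List.length_append, List.length_singleton, List.range_succ, List.map_append]
  congr 1
  · refine List.map_congr_left fun m hm => ?_
    rw [List.take_append_of_le_length (List.mem_range.1 hm).le]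
  · simp

theorem hist_prefix (P : SeqTree CGT) (a b : List ℕ) :
    (run P a).hist <+: (run P (a ++ b)).hist := by
  induction b using List.reverseRecOn with
  | nil => simp
  | append_singleton b i ih =>
    refine ih.trans ?_
    rw [← List.append_assoc, run_concat, Conf.next]
    split <;> simp

theorem chunk_eq (S : ASeq) (r : CGT.Rule) : S.chunk r = S.resets ++ [S.afterReset.lift r] := rfl

/-- A bud returns to the first rule of its companion's chunk, whose conclusion must therefore be the
sequent before the reset. -/
theorem chunk_head {S : ASeq} {r : CRule} (h : S.strip = r.concl) :
    ∃ R L, S.chunk r = R :: L ∧ R.concl = S := by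
  rcases S.reset_cases with ⟨-, h1, h2⟩ | ⟨u, a, -, h1, -⟩
  · exact ⟨_, [], by rw [ASeq.chunk, h1]; rfl, by rw [h2]; exact (ASeq.lift_spec h).2.1⟩
  · exact ⟨_, _, by rw [ASeq.chunk, h1]; rfl, rfl⟩

/-- An annotated rule as a rule of reset Gödel's T. -/
theorem exists_rule {R : RSchema} (hs : R.Side) (ht : R.concl.Tidy) :
    ∃ ρ : RGT.Rule, RGT.schema ρ = R :=
  ⟨⟨R, hs, ht.isSeq, fun _ hp => (RSchema.tidy_prems ht hs hp).isSeq⟩, rfl⟩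

/-- Every inner node is replaced by its chunk, and every bud returns to the depth given by the
length of the history at its companion. `GoodAt` supplies what is needed there: equal annotated
sequents for well-formedness, and an invariant letter for `BudsClosed`. -/
theorem IsPart.exists_realizes {P Q : SeqTree CGT} {o : List ℕ → List ℕ} (hP : IsPreproof P)
    (ho : P.opens = []) (h : IsPart P Q o)
    (hgood : ∀ a Γ m, Q.label a = some (.bud Γ m) → GoodAt P a m) (T : SeqTree CGT) :
    ∀ (a : List ℕ) (H : List RGT.Rule), Q.sub a = some T →
      H.map RGT.schema = (run P a).hist →
      ∃ R, Realizes H (marks P a) a.length (run P a).seq R T := by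
  induction T with
  | opn v => exact fun a H ha _ => absurd (PTree.label_eq_opn.2 ha) (h.opn a v)
  | bud Γ m =>
    intro a H ha hH
    have hb := PTree.label_eq_bud.2 ha
    have hnode : IsNode P a := h.isNode (by simp [hb])
    obtain ⟨⟨Q', hQ', hQe⟩, hT⟩ := run_spec hP ho hnode
    obtain ⟨h1, -, ⟨l, hl, -⟩, -⟩ := h.bud a Γ m hb
    obtain ⟨hm, h2, h3, p, c, h4, h5, R₀, h6, h7⟩ := hgood a Γ m hb
    have hΓ : Γ = (run P a).seq.strip := by
      rw [h1, PTree.label_eq_bud, hQ', Option.some.injEq] at hl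
      subst hl
      exact hQe
    have hmarks : m < (marks P a).length := by simpa [marks] using hm
    have hmark : (marks P a)[m] = (run P (a.take m)).hist.length := by simp [marks]
    refine ⟨.bud ⟨(run P a).seq, hT.isSeq⟩ (run P (a.take m)).hist.length, rfl, rfl, ?_, ?_, ?_⟩
    · have hnode' : IsNode P (a.take m) := hnode.of_prefix (List.take_prefix _ _)
      obtain ⟨r, hr⟩ := exists_rule_loc hP ho hnode'
      obtain ⟨R, L, hR, hRc⟩ := chunk_head (strip_eq_concl hP ho hnode' hr)
      -- The history at the companion does not yet contain its own chunk, so the entry of `H` at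
      -- this depth is the first rule of that chunk.
      have hpre : (run P (a.take m)).hist ++ R :: L <+: (run P a).hist := by
        have := hist_prefix P (a.take (m + 1)) (a.drop (m + 1))
        rw [List.take_append_drop, List.take_succ_eq_append_getElem hm,
          run_concat_of_rule hr] at this
        exact hR ▸ this
      obtain ⟨L', hL'⟩ := hpre
      rw [← hL', List.append_assoc] at hH
      obtain ⟨H₁, H₂, rfl, hH₁, hH₂⟩ := List.map_eq_append_iff.1 hH
      obtain ⟨ρ, H₃, rfl, hρ, -⟩ := List.map_eq_cons_iff.1 hH₂
      change (List.map RGT.concl _)[_]? = _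
      rw [← hH₁, List.length_map]
      rw [List.map_append, List.map_cons, List.getElem?_append_right (by simp)]
      simp only [List.length_map, Nat.sub_self, List.getElem?_cons_zero]
      refine congrArg some (Subtype.ext ?_)
      change (RGT.schema ρ).concl = _
      rw [hρ, hRc, h3]
    · have hdrop : (H.drop (run P (a.take m)).hist.length).map RGT.schema =
          (run P a).hist.drop (run P (a.take m)).hist.length := by rw [List.map_drop, hH]
      rw [← hdrop] at h5 h6
      obtain ⟨ρ, hρ, rfl⟩ := List.mem_map.1 h6
      exact ⟨p, c, h4, fun R hR => h5 _ (List.mem_map_of_mem hR), ρ, hρ, h7⟩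
    · intro env env' he hM
      have := (hM m hmarks).2.2
      rw [hmark] at this
      subst hΓ
      change PTree.bud _ _ = _
      rw [this]
      rfl
  | node r ts ih =>
    intro a H ha hH
    have hlab := PTree.label_eq_rule.2 ⟨ts, ha⟩
    have hnode : IsNode P a := h.isNode (by simp [hlab])
    have hr := (h.rule a r hlab).1
    obtain ⟨-, hT⟩ := run_spec hP ho hnode
    obtain ⟨hl1, hl2, hl3, -⟩ := ASeq.lift_spec (afterReset_strip hP ho hnode hr)
    have hT' := hT.afterReset
    rw [← hl2] at hT'
    obtain ⟨ρ, hρ⟩ := exists_rule hl3 hT'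
    have hlen : (marks P a).length = a.length := by simp [marks]
    have hHlen : H.length = (run P a).hist.length := by rw [← hH, List.length_map]
    have hsub : ∀ j : Fin (CGT.arity r), Q.sub (a ++ [j.1]) = some (ts j) := fun j =>
      PTree.sub_append_singleton.2 ⟨r, ts, ha, j.2, rfl⟩
    have harity : RGT.arity ρ = CGT.arity r := by
      have := congrArg List.length (RSchema.strip_prems hl1)
      rw [List.length_map] at this
      change (RGT.schema ρ).prems.length = _
      rw [hρ]
      exact this
    have hprem : ∀ (i : Fin (RGT.arity ρ)), (run P (a ++ [i.1])).seq = (RGT.prem ρ i).1 := by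
      intro i
      have h1 := run_premise hP ho (a := a) (i := i.1)
        (h.isNode fun hn => by
          have := (PTree.label_eq_none.1 hn).symm.trans (hsub (i.cast harity))
          simp at this) hr
      rw [← hρ] at h1
      exact (List.getElem?_eq_some_iff.1 h1).2.symm
    have hconcl : (RGT.schema ρ).concl = (run P a).seq.afterReset := by rw [hρ, hl2]
    have hstrip : (RGT.schema ρ).strip = some r := by rw [hρ]; exact hl1
    have hchildren : ∀ H', (H' ++ [ρ]).map RGT.schema = (run P a).hist ++ (run P a).seq.chunk r →
        ∃ Rs : Fin (RGT.arity ρ) → SeqTree RGT, ∀ i j, i.1 = j.1 →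
          Realizes (H' ++ [ρ]) (marks P a ++ [H.length]) (a.length + 1) (RGT.prem ρ i).1
            (Rs i) (ts j) := by
      intro H' hH'
      have hex := fun j : Fin (CGT.arity r) => ih j (a ++ [j.1]) (H' ++ [ρ]) (hsub j)
        (by rw [hH', run_concat_of_rule hr])
      choose Rs hRs using hex
      refine ⟨fun i => Rs (i.cast harity), fun i j hij => ?_⟩
      obtain rfl : j = i.cast harity := Fin.ext hij.symm
      have := hRs (i.cast harity)
      rw [marks_concat, List.length_append, ← hHlen] at this
      rw [← hprem i]
      exact this
    rcases (run P a).seq.reset_cases with ⟨-, hres, hres'⟩ | ⟨u, c, hside, hres, hres'⟩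
    · obtain ⟨Rs, hRs⟩ := hchildren H (by
        rw [List.map_append, hH, chunk_eq, hres, List.map_singleton, hρ]; rfl)
      -- Without a reset the rule begins the chunk and bears the mark.
      have := Realizes.rule (M := marks P a) (n := a.length) hstrip (Rs := Rs) (ts := ts)
        (fun env env' he hE => by have := hE.mark; rwa [he, hlen] at this) hRs
      rw [hconcl, hres'] at this
      exact ⟨_, this⟩
    · obtain ⟨ρ₀, hρ₀⟩ := exists_rule hside hT
      obtain ⟨Rs, hRs⟩ := hchildren (H ++ [ρ₀]) (by
        rw [List.map_append, List.map_append, hH, chunk_eq, hres, List.map_singleton,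
          List.map_singleton, hρ, hρ₀, List.append_assoc])
      have := Realizes.rule (M := marks P a ++ [H.length]) (n := a.length) hstrip (Rs := Rs)
        (ts := ts) (fun env env' _ hE => hE.append _ _) hRs
      rw [hconcl, ← hlen] at this
      have := Realizes.reset (S := (run P a).seq) hρ₀ (by rw [hρ₀]; rfl) (by rw [hρ₀, hres']) this
      rw [hlen] at this
      exact ⟨_, this⟩

end CyclicProofs

theorem mainTheorem8 (s : CyclicProofs.CSeq) (P : CyclicProofs.SeqTree CyclicProofs.CGT)
    (hP : CyclicProofs.IsCGTProofOf P s) :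
    ∃ P' : CyclicProofs.SeqTree CyclicProofs.RGT,
      CyclicProofs.IsRGTProofOf P' s ∧
        CyclicProofs.IsUnfolding P
          ((CyclicProofs.strip CyclicProofs.CGT true CyclicProofs.cgtTrace).apply
            (CyclicProofs.embed.apply P')) := by
  obtain ⟨hP, rfl⟩ := hP
  obtain ⟨Q, o, hQ, hpart, hgood⟩ := CyclicProofs.IsPart.exists_unfolding
    (CyclicProofs.wellFounded_badExt hP) .refl (CyclicProofs.isPart_self hP.1 hP.2.1)
  obtain ⟨R, hR⟩ := hpart.exists_realizes hP.1 hP.2.1 hgood Q [] [] (CyclicProofs.PTree.sub_nil Q)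
    rfl
  refine ⟨R, ⟨⟨hR.wf, hR.opens, fun t Γ l ht => hR.buds.hasInvariant ht⟩,
    Subtype.ext hR.endseq⟩, o, ?_⟩
  -- At the root there are no marked ancestors, so the condition on the environments is vacuous.
  have himage := hR.image [] [] rfl fun m hm => absurd hm (by simp [CyclicProofs.marks])
  exact (congrArg (fun T => CyclicProofs.UnfoldsTo P T o) himage).mpr hQ
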